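/- Let $\alpha>0$, $\gamma\ge 0$, $c_0,c_1,c_2,c_3\in\mathbb R$ and $L,T,M>0$. For $0<\varepsilon\le1$ and integers $I,J\ge1$ put $h=L/I$, $\tau=T/J$, $x_i=ih$, and regard grid functions as functions of $i\in\mathbb Z$ that vanish for $i\le 2$ and for $i\ge I-2$. Write $f_x=(f_{i+1}-f_i)/h$, $f_{\bar x}=(f_i-f_{i-1})/h$, $f_{\dot x}=\tfrac12(f_x+f_{\bar x})$, $\partial_{\dot x}f=f_{\dot x}$, $\gamma_h=\gamma(1-h)$, $$Q_1(y)=\tfrac12\{y^2y_{\dot x}+y(y^2)_{\dot x}+(y^3)_{\dot x}\},\qquad Q_2(y)=\partial_{\dot x}\Big\{c_2y_xy_{\bar x}+\tfrac{c_3}2\big(2yy_{x\bar x}+(y_x)^2-2y_xy_{\bar x}+(y_{\bar x})^2\big)\Big\},$$ $$R_1(u,v)=\tfrac12\{u^2v_{\dot x}+2u(uv)_{\dot x}+3(u^2v)_{\dot x}+2uvu_{\dot x}+v(u^2)_{\dot x}\},$$ $$R_2(u,v)=\partial_{\dot x}\big\{(c_2-c_3)(u_xv_{\bar x}+u_{\bar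 x}v_x)+c_3(uv_{x\bar x}+u_xv_x+u_{\bar x}v_{\bar x}+u_{x\bar x}v)\big\}.$$ Given a time level $\check y$, the next level $y$ of the nonlinear implicit scheme is a solution of $$y-\alpha^2\varepsilon^2y_{x\bar x}+\tau\{c_0y_{\dot x}+c_1Q_1(y)+\varepsilon^2(\gamma_hy_{x\bar x\dot x}+\gamma hy_{x\bar xx})-\varepsilon^2Q_2(y)\}=\check y-\alpha^2\varepsilon^2\check y_{x\bar x}\qquad(\mathrm N)$$ at the nodes $i=3,\dots,I-3$ (with $y_i=0$ at all other $i$), and the linearization iterates are $\varphi(0)=\check y$ and, for $s\ge1$ and with $\bar\varphi=\varphi(s-1)$, the solution $\varphi=\varphi(s)$ of $$\varphi-\alpha^2\varepsilon^2\varphi_{x\bar x}+\tau\{c_0\varphi_{\dot x}+c_1R_1(\bar\varphi,\varphi)+\varepsilon^2(\gamma_h\varphi_{x\bar x\dot x}+\gamma h\varphi_{x\bar xx})-\varepsilon^2R_2(\bar\varphi,\varphi)\}=\check y-\alpha^2\varepsilon^2\check y_{x\bar x}+\tau\{2c_1Q_1(\bar\varphi)-\varepsilon^2Q_2(\bar\varphi)\}\qquad(\mathrm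 L)$$ at the same nodes, with $\varphi_i=0$ at all other $i$. Let $\|f\|^2=h\sum_{i=1}^{I-1}|f_i|^2$ and $\|f\|_{(2,\tau)}^2=\|f\|^2+\|\varepsilon f_x\|^2+\tau h^2\|\varepsilon f_{x\bar x}\|^2$. A grid function $f$ is called even if $f_{k+i}=f_{k-i}$ for all $i$, for some $k\in\mathbb Z$. Then there are constants $q_1,q_2,c>0$, depending only on $\alpha,\gamma,c_0,\dots,c_3,L,T,M$ (not on $\varepsilon,h,\tau$), such that the following holds whenever $\tau\le q_1\varepsilon h^2$ and $h\le q_2\varepsilon$. Let $u^0\in W_2^2(0,L/\varepsilon)$ satisfy $\|u^0\|_{W_2^2(0,L/\varepsilon)}\le M$ and $u^0(0)=u^0(L/\varepsilon)=0$, let $y^0_i=\frac1h\int_{x_i-h/2}^{x_i+h/2}u^0(\eta/\varepsilon)\,d\eta$ for $3\le i\le I-3$ and $y^0_i=0$ otherwise, let $1\le j\le J$, let $y^1,\dots,y^{j-1}$ be successive levels of the scheme (N) that start from $y^0$, and assume that $y^0,\dots,y^{j-1}$ are even (each about its own node). Put $\check y=y^{j-1}$. Then the iterates $\varphi(s)$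 exist and are uniquely determined, and there is a solution $y$ of (N) such that $$\lim_{s\to\infty}\|\varphi(s)-y\|_{(2,\tau)}=0\qquad\text{and}\qquad\|y-\varphi(2)\|\le c\,\tau^4 .$$ Every even solution of (N) coincides with this $y$ (and so, in particular, does the solution of (N) if it is unique). -/

import Mathlib

open Filter Topology MeasureTheory

namespace GmKdV

noncomputable section

/-- The coefficients of the general mKdV equation
`∂ₜ(u - α²ε² u_xx) + ∂ₓ(c₀ u + c₁ u³ - c₂ ε² u_x² + ε² (γ - c₃ u) u_xx) = 0`. -/
structure Coeffs where
  α : ℝ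
  γ : ℝ
  c₀ : ℝ
  c₁ : ℝ
  c₂ : ℝ
  c₃ : ℝ

/-! Grid functions are maps `ℤ → ℝ`; the value at `i` belongs to the node `x_i = i h`, and the
grid functions of the scheme vanish outside the mesh `0, …, I`. -/

/-- Forward difference quotient `f_x`. -/
def fwd (h : ℝ) (f : ℤ → ℝ) : ℤ → ℝ := fun i => (f (i + 1) - f i) / h

/-- Backward difference quotient `f_x̄`. -/
def bwd (h : ℝ) (f : ℤ → ℝ) : ℤ → ℝ := fun i => (f i - f (i - 1)) / h

/-- Central difference quotient `f_ẋ = (f_x + f_x̄) / 2`. -/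
def ctr (h : ℝ) (f : ℤ → ℝ) : ℤ → ℝ := fun i => (fwd h f i + bwd h f i) / 2

/-- Second difference quotient `f_xx̄ = (f_x)_x̄`. -/
def sec (h : ℝ) (f : ℤ → ℝ) : ℤ → ℝ := bwd h (fwd h f)

/-- `Q₁(y) = ½ { y² y_ẋ + y (y²)_ẋ + (y³)_ẋ }`. -/
def Q1 (h : ℝ) (y : ℤ → ℝ) : ℤ → ℝ :=
  (1 / 2 : ℝ) • (y ^ 2 * ctr h y + y * ctr h (y ^ 2) + ctr h (y ^ 3))

/-- `Q₂(y) = ∂_ẋ { c₂ y_x y_x̄ + (c₃/2) (2 y y_xx̄ + (y_x)² - 2 y_x y_x̄ + (y_x̄)²) }`. -/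
def Q2 (p : Coeffs) (h : ℝ) (y : ℤ → ℝ) : ℤ → ℝ :=
  ctr h (p.c₂ • (fwd h y * bwd h y) +
    (p.c₃ / 2) • ((2 : ℝ) • (y * sec h y) + fwd h y ^ 2
      - (2 : ℝ) • (fwd h y * bwd h y) + bwd h y ^ 2))

/-- `R₁(u,v) = ½ { u² v_ẋ + 2u (uv)_ẋ + 3 (u²v)_ẋ + 2 u v u_ẋ + v (u²)_ẋ }`. -/
def R1 (h : ℝ) (u v : ℤ → ℝ) : ℤ → ℝ :=
  (1 / 2 : ℝ) • (u ^ 2 * ctr h v + (2 : ℝ) • (u * ctr h (u * v)) + (3 : ℝ) • ctr h (u ^ 2 * v)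
    + (2 : ℝ) • (u * v * ctr h u) + v * ctr h (u ^ 2))

/-- `R₂(u,v) = ∂_ẋ { (c₂-c₃)(u_x v_x̄ + u_x̄ v_x) + c₃ (u v_xx̄ + u_x v_x + u_x̄ v_x̄ + u_xx̄ v) }`. -/
def R2 (p : Coeffs) (h : ℝ) (u v : ℤ → ℝ) : ℤ → ℝ :=
  ctr h ((p.c₂ - p.c₃) • (fwd h u * bwd h v + bwd h u * fwd h v) +
    p.c₃ • (u * sec h v + fwd h u * fwd h v + bwd h u * bwd h v + sec h u * v))

/-- `y - α² ε² y_xx̄`. -/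
def mass (p : Coeffs) (ε h : ℝ) (y : ℤ → ℝ) : ℤ → ℝ := y - (p.α ^ 2 * ε ^ 2) • sec h y

/-- The linear spatial terms `c₀ y_ẋ + ε² (γ_h y_xx̄ẋ + γ h y_xx̄x)`, with `γ_h = γ (1 - h)`. -/
def lin (p : Coeffs) (ε h : ℝ) (y : ℤ → ℝ) : ℤ → ℝ :=
  p.c₀ • ctr h y +
    ε ^ 2 • ((p.γ * (1 - h)) • ctr h (sec h y) + (p.γ * h) • fwd h (sec h y))

/-- The boundary conditions `y_l = y_{I-l} = 0`, `l = 0, 1, 2`, with extension by zero outside the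
mesh. -/
def VanishesAtEnds (I : ℕ) (y : ℤ → ℝ) : Prop := ∀ i : ℤ, i ≤ 2 ∨ (I : ℤ) - 2 ≤ i → y i = 0

/-- `y` is a new time level for the implicit nonlinear scheme with previous level `yOld`:
`y - α²ε² y_xx̄ + τ { c₀ y_ẋ + c₁ Q₁(y) + ε² (γ_h y_xx̄ẋ + γ h y_xx̄x) - ε² Q₂(y) }
  = yOld - α²ε² yOld_xx̄`
with the boundary conditions; there is one equation for each node `3, …, I - 3` at which the value
is not prescribed. -/
def IsNonlinearStep (p : Coeffs) (ε h τ : ℝ) (I : ℕ) (yOld y : ℤ → ℝ) : Prop :=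
  VanishesAtEnds I y ∧ ∀ i : ℤ, 3 ≤ i → i ≤ (I : ℤ) - 3 →
    (mass p ε h y + τ • (lin p ε h y + p.c₁ • Q1 h y - ε ^ 2 • Q2 p h y)) i = mass p ε h yOld i

/-- `φ` solves the linearized system
`φ - α²ε² φ_xx̄ + τ { c₀ φ_ẋ + c₁ R₁(ψ,φ) + ε² (γ_h φ_xx̄ẋ + γ h φ_xx̄x) - ε² R₂(ψ,φ) }
  = yOld - α²ε² yOld_xx̄ + τ { 2 c₁ Q₁(ψ) - ε² Q₂(ψ) }`
around the previous iterate `ψ`, with the boundary conditions. -/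
def IsLinearizedStep (p : Coeffs) (ε h τ : ℝ) (I : ℕ) (yOld ψ φ : ℤ → ℝ) : Prop :=
  VanishesAtEnds I φ ∧ ∀ i : ℤ, 3 ≤ i → i ≤ (I : ℤ) - 3 →
    (mass p ε h φ + τ • (lin p ε h φ + p.c₁ • R1 h ψ φ - ε ^ 2 • R2 p h ψ φ)) i =
      (mass p ε h yOld + τ • ((2 * p.c₁) • Q1 h ψ - ε ^ 2 • Q2 p h ψ)) i

/-- The sequence of linearization iterates started at the previous time level. -/
def IsIteration (p : Coeffs) (ε h τ : ℝ) (I : ℕ) (yOld : ℤ → ℝ) (φ : ℕ → ℤ → ℝ) : Prop :=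
  φ 0 = yOld ∧ ∀ s : ℕ, IsLinearizedStep p ε h τ I yOld (φ s) (φ (s + 1))

/-- Evenness of a grid function about some node `k`. -/
def IsEvenGrid (y : ℤ → ℝ) : Prop := ∃ k : ℤ, ∀ i : ℤ, y (k + i) = y (k - i)

/-- The square of the discrete `L²(0, L)` norm. -/
def normSq (h : ℝ) (I : ℕ) (f : ℤ → ℝ) : ℝ := h * ∑ i ∈ Finset.Icc (1 : ℤ) ((I : ℤ) - 1), |f i| ^ 2

/-- The discrete `L²(0, L)` norm. -/
def dnorm (h : ℝ) (I : ℕ) (f : ℤ → ℝ) : ℝ := √(normSq h I f)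

/-- The norm of the space `H²_{τ,h,ε}`:
`‖f‖²_{(2,τ)} = ‖f‖² + ‖ε f_x‖² + τ h² ‖ε f_xx̄‖²`. -/
def dnorm2 (ε h τ : ℝ) (I : ℕ) (f : ℤ → ℝ) : ℝ :=
  √(normSq h I f + normSq h I (ε • fwd h f) + τ * h ^ 2 * normSq h I (ε • sec h f))

/-- `u` is (the `C¹` representative of) an element of the Sobolev space `W₂²(0, R)` with norm at
most `M`: its first and second derivatives `v`, `g` are those given by integration. -/
def SobolevBound (R M : ℝ) (u : ℝ → ℝ) : Prop :=
  ∃ v g : ℝ → ℝ, MemLp g 2 (volume.restrict (Set.Ioc 0 R)) ∧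
    (∀ x ∈ Set.Icc 0 R, v x = v 0 + ∫ s in (0 : ℝ)..x, g s) ∧
    (∀ x ∈ Set.Icc 0 R, u x = u 0 + ∫ s in (0 : ℝ)..x, v s) ∧
    ∫ s in (0 : ℝ)..R, (u s ^ 2 + v s ^ 2 + g s ^ 2) ≤ M ^ 2

/-- The initial grid function: cell averages of `u⁰(x/ε)` at the nodes `3, …, I - 3` and zero at
the other nodes. -/
def initialData (ε h : ℝ) (I : ℕ) (u0 : ℝ → ℝ) : ℤ → ℝ := fun i =>
  if 3 ≤ i ∧ i ≤ (I : ℤ) - 3 then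
    (1 / h) * ∫ η in ((i : ℝ) * h - h / 2)..((i : ℝ) * h + h / 2), u0 (η / ε)
  else 0

end

end GmKdV

/-! The linearized scheme (L) is Newton's method for (N). The expansion `nonlin_add` of the spatial
operator is exact: `linz ψ` is the derivative at ψ, `rmd ψ w` collects the terms of order two and
three in w, and (L) is the Newton equation at the previous iterate.

A priori bound. Tested with an even grid function, the spatial operator of (N) is nonnegative, so
the energy ‖f‖² + α²ε²‖f_x‖² does not grow along even levels (`IsNonlinearStep.enSq_le`). The
initial data have energy O(ε) (`enSq_initialData_le`), and the discrete Sobolev inequality turns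
this into a maximum bound independent of ε, h and the level.

Convergence. The form of `linz` is at most C/(εh²) times the L² norm of its argument times the
energy norm of the test function. For τ ≤ qεh² the mass term therefore absorbs it; this gives
solvability of (L), and a similar bound for `rmd` makes successive increments contract by 1/2. The
first increment is O(τ√ε/h) in energy, so in the maximum norm all increments together sum to at most
1 and the iterates never leave the region where the bounds hold (`exists_iteration_limit`). An even
solution of (N) obeys the same maximum bound, and expanding (N) at the limit z forces the two to
coincide.

Rate. A duality argument (`exists_dnorm_quadratic_le`) bounds the L² norm of z - φ(s+1) by
Dτε^(-3/2) times the squared energy norm of z - φ(s). Since z - φ(0) has energy norm O(τ√ε/h), one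
step gives ‖z - φ(1)‖ = O(τ³ε^(-1/2)h^(-2)). Passing back to the energy norm costs a factor ε/h, and
a second step gives O(τ⁷ε^(-1/2)h^(-6)). Three of the powers of τ are then traded for (qεh²)³, which
leaves O(τ⁴). -/

namespace GmKdV

/-! ### Inner product, energy norm, difference quotients and supports -/

/-- The discrete inner product of `L²(0, L)`. -/
noncomputable def inn (h : ℝ) (I : ℕ) (f g : ℤ → ℝ) : ℝ :=
  h * ∑ i ∈ Finset.Icc (1 : ℤ) ((I : ℤ) - 1), f i * g i

/-- The square of the energy norm `‖f‖² + α² ε² ‖f_x‖²`. -/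
noncomputable def enSq (p : Coeffs) (ε h : ℝ) (I : ℕ) (f : ℤ → ℝ) : ℝ :=
  normSq h I f + p.α ^ 2 * ε ^ 2 * normSq h I (fwd h f)

/-- The energy norm. -/
noncomputable def en (p : Coeffs) (ε h : ℝ) (I : ℕ) (f : ℤ → ℝ) : ℝ := √(enSq p ε h I f)

/-- The grid function vanishes off the nodes `2, …, I - 2`. -/
def VanishesNearEnds (I : ℕ) (f : ℤ → ℝ) : Prop := ∀ i : ℤ, i ≤ 1 ∨ (I : ℤ) - 1 ≤ i → f i = 0

lemma fwd_apply (h : ℝ) (f : ℤ → ℝ) (i : ℤ) : fwd h f i = (f (i + 1) - f i) / h := rfl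

lemma bwd_apply (h : ℝ) (f : ℤ → ℝ) (i : ℤ) : bwd h f i = (f i - f (i - 1)) / h := rfl

lemma bwd_eq_fwd (h : ℝ) (f : ℤ → ℝ) (i : ℤ) : bwd h f i = fwd h f (i - 1) := by
  simp [fwd_apply, bwd_apply]

lemma ctr_apply (h : ℝ) (f : ℤ → ℝ) (i : ℤ) :
    ctr h f i = (f (i + 1) - f (i - 1)) / (2 * h) := by
  simp only [ctr, fwd, bwd]; ring

lemma ctr_eq (h : ℝ) (f : ℤ → ℝ) (i : ℤ) :
    ctr h f i = (fwd h f i + fwd h f (i - 1)) / 2 := by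
  rw [← bwd_eq_fwd]; rfl

lemma sec_apply (h : ℝ) (f : ℤ → ℝ) (i : ℤ) :
    sec h f i = (f (i + 1) - 2 * f i + f (i - 1)) / h ^ 2 := by
  simp only [sec, fwd, bwd, sub_add_cancel]; ring

lemma sec_eq (h : ℝ) (f : ℤ → ℝ) (i : ℤ) :
    sec h f i = (fwd h f i - fwd h f (i - 1)) / h := rfl

section Supports

variable {I : ℕ} {f g : ℤ → ℝ}

lemma VanishesAtEnds.near (hf : VanishesAtEnds I f) : VanishesNearEnds I f :=
  fun i hi => hf i (by omega)

lemma VanishesAtEnds.sub (hf : VanishesAtEnds I f) (hg : VanishesAtEnds I g) :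
    VanishesAtEnds I (f - g) := fun i hi => by simp [hf i hi, hg i hi]

lemma VanishesAtEnds.fwd (h : ℝ) (hf : VanishesAtEnds I f) : VanishesNearEnds I (fwd h f) :=
  fun i hi => by
    rw [fwd_apply, hf i (by omega), hf (i + 1) (by omega)]; simp

lemma VanishesAtEnds.ctr (h : ℝ) (hf : VanishesAtEnds I f) : VanishesNearEnds I (ctr h f) :=
  fun i hi => by
    rw [ctr_apply, hf (i + 1) (by omega), hf (i - 1) (by omega)]; simp

end Supports

/-! ### Summation by parts and stencil estimates on the window 1, …, I - 1 -/

lemma sum_window_shift (I : ℕ) (F : ℤ → ℝ) (hF : ∀ i : ℤ, i ≤ 1 ∨ (I : ℤ) ≤ i → F i = 0) :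
    ∑ i ∈ Finset.Icc (1 : ℤ) ((I : ℤ) - 1), F (i + 1)
      = ∑ i ∈ Finset.Icc (1 : ℤ) ((I : ℤ) - 1), F i := by
  -- The support of `F` lies in the window and also in its translate, so both sums equal the
  -- translation invariant sum over ℤ.
  have h1 : ∑ i ∈ Finset.Icc (1 : ℤ) ((I : ℤ) - 1), F i = ∑' i : ℤ, F i :=
    (tsum_eq_sum fun i hi => hF i (by simp only [Finset.mem_Icc] at hi; omega)).symm
  have h2 : ∑ i ∈ Finset.Icc (1 : ℤ) ((I : ℤ) - 1), F (i + 1) = ∑' i : ℤ, F (i + 1) :=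
    (tsum_eq_sum fun i hi => hF (i + 1) (by simp only [Finset.mem_Icc] at hi; omega)).symm
  rw [h1, h2]
  exact (Equiv.addRight (1 : ℤ)).tsum_eq F

lemma sum_window_shift_neg (I : ℕ) (F : ℤ → ℝ)
    (hF : ∀ i : ℤ, i ≤ 0 ∨ (I : ℤ) - 1 ≤ i → F i = 0) :
    ∑ i ∈ Finset.Icc (1 : ℤ) ((I : ℤ) - 1), F (i - 1)
      = ∑ i ∈ Finset.Icc (1 : ℤ) ((I : ℤ) - 1), F i := by
  have := sum_window_shift I (fun i => F (i - 1)) (fun i hi => hF _ (by omega))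
  simpa using this.symm

section InnerProduct

variable {h : ℝ} {I : ℕ}

lemma inn_comm (h : ℝ) (I : ℕ) (f g : ℤ → ℝ) : inn h I f g = inn h I g f := by
  simp only [inn, mul_comm]

lemma inn_add_left (h : ℝ) (I : ℕ) (f f' g : ℤ → ℝ) :
    inn h I (f + f') g = inn h I f g + inn h I f' g := by
  simp only [inn, Pi.add_apply, add_mul, Finset.sum_add_distrib, mul_add]

lemma inn_sub_left (h : ℝ) (I : ℕ) (f f' g : ℤ → ℝ) :
    inn h I (f - f') g = inn h I f g - inn h I f' g := by
  simp only [inn, Pi.sub_apply, sub_mul, Finset.sum_sub_distrib, mul_sub]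

lemma inn_smul_left (h : ℝ) (I : ℕ) (c : ℝ) (f g : ℤ → ℝ) :
    inn h I (c • f) g = c * inn h I f g := by
  simp only [inn, Pi.smul_apply, smul_eq_mul, Finset.mul_sum]
  exact Finset.sum_congr rfl fun i _ => by ring

lemma inn_neg_left (h : ℝ) (I : ℕ) (f g : ℤ → ℝ) :
    inn h I (-f) g = - inn h I f g := by
  simp [inn]

lemma inn_self (h : ℝ) (I : ℕ) (f : ℤ → ℝ) : inn h I f f = normSq h I f := by
  simp only [inn, normSq, sq_abs]
  simp only [pow_two]

lemma normSq_nonneg (hh : 0 < h) (f : ℤ → ℝ) : 0 ≤ normSq h I f := by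
  unfold normSq; positivity

lemma dnorm_nonneg (f : ℤ → ℝ) : 0 ≤ dnorm h I f := Real.sqrt_nonneg _

lemma dnorm_sq (hh : 0 < h) (f : ℤ → ℝ) : dnorm h I f ^ 2 = normSq h I f :=
  Real.sq_sqrt (normSq_nonneg hh f)

lemma abs_inn_le (hh : 0 < h) (f g : ℤ → ℝ) :
    |inn h I f g| ≤ dnorm h I f * dnorm h I g := by
  unfold dnorm
  rw [← Real.sqrt_mul (normSq_nonneg hh f)]
  apply Real.abs_le_sqrt
  have := Finset.sum_mul_sq_le_sq_mul_sq (Finset.Icc (1 : ℤ) ((I : ℤ) - 1)) f g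
  simp only [inn, normSq, sq_abs, mul_pow]
  calc h ^ 2 * (∑ i ∈ Finset.Icc (1 : ℤ) ((I : ℤ) - 1), f i * g i) ^ 2 ≤ h ^ 2 * _ :=
        mul_le_mul_of_nonneg_left this (by positivity)
    _ = _ := by ring

lemma abs_inn_le_sum (hh : 0 < h) (f g : ℤ → ℝ) :
    |inn h I f g| ≤ h * ∑ i ∈ Finset.Icc (1 : ℤ) ((I : ℤ) - 1), |f i| * |g i| := by
  unfold inn
  rw [abs_mul, abs_of_pos hh]
  gcongr
  exact (Finset.abs_sum_le_sum_abs _ _).trans_eq (by simp [abs_mul])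

/-- Two grid functions that agree on the nodes `3, …, I - 3` have the same product with a grid
function that vanishes at the ends. -/
lemma inn_congr {f f' g : ℤ → ℝ} (hg : VanishesAtEnds I g)
    (hf : ∀ i : ℤ, 3 ≤ i → i ≤ (I : ℤ) - 3 → f i = f' i) : inn h I f g = inn h I f' g := by
  unfold inn
  congr 1
  refine Finset.sum_congr rfl fun i _ => ?_
  by_cases hi : 3 ≤ i ∧ i ≤ (I : ℤ) - 3
  · rw [hf i hi.1 hi.2]
  · rw [hg i (by omega)]; simp

/-- Only the test function has to vanish near the ends; `f` is free, so the rule also applies to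
fluxes and to differences of differences. -/
lemma inn_fwd {f g : ℤ → ℝ} (hg : VanishesNearEnds I g) :
    inn h I (fwd h f) g = - inn h I f (bwd h g) := by
  have hs := sum_window_shift I (fun i => f i * g (i - 1))
    (fun i hi => by rw [hg (i - 1) (by omega)]; simp)
  simp only [add_sub_cancel_right] at hs
  have e1 : ∑ i ∈ Finset.Icc (1 : ℤ) ((I : ℤ) - 1), fwd h f i * g i
      = (∑ i ∈ Finset.Icc (1 : ℤ) ((I : ℤ) - 1), f (i + 1) * g i
        - ∑ i ∈ Finset.Icc (1 : ℤ) ((I : ℤ) - 1), f i * g i) / h := by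
    rw [← Finset.sum_sub_distrib, Finset.sum_div]
    exact Finset.sum_congr rfl fun i _ => by rw [fwd_apply]; ring
  have e2 : ∑ i ∈ Finset.Icc (1 : ℤ) ((I : ℤ) - 1), f i * bwd h g i
      = (∑ i ∈ Finset.Icc (1 : ℤ) ((I : ℤ) - 1), f i * g i
        - ∑ i ∈ Finset.Icc (1 : ℤ) ((I : ℤ) - 1), f i * g (i - 1)) / h := by
    rw [← Finset.sum_sub_distrib, Finset.sum_div]
    exact Finset.sum_congr rfl fun i _ => by rw [bwd_apply]; ring
  unfold inn
  rw [e1, e2, hs]; ring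

lemma inn_bwd {f g : ℤ → ℝ} (hg : VanishesNearEnds I g) :
    inn h I (bwd h f) g = - inn h I f (fwd h g) := by
  have hs := sum_window_shift_neg I (fun i => f i * g (i + 1))
    (fun i hi => by rw [hg (i + 1) (by omega)]; simp)
  simp only [sub_add_cancel] at hs
  have e1 : ∑ i ∈ Finset.Icc (1 : ℤ) ((I : ℤ) - 1), bwd h f i * g i
      = (∑ i ∈ Finset.Icc (1 : ℤ) ((I : ℤ) - 1), f i * g i
        - ∑ i ∈ Finset.Icc (1 : ℤ) ((I : ℤ) - 1), f (i - 1) * g i) / h := by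
    rw [← Finset.sum_sub_distrib, Finset.sum_div]
    exact Finset.sum_congr rfl fun i _ => by rw [bwd_apply]; ring
  have e2 : ∑ i ∈ Finset.Icc (1 : ℤ) ((I : ℤ) - 1), f i * fwd h g i
      = (∑ i ∈ Finset.Icc (1 : ℤ) ((I : ℤ) - 1), f i * g (i + 1)
        - ∑ i ∈ Finset.Icc (1 : ℤ) ((I : ℤ) - 1), f i * g i) / h := by
    rw [← Finset.sum_sub_distrib, Finset.sum_div]
    exact Finset.sum_congr rfl fun i _ => by rw [fwd_apply]; ring
  unfold inn
  rw [e1, e2, hs]; ring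

lemma ctr_eq_smul (h : ℝ) (f : ℤ → ℝ) : ctr h f = (1 / 2 : ℝ) • (fwd h f + bwd h f) := by
  ext i; simp only [ctr, Pi.smul_apply, Pi.add_apply, smul_eq_mul]; ring

lemma inn_ctr {f g : ℤ → ℝ} (hg : VanishesNearEnds I g) :
    inn h I (ctr h f) g = - inn h I f (ctr h g) := by
  rw [ctr_eq_smul h f, inn_smul_left, inn_add_left, inn_fwd hg, inn_bwd hg, inn_comm h I f (ctr h g),
    ctr_eq_smul h g, inn_smul_left, inn_add_left, inn_comm h I _ f, inn_comm h I _ f]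
  ring

lemma inn_sec {f g : ℤ → ℝ} (hg : VanishesNearEnds I g) :
    inn h I (sec h f) g = - inn h I (fwd h f) (fwd h g) := inn_bwd hg

lemma normSq_bwd {f : ℤ → ℝ} (hf : VanishesAtEnds I f) :
    normSq h I (bwd h f) = normSq h I (fwd h f) := by
  unfold normSq
  congr 1
  simp only [bwd_eq_fwd]
  refine sum_window_shift_neg I (fun i => |fwd h f i| ^ 2) fun i hi => ?_
  have : fwd h f i = 0 := hf.fwd h i (by omega)
  simp [this]

lemma dnorm_bwd {f : ℤ → ℝ} (hf : VanishesAtEnds I f) :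
    dnorm h I (bwd h f) = dnorm h I (fwd h f) := by
  unfold dnorm; rw [normSq_bwd hf]

/-- Reduces L² estimates to pointwise ones on three neighbouring nodes: since `f` vanishes near the
ends, its two translates have the same norm on the window. -/
lemma dnorm_le_of_stencil (hh : 0 < h) {f P : ℤ → ℝ} {c : ℝ} (hc : 0 ≤ c)
    (hf : VanishesNearEnds I f)
    (hP : ∀ i : ℤ, |P i| ≤ c * (|f (i - 1)| + |f i| + |f (i + 1)|)) :
    dnorm h I P ≤ 3 * c * dnorm h I f := by
  have h1 : normSq h I P ≤ (3 * c) ^ 2 * normSq h I f := by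
    have hp := sum_window_shift I (fun i => |f i| ^ 2) (fun i hi => by
      have : f i = 0 := hf i (by omega)
      simp [this])
    have hm := sum_window_shift_neg I (fun i => |f i| ^ 2) (fun i hi => by
      have : f i = 0 := hf i (by omega)
      simp [this])
    have hpt : ∀ i ∈ Finset.Icc (1 : ℤ) ((I : ℤ) - 1), |P i| ^ 2
        ≤ 3 * c ^ 2 * (|f (i - 1)| ^ 2 + |f i| ^ 2 + |f (i + 1)| ^ 2) := by
      intro i _
      calc |P i| ^ 2 ≤ (c * (|f (i - 1)| + |f i| + |f (i + 1)|)) ^ 2 := by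
            gcongr; exact hP i
        _ = c ^ 2 * (|f (i - 1)| + |f i| + |f (i + 1)|) ^ 2 := by ring
        _ ≤ c ^ 2 * (3 * (|f (i - 1)| ^ 2 + |f i| ^ 2 + |f (i + 1)| ^ 2)) := by
            gcongr
            nlinarith [sq_nonneg (|f (i - 1)| - |f i|), sq_nonneg (|f (i - 1)| - |f (i + 1)|),
              sq_nonneg (|f i| - |f (i + 1)|)]
        _ = _ := by ring
    have hs := Finset.sum_le_sum hpt
    rw [← Finset.mul_sum, Finset.sum_add_distrib, Finset.sum_add_distrib, hp, hm] at hs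
    unfold normSq
    calc _ ≤ h * _ := mul_le_mul_of_nonneg_left hs hh.le
      _ = _ := by ring
  unfold dnorm
  calc √(normSq h I P) ≤ √((3 * c) ^ 2 * normSq h I f) := Real.sqrt_le_sqrt h1
    _ = _ := by rw [Real.sqrt_mul (by positivity), Real.sqrt_sq (by positivity)]

lemma abs_inn_le_of_stencil (hh : 0 < h) {f P g : ℤ → ℝ} {c : ℝ} (hc : 0 ≤ c)
    (hf : VanishesNearEnds I f)
    (hP : ∀ i : ℤ, |P i| ≤ c * (|f (i - 1)| + |f i| + |f (i + 1)|)) :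
    |inn h I P g| ≤ 3 * c * dnorm h I f * dnorm h I g :=
  (abs_inn_le hh P g).trans
    (mul_le_mul_of_nonneg_right (dnorm_le_of_stencil hh hc hf hP) (dnorm_nonneg g))

lemma dnorm_ctr_le (hh : 0 < h) {g : ℤ → ℝ} (hg : VanishesAtEnds I g) :
    dnorm h I (ctr h g) ≤ 2 * dnorm h I (fwd h g) := by
  have := dnorm_le_of_stencil hh (c := 1 / 2) (by norm_num) (hg.fwd h) (P := ctr h g) fun i => by
    rw [ctr_eq, abs_div, abs_two]
    have := abs_add_le (fwd h g i) (fwd h g (i - 1))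
    have := abs_nonneg (fwd h g (i + 1))
    linarith
  have := dnorm_nonneg (h := h) (I := I) (fwd h g)
  linarith

lemma dnorm_fwd_le (hh : 0 < h) {g : ℤ → ℝ} (hg : VanishesAtEnds I g) :
    dnorm h I (fwd h g) ≤ 3 / h * dnorm h I g := by
  have := dnorm_le_of_stencil hh (c := 1 / h) (by positivity) hg.near (P := fwd h g) fun i => by
    rw [fwd_apply, abs_div, abs_of_pos hh, one_div, inv_mul_eq_div]
    gcongr
    have := abs_sub (g (i + 1)) (g i)
    have := abs_nonneg (g (i - 1))
    linarith
  calc _ ≤ _ := this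
    _ = _ := by ring

end InnerProduct

/-! ### The energy norm and the discrete Sobolev inequality -/

section Energy

variable {p : Coeffs} {ε h : ℝ} {I : ℕ}

lemma enSq_nonneg (hh : 0 < h) (f : ℤ → ℝ) : 0 ≤ enSq p ε h I f := by
  have := normSq_nonneg (I := I) hh f
  have := normSq_nonneg (I := I) hh (fwd h f)
  unfold enSq; positivity

lemma en_nonneg (f : ℤ → ℝ) : 0 ≤ en p ε h I f := Real.sqrt_nonneg _

lemma en_sq (hh : 0 < h) (f : ℤ → ℝ) : en p ε h I f ^ 2 = enSq p ε h I f :=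
  Real.sq_sqrt (enSq_nonneg hh f)

lemma dnorm_le_en (hh : 0 < h) (f : ℤ → ℝ) : dnorm h I f ≤ en p ε h I f := by
  refine Real.sqrt_le_sqrt ?_
  have := normSq_nonneg (I := I) hh (fwd h f)
  unfold enSq
  have : 0 ≤ p.α ^ 2 * ε ^ 2 * normSq h I (fwd h f) := by positivity
  linarith

lemma dnorm_fwd_le_en (hα : 0 < p.α) (hε : 0 < ε) (hh : 0 < h) (f : ℤ → ℝ) :
    dnorm h I (fwd h f) ≤ en p ε h I f / (p.α * ε) := by
  rw [le_div_iff₀ (by positivity)]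
  refine Real.le_sqrt_of_sq_le ?_
  rw [mul_pow, dnorm_sq hh, enSq]
  have := normSq_nonneg (I := I) hh f
  nlinarith

lemma dnorm_ctr_le_en (hα : 0 < p.α) (hε : 0 < ε) (hh : 0 < h) {f : ℤ → ℝ}
    (hf : VanishesAtEnds I f) :
    dnorm h I (ctr h f) ≤ 2 * en p ε h I f / (p.α * ε) := by
  have h1 := dnorm_ctr_le hh hf
  have h2 := dnorm_fwd_le_en (I := I) hα hε hh f
  rw [mul_div_assoc]
  linarith

lemma inn_mass {f g : ℤ → ℝ} (hg : VanishesNearEnds I g) :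
    inn h I (mass p ε h f) g
      = inn h I f g + p.α ^ 2 * ε ^ 2 * inn h I (fwd h f) (fwd h g) := by
  unfold mass
  rw [inn_sub_left, inn_smul_left, inn_sec hg]; ring

lemma inn_mass_self {f : ℤ → ℝ} (hf : VanishesNearEnds I f) :
    inn h I (mass p ε h f) f = enSq p ε h I f := by
  rw [inn_mass hf, inn_self, inn_self, enSq]

lemma inn_mass_le (hh : 0 < h) {f g : ℤ → ℝ} (hg : VanishesNearEnds I g) :
    inn h I (mass p ε h f) g ≤ (enSq p ε h I f + enSq p ε h I g) / 2 := by
  rw [inn_mass hg]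
  have key : ∀ a b : ℤ → ℝ, inn h I a b ≤ (normSq h I a + normSq h I b) / 2 := fun a b => by
    have h1 := abs_inn_le (I := I) hh a b
    have h2 := le_abs_self (inn h I a b)
    rw [← dnorm_sq hh a, ← dnorm_sq hh b]
    nlinarith [sq_nonneg (dnorm h I a - dnorm h I b)]
  have h1 := key f g
  have h2 := mul_le_mul_of_nonneg_left (key (fwd h f) (fwd h g))
    (by positivity : 0 ≤ p.α ^ 2 * ε ^ 2)
  unfold enSq
  linarith

/-- A discrete Sobolev inequality. -/
lemma sq_le_dnorm_mul_dnorm (hh : 0 < h) {f : ℤ → ℝ} (hf : VanishesAtEnds I f) (i : ℤ) :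
    f i ^ 2 ≤ 2 * dnorm h I f * dnorm h I (fwd h f) := by
  set S := h * ∑ j ∈ Finset.Icc (1 : ℤ) ((I : ℤ) - 1), |f j + f (j + 1)| * |fwd h f j| with hS
  have hS1 : S ≤ 2 * dnorm h I f * dnorm h I (fwd h f) := by
    have hs1 := sum_window_shift I (fun j => |f j| ^ 2)
      (fun j hj => by have : f j = 0 := hf.near j (by omega)
                      simp [this])
    have hn : dnorm h I (fun j => |f j + f (j + 1)|) ≤ 2 * dnorm h I f := by
      unfold dnorm
      have : normSq h I (fun j => |f j + f (j + 1)|) ≤ 2 ^ 2 * normSq h I f := by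
        unfold normSq
        rw [mul_left_comm]
        gcongr
        calc _ ≤ ∑ j ∈ Finset.Icc (1 : ℤ) ((I : ℤ) - 1), (2 * |f j| ^ 2 + 2 * |f (j + 1)| ^ 2) := by
              refine Finset.sum_le_sum fun j _ => ?_
              simp only [sq_abs]
              nlinarith [sq_nonneg (f j - f (j + 1))]
          _ = _ := by
              rw [Finset.sum_add_distrib, ← Finset.mul_sum, ← Finset.mul_sum, hs1]; ring
      calc _ ≤ √(2 ^ 2 * normSq h I f) := Real.sqrt_le_sqrt this
        _ = _ := by rw [Real.sqrt_mul (by positivity), Real.sqrt_sq (by positivity)]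
    have h2 := abs_inn_le (I := I) hh (fun j => |f j + f (j + 1)|) (fun j => |fwd h f j|)
    have h3 : dnorm h I (fun j => |fwd h f j|) = dnorm h I (fwd h f) := by
      simp [dnorm, normSq]
    rw [h3] at h2
    calc S = inn h I (fun j => |f j + f (j + 1)|) (fun j => |fwd h f j|) := rfl
      _ ≤ _ := le_abs_self _
      _ ≤ _ := h2
      _ ≤ _ := mul_le_mul_of_nonneg_right hn (dnorm_nonneg _)
  -- Telescoping from node 1, where `f` vanishes: the increment of f² over one cell is h (f_i +
  -- f_{i+1}) f_x.
  have tele : ∀ n : ℕ, f (1 + n) ^ 2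
      ≤ h * ∑ j ∈ Finset.Ico (1 : ℤ) (1 + n), |f j + f (j + 1)| * |fwd h f j| := by
    intro n
    induction n with
    | zero => simp [hf 1 (by omega)]
    | succ n ih =>
      have e : Finset.Ico (1 : ℤ) (1 + (n + 1 : ℕ))
          = (insert (1 + n : ℤ) (Finset.Ico 1 (1 + n : ℤ)) : Finset ℤ) := by
        ext j; simp only [Finset.mem_Ico, Finset.mem_insert]; push_cast; omega
      rw [e, Finset.sum_insert (by simp), mul_add]
      have hstep : f (1 + (n + 1 : ℕ)) ^ 2 - f (1 + n) ^ 2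
          ≤ h * (|f (1 + n) + f (1 + n + 1)| * |fwd h f (1 + n)|) := by
        have e2 : (1 + (n + 1 : ℕ) : ℤ) = 1 + n + 1 := by push_cast; ring
        rw [e2, fwd_apply, abs_div, abs_of_pos hh, ← mul_div_assoc, mul_div_cancel₀ _ hh.ne',
          ← abs_mul]
        refine le_trans (le_of_eq ?_) (le_abs_self _)
        ring
      linarith
  by_cases hi : i ≤ 2 ∨ (I : ℤ) - 2 ≤ i
  · rw [hf i hi]
    have := mul_nonneg (dnorm_nonneg (h := h) (I := I) f) (dnorm_nonneg (h := h) (I := I) (fwd h f))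
    nlinarith
  · obtain ⟨n, hn⟩ : ∃ n : ℕ, i = 1 + n := ⟨(i - 1).toNat, by omega⟩
    rw [hn]
    refine (tele n).trans (le_trans ?_ hS1)
    rw [hS]
    gcongr
    intro j hj
    simp only [Finset.mem_Ico, Finset.mem_Icc] at hj ⊢
    omega

/-- Young's inequality with weight αε in the Sobolev inequality. The factor 1/ε is cancelled exactly
when the energy is O(ε). -/
lemma sq_le_enSq (hα : 0 < p.α) (hε : 0 < ε) (hh : 0 < h) {f : ℤ → ℝ}
    (hf : VanishesAtEnds I f) (i : ℤ) : f i ^ 2 ≤ enSq p ε h I f / (p.α * ε) := by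
  refine (sq_le_dnorm_mul_dnorm hh hf i).trans ?_
  rw [le_div_iff₀ (by positivity), enSq, ← dnorm_sq hh f, ← dnorm_sq hh (fwd h f)]
  nlinarith [sq_nonneg (dnorm h I f - p.α * ε * dnorm h I (fwd h f))]

lemma eq_zero_of_normSq (hh : 0 < h) {f : ℤ → ℝ} (hf : VanishesAtEnds I f)
    (h0 : normSq h I f ≤ 0) : f = 0 := by
  ext i
  by_cases hi : i ≤ 2 ∨ (I : ℤ) - 2 ≤ i
  · exact hf i hi
  · have h1 : |f i| ^ 2 ≤ ∑ i ∈ Finset.Icc (1 : ℤ) ((I : ℤ) - 1), |f i| ^ 2 :=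
      Finset.single_le_sum (f := fun i => |f i| ^ 2) (fun _ _ => by positivity)
        (by simp only [Finset.mem_Icc]; omega)
    have h2 : ∑ i ∈ Finset.Icc (1 : ℤ) ((I : ℤ) - 1), |f i| ^ 2 ≤ 0 := by
      unfold normSq at h0
      exact nonpos_of_mul_nonpos_right h0 hh
    have h3 : f i ^ 2 ≤ 0 := by rw [← sq_abs]; linarith
    simpa using le_antisymm h3 (sq_nonneg _)

end Energy

/-! ### Exact Taylor expansion of the spatial operator -/

/-- The spatial part of the nonlinear scheme. -/
noncomputable def nonlin (p : Coeffs) (ε h : ℝ) (y : ℤ → ℝ) : ℤ → ℝ :=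
  lin p ε h y + p.c₁ • Q1 h y - ε ^ 2 • Q2 p h y

/-- The spatial part of the linearized scheme. -/
noncomputable def linz (p : Coeffs) (ε h : ℝ) (ψ v : ℤ → ℝ) : ℤ → ℝ :=
  lin p ε h v + p.c₁ • R1 h ψ v - ε ^ 2 • R2 p h ψ v

/-- The remainder in the Taylor expansion of `nonlin`. -/
noncomputable def rmd (p : Coeffs) (ε h : ℝ) (ψ w : ℤ → ℝ) : ℤ → ℝ :=
  p.c₁ • R1 h w (ψ + (1 / 3 : ℝ) • w) - ε ^ 2 • Q2 p h w

/-- The grid function whose central difference quotient is `R₂(u, v)`. -/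
noncomputable def flux (p : Coeffs) (h : ℝ) (u v : ℤ → ℝ) : ℤ → ℝ :=
  (p.c₂ - p.c₃) • (fwd h u * bwd h v + bwd h u * fwd h v) +
    p.c₃ • (u * sec h v + fwd h u * fwd h v + bwd h u * bwd h v + sec h u * v)

lemma R2_eq (p : Coeffs) (h : ℝ) (u v : ℤ → ℝ) : R2 p h u v = ctr h (flux p h u v) := rfl

/-- `flux` is a symmetric bilinear form, and the quadratic term of the scheme is half of its
diagonal; its derivative is thus `R2`. -/
lemma Q2_eq_ctr (p : Coeffs) (h : ℝ) (y : ℤ → ℝ) :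
    Q2 p h y = ctr h ((1 / 2 : ℝ) • flux p h y y) := by
  unfold Q2
  congr 1
  ext i
  simp only [flux, Pi.add_apply, Pi.sub_apply, Pi.mul_apply, Pi.pow_apply, Pi.smul_apply,
    smul_eq_mul]
  ring

lemma R1_apply (h : ℝ) (u v : ℤ → ℝ) (i : ℤ) :
    R1 h u v i = 1 / (4 * h) * (u i ^ 2 * (v (i + 1) - v (i - 1))
      + 2 * u i * (u (i + 1) * v (i + 1) - u (i - 1) * v (i - 1))
      + 3 * (u (i + 1) ^ 2 * v (i + 1) - u (i - 1) ^ 2 * v (i - 1))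
      + 2 * u i * v i * (u (i + 1) - u (i - 1))
      + v i * (u (i + 1) ^ 2 - u (i - 1) ^ 2)) := by
  simp only [R1, ctr_apply, Pi.add_apply, Pi.mul_apply, Pi.pow_apply, Pi.smul_apply, smul_eq_mul]
  ring

lemma Q1_apply (h : ℝ) (y : ℤ → ℝ) (i : ℤ) :
    Q1 h y i = 1 / (4 * h) * (y i ^ 2 * (y (i + 1) - y (i - 1))
      + y i * (y (i + 1) ^ 2 - y (i - 1) ^ 2) + (y (i + 1) ^ 3 - y (i - 1) ^ 3)) := by
  simp only [Q1, ctr_apply, Pi.add_apply, Pi.mul_apply, Pi.pow_apply, Pi.smul_apply, smul_eq_mul]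
  ring

lemma R1_self (h : ℝ) (y : ℤ → ℝ) : R1 h y y = (3 : ℝ) • Q1 h y := by
  ext i
  simp only [R1_apply, Q1_apply, Pi.smul_apply, smul_eq_mul]
  ring

lemma R2_self (p : Coeffs) (h : ℝ) (y : ℤ → ℝ) : R2 p h y y = (2 : ℝ) • Q2 p h y := by
  ext i
  rw [R2_eq, Q2_eq_ctr]
  simp only [ctr_apply, Pi.smul_apply, smul_eq_mul]
  ring

lemma ctr_add (h : ℝ) (f g : ℤ → ℝ) : ctr h (f + g) = ctr h f + ctr h g := by
  ext i; simp only [ctr_apply, Pi.add_apply]; ring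

lemma ctr_smul (h c : ℝ) (f : ℤ → ℝ) : ctr h (c • f) = c • ctr h f := by
  ext i; simp only [ctr_apply, Pi.smul_apply, smul_eq_mul]; ring

lemma flux_apply (p : Coeffs) (h : ℝ) (u v : ℤ → ℝ) (i : ℤ) :
    flux p h u v i = (p.c₂ - p.c₃) * (fwd h u i * fwd h v (i - 1) + fwd h u (i - 1) * fwd h v i)
      + p.c₃ * (u i * ((fwd h v i - fwd h v (i - 1)) / h) + fwd h u i * fwd h v i
        + fwd h u (i - 1) * fwd h v (i - 1) + (fwd h u i - fwd h u (i - 1)) / h * v i) := by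
  simp only [flux, Pi.add_apply, Pi.mul_apply, Pi.smul_apply, smul_eq_mul, bwd_eq_fwd, sec_eq]

lemma fwd_add (h : ℝ) (f g : ℤ → ℝ) : fwd h (f + g) = fwd h f + fwd h g := by
  ext i; simp only [fwd_apply, Pi.add_apply]; ring

lemma fwd_smul (h c : ℝ) (f : ℤ → ℝ) : fwd h (c • f) = c • fwd h f := by
  ext i; simp only [fwd_apply, Pi.smul_apply, smul_eq_mul]; ring

lemma sec_add (h : ℝ) (f g : ℤ → ℝ) : sec h (f + g) = sec h f + sec h g := by
  ext i; simp only [sec_apply, Pi.add_apply]; ring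

lemma sec_smul (h c : ℝ) (f : ℤ → ℝ) : sec h (c • f) = c • sec h f := by
  ext i; simp only [sec_apply, Pi.smul_apply, smul_eq_mul]; ring

lemma flux_add_right (p : Coeffs) (h : ℝ) (u v w : ℤ → ℝ) :
    flux p h u (v + w) = flux p h u v + flux p h u w := by
  ext i; simp only [flux_apply, fwd_add, Pi.add_apply]; ring

lemma flux_smul_right (p : Coeffs) (h c : ℝ) (u v : ℤ → ℝ) :
    flux p h u (c • v) = c • flux p h u v := by
  ext i; simp only [flux_apply, fwd_smul, Pi.smul_apply, smul_eq_mul]; ring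

lemma flux_comm (p : Coeffs) (h : ℝ) (u v : ℤ → ℝ) : flux p h u v = flux p h v u := by
  ext i; simp only [flux_apply]; ring

lemma lin_add (p : Coeffs) (ε h : ℝ) (f g : ℤ → ℝ) :
    lin p ε h (f + g) = lin p ε h f + lin p ε h g := by
  simp only [lin, ctr_add, sec_add, fwd_add, smul_add]; abel

lemma lin_smul (p : Coeffs) (ε h c : ℝ) (f : ℤ → ℝ) : lin p ε h (c • f) = c • lin p ε h f := by
  simp only [lin, ctr_smul, sec_smul, fwd_smul, smul_add, smul_comm c]

lemma mass_add (p : Coeffs) (ε h : ℝ) (f g : ℤ → ℝ) :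
    mass p ε h (f + g) = mass p ε h f + mass p ε h g := by
  simp only [mass, sec_add, smul_add]; abel

lemma mass_smul (p : Coeffs) (ε h c : ℝ) (f : ℤ → ℝ) :
    mass p ε h (c • f) = c • mass p ε h f := by
  simp only [mass, sec_smul, smul_sub, smul_comm c]

lemma mass_sub (p : Coeffs) (ε h : ℝ) (f g : ℤ → ℝ) :
    mass p ε h (f - g) = mass p ε h f - mass p ε h g := by
  ext i; simp only [mass, sec_apply, Pi.sub_apply, Pi.smul_apply, smul_eq_mul]; ring

lemma linz_add (p : Coeffs) (ε h : ℝ) (ψ f g : ℤ → ℝ) :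
    linz p ε h ψ (f + g) = linz p ε h ψ f + linz p ε h ψ g := by
  have : R1 h ψ (f + g) = R1 h ψ f + R1 h ψ g := by
    ext i; simp only [R1_apply, Pi.add_apply]; ring
  simp only [linz, lin_add, this, R2_eq, flux_add_right, ctr_add, smul_add]; abel

lemma linz_smul (p : Coeffs) (ε h c : ℝ) (ψ f : ℤ → ℝ) :
    linz p ε h ψ (c • f) = c • linz p ε h ψ f := by
  have : R1 h ψ (c • f) = c • R1 h ψ f := by
    ext i; simp only [R1_apply, Pi.smul_apply, smul_eq_mul]; ring
  simp only [linz, lin_smul, this, R2_eq, flux_smul_right, ctr_smul, smul_add, smul_sub,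
    smul_comm c]

lemma linz_sub (p : Coeffs) (ε h : ℝ) (ψ f g : ℤ → ℝ) :
    linz p ε h ψ (f - g) = linz p ε h ψ f - linz p ε h ψ g := by
  rw [sub_eq_add_neg f g, ← neg_one_smul ℝ g, linz_add, linz_smul, neg_one_smul, ← sub_eq_add_neg]

/-- Q₁ is the diagonal T(y,y,y) of a symmetric trilinear form and R₁(u,v) = 3T(u,u,v). The higher
terms 3T(ψ,w,w) + T(w,w,w) are therefore R₁(w, ψ + w/3), which explains the argument in `rmd`. -/
lemma nonlin_add (p : Coeffs) (ε h : ℝ) (ψ w : ℤ → ℝ) :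
    nonlin p ε h (ψ + w) = nonlin p ε h ψ + linz p ε h ψ w + rmd p ε h ψ w := by
  have h1 : Q1 h (ψ + w) = Q1 h ψ + R1 h ψ w + R1 h w (ψ + (1 / 3 : ℝ) • w) := by
    ext i
    simp only [Q1_apply, R1_apply, Pi.add_apply, Pi.smul_apply, smul_eq_mul]
    ring
  have h2 : Q2 p h (ψ + w) = Q2 p h ψ + R2 p h ψ w + Q2 p h w := by
    rw [Q2_eq_ctr, Q2_eq_ctr, Q2_eq_ctr, R2_eq, ← ctr_add, ← ctr_add, flux_add_right,
      flux_comm p h (ψ + w), flux_comm p h (ψ + w), flux_add_right, flux_add_right,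
      flux_comm p h w ψ]
    congr 1
    ext i
    simp only [Pi.add_apply, Pi.smul_apply, smul_eq_mul]
    ring
  unfold nonlin linz rmd
  rw [h1, h2, lin_add]
  simp only [smul_add]; abel

/-- Identifies the right side of (L) with `linz ψ ψ - nonlin ψ`, that is, (L) with a Newton step. -/
lemma linz_self (p : Coeffs) (ε h : ℝ) (y : ℤ → ℝ) :
    linz p ε h y y = nonlin p ε h y + ((2 * p.c₁) • Q1 h y - ε ^ 2 • Q2 p h y) := by
  unfold nonlin linz
  rw [R1_self, R2_self]
  ext i
  simp only [Pi.add_apply, Pi.sub_apply, Pi.smul_apply, smul_eq_mul]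
  ring

/-! ### Pointwise bounds for the nonlinear terms -/

section Bounds

lemma abs_mul_mul_le {a b c A B : ℝ} (ha : |a| ≤ A) (hb : |b| ≤ B) :
    |a * b * c| ≤ A * B * |c| := by
  rw [abs_mul, abs_mul]
  have := (abs_nonneg a).trans ha
  gcongr

lemma abs_R1_le_right {h B : ℝ} (hh : 0 < h) {u v : ℤ → ℝ} (hu : ∀ i, |u i| ≤ B) (i : ℤ) :
    |R1 h u v i| ≤ 2 * B ^ 2 / h * (|v (i - 1)| + |v i| + |v (i + 1)|) := by
  rw [R1_apply, abs_mul, abs_of_pos (by positivity : 0 < 1 / (4 * h))]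
  have e : 2 * B ^ 2 / h * (|v (i - 1)| + |v i| + |v (i + 1)|)
      = 1 / (4 * h) * (8 * B ^ 2 * (|v (i - 1)| + |v i| + |v (i + 1)|)) := by
    field_simp; ring
  rw [e]
  refine mul_le_mul_of_nonneg_left ?_ (by positivity)
  have u0 := hu i
  have u1 := hu (i + 1)
  have u2 := hu (i - 1)
  have t1 := abs_le.1 (abs_mul_mul_le (c := v (i + 1)) u0 u0)
  have t2 := abs_le.1 (abs_mul_mul_le (c := v (i - 1)) u0 u0)
  have t3 := abs_le.1 (abs_mul_mul_le (c := v (i + 1)) u0 u1)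
  have t4 := abs_le.1 (abs_mul_mul_le (c := v (i - 1)) u0 u2)
  have t5 := abs_le.1 (abs_mul_mul_le (c := v (i + 1)) u1 u1)
  have t6 := abs_le.1 (abs_mul_mul_le (c := v (i - 1)) u2 u2)
  have t7 := abs_le.1 (abs_mul_mul_le (c := v i) u0 u1)
  have t8 := abs_le.1 (abs_mul_mul_le (c := v i) u0 u2)
  have t9 := abs_le.1 (abs_mul_mul_le (c := v i) u1 u1)
  have t10 := abs_le.1 (abs_mul_mul_le (c := v i) u2 u2)
  have n0 : 0 ≤ B * B * |v i| :=
    mul_nonneg (mul_self_nonneg B) (abs_nonneg _)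
  have n1 : 0 ≤ B * B * |v (i + 1)| :=
    mul_nonneg (mul_self_nonneg B) (abs_nonneg _)
  have n2 : 0 ≤ B * B * |v (i - 1)| :=
    mul_nonneg (mul_self_nonneg B) (abs_nonneg _)
  rw [abs_le]
  constructor <;> linarith [t1.1, t1.2, t2.1, t2.2, t3.1, t3.2, t4.1, t4.2, t5.1, t5.2, t6.1, t6.2,
    t7.1, t7.2, t8.1, t8.2, t9.1, t9.2, t10.1, t10.2]

/-- Counterpart of `abs_R1_le_right` that keeps a factor of the first argument: in the Taylor
remainder the small quantity stands there. -/
lemma abs_R1_le_left {h B : ℝ} (hh : 0 < h) {u v : ℤ → ℝ} (hu : ∀ i, |u i| ≤ B)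
    (hv : ∀ i, |v i| ≤ B) (i : ℤ) :
    |R1 h u v i| ≤ 2 * B ^ 2 / h * (|u (i - 1)| + |u i| + |u (i + 1)|) := by
  rw [R1_apply, abs_mul, abs_of_pos (by positivity : 0 < 1 / (4 * h))]
  have e : 2 * B ^ 2 / h * (|u (i - 1)| + |u i| + |u (i + 1)|)
      = 1 / (4 * h) * (8 * B ^ 2 * (|u (i - 1)| + |u i| + |u (i + 1)|)) := by
    field_simp; ring
  rw [e]
  refine mul_le_mul_of_nonneg_left ?_ (by positivity)
  have u0 := hu i
  have u1 := hu (i + 1)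
  have u2 := hu (i - 1)
  have v0 := hv i
  have v1 := hv (i + 1)
  have v2 := hv (i - 1)
  have t1 := abs_le.1 (abs_mul_mul_le (c := u i) u0 v1)
  have t2 := abs_le.1 (abs_mul_mul_le (c := u i) u0 v2)
  have t3 := abs_le.1 (abs_mul_mul_le (c := u (i + 1)) u0 v1)
  have t4 := abs_le.1 (abs_mul_mul_le (c := u (i - 1)) u0 v2)
  have t5 := abs_le.1 (abs_mul_mul_le (c := u (i + 1)) u1 v1)
  have t6 := abs_le.1 (abs_mul_mul_le (c := u (i - 1)) u2 v2)
  have t7 := abs_le.1 (abs_mul_mul_le (c := u (i + 1)) u0 v0)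
  have t8 := abs_le.1 (abs_mul_mul_le (c := u (i - 1)) u0 v0)
  have t9 := abs_le.1 (abs_mul_mul_le (c := u (i + 1)) u1 v0)
  have t10 := abs_le.1 (abs_mul_mul_le (c := u (i - 1)) u2 v0)
  have n0 : 0 ≤ B * B * |u i| :=
    mul_nonneg (mul_self_nonneg B) (abs_nonneg _)
  have n1 : 0 ≤ B * B * |u (i + 1)| :=
    mul_nonneg (mul_self_nonneg B) (abs_nonneg _)
  have n2 : 0 ≤ B * B * |u (i - 1)| :=
    mul_nonneg (mul_self_nonneg B) (abs_nonneg _)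
  rw [abs_le]
  constructor <;> linarith [t1.1, t1.2, t2.1, t2.2, t3.1, t3.2, t4.1, t4.2, t5.1, t5.2, t6.1, t6.2,
    t7.1, t7.2, t8.1, t8.2, t9.1, t9.2, t10.1, t10.2]

lemma abs_fwd_le {h B : ℝ} (hh : 0 < h) {u : ℤ → ℝ} (hu : ∀ i, |u i| ≤ B) (i : ℤ) :
    |fwd h u i| ≤ 2 * B / h := by
  rw [fwd_apply, abs_div, abs_of_pos hh]
  gcongr
  linarith [abs_sub (u (i + 1)) (u i), hu i, hu (i + 1)]

/-- The coefficient in the bounds for `flux`. -/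
def fluxConst (p : Coeffs) : ℝ := 4 * |p.c₂ - p.c₃| + 10 * |p.c₃|

lemma fluxConst_nonneg (p : Coeffs) : 0 ≤ fluxConst p := by unfold fluxConst; positivity

/-- The difference quotients of the second argument are kept. -/
lemma abs_flux_le_fwd (p : Coeffs) {h B : ℝ} (hh : 0 < h) {u v : ℤ → ℝ} (hu : ∀ i, |u i| ≤ B)
    (i : ℤ) :
    |flux p h u v i| ≤ fluxConst p * B / h * (|fwd h v (i - 1)| + |fwd h v i|)
      + 4 * |p.c₃| * B / h ^ 2 * |v i| := by
  have hB : 0 ≤ B := (abs_nonneg _).trans (hu 0)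
  have u0 := hu i
  have d0 := abs_fwd_le hh hu i
  have d1 := abs_fwd_le hh hu (i - 1)
  set x := fwd h v i
  set y := fwd h v (i - 1)
  set a := fwd h u i
  set b := fwd h u (i - 1)
  have e1 : |a * y + b * x| ≤ 2 * B / h * (|y| + |x|) := by
    calc _ ≤ |a| * |y| + |b| * |x| := by rw [← abs_mul, ← abs_mul]; exact abs_add_le _ _
      _ ≤ 2 * B / h * |y| + 2 * B / h * |x| := by gcongr
      _ = _ := by ring
  have e2 : |u i * ((x - y) / h)| ≤ B / h * (|y| + |x|) := by
    rw [abs_mul, abs_div, abs_of_pos hh]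
    calc _ ≤ B * ((|x| + |y|) / h) := by gcongr; exact abs_sub _ _
      _ = _ := by ring
  have e3 : |a * x| ≤ 2 * B / h * |x| := by rw [abs_mul]; gcongr
  have e4 : |b * y| ≤ 2 * B / h * |y| := by rw [abs_mul]; gcongr
  have e5 : |(a - b) / h * v i| ≤ 4 * B / h ^ 2 * |v i| := by
    rw [abs_mul, abs_div, abs_of_pos hh]
    calc _ ≤ (2 * B / h + 2 * B / h) / h * |v i| := by
          gcongr; exact (abs_sub _ _).trans (by gcongr)
      _ = _ := by field_simp; ring
  have e6 : |u i * ((x - y) / h) + a * x + b * y + (a - b) / h * v i|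
      ≤ 3 * B / h * (|y| + |x|) + 4 * B / h ^ 2 * |v i| := by
    have t1 := abs_add_le (u i * ((x - y) / h) + a * x + b * y) ((a - b) / h * v i)
    have t2 := abs_add_le (u i * ((x - y) / h) + a * x) (b * y)
    have t3 := abs_add_le (u i * ((x - y) / h)) (a * x)
    have : 3 * B / h * (|y| + |x|)
      = B / h * (|y| + |x|) + 2 * B / h * |x| + 2 * B / h * |y| := by ring
    linarith
  rw [flux_apply]
  calc _ ≤ |p.c₂ - p.c₃| * |a * y + b * x|
        + |p.c₃| * |u i * ((x - y) / h) + a * x + b * y + (a - b) / h * v i| := by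
        rw [← abs_mul, ← abs_mul]; exact abs_add_le _ _
    _ ≤ |p.c₂ - p.c₃| * (2 * B / h * (|y| + |x|))
        + |p.c₃| * (3 * B / h * (|y| + |x|) + 4 * B / h ^ 2 * |v i|) := by gcongr
    _ = (2 * |p.c₂ - p.c₃| + 3 * |p.c₃|) * B / h * (|y| + |x|)
        + 4 * |p.c₃| * B / h ^ 2 * |v i| := by ring
    _ ≤ _ := by
        gcongr
        unfold fluxConst
        linarith [abs_nonneg (p.c₂ - p.c₃), abs_nonneg p.c₃]

lemma abs_flux_le (p : Coeffs) {h B : ℝ} (hh : 0 < h) {u v : ℤ → ℝ} (hu : ∀ i, |u i| ≤ B)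
    (i : ℤ) :
    |flux p h u v i| ≤ 3 * fluxConst p * B / h ^ 2 * (|v (i - 1)| + |v i| + |v (i + 1)|) := by
  have hB : 0 ≤ B := (abs_nonneg _).trans (hu 0)
  refine (abs_flux_le_fwd p hh hu i).trans ?_
  have hc := fluxConst_nonneg p
  have d0 : |fwd h v i| ≤ (|v (i + 1)| + |v i|) / h := by
    rw [fwd_apply, abs_div, abs_of_pos hh]; gcongr; exact abs_sub _ _
  have d1 : |fwd h v (i - 1)| ≤ (|v i| + |v (i - 1)|) / h := by
    rw [fwd_apply, abs_div, abs_of_pos hh, sub_add_cancel]; gcongr; exact abs_sub _ _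
  calc _ ≤ fluxConst p * B / h * ((|v i| + |v (i - 1)|) / h + (|v (i + 1)| + |v i|) / h)
        + fluxConst p * B / h ^ 2 * |v i| := by
        gcongr
        unfold fluxConst
        linarith [abs_nonneg (p.c₂ - p.c₃), abs_nonneg p.c₃]
    _ = fluxConst p * B / h ^ 2 * (|v (i - 1)| + 3 * |v i| + |v (i + 1)|) := by
        field_simp; ring
    _ ≤ fluxConst p * B / h ^ 2 * (3 * (|v (i - 1)| + |v i| + |v (i + 1)|)) := by
        gcongr
        linarith [abs_nonneg (v (i - 1)), abs_nonneg (v (i + 1))]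
    _ = _ := by ring

lemma abs_sec_le {h : ℝ} (hh : 0 < h) (v : ℤ → ℝ) (i : ℤ) :
    |sec h v i| ≤ 2 / h ^ 2 * (|v (i - 1)| + |v i| + |v (i + 1)|) := by
  rw [sec_apply, abs_div, abs_of_pos (by positivity : 0 < h ^ 2), div_mul_eq_mul_div]
  gcongr
  rw [abs_le]
  constructor <;> linarith [neg_abs_le (v (i - 1)), le_abs_self (v (i - 1)), neg_abs_le (v i),
    le_abs_self (v i), neg_abs_le (v (i + 1)), le_abs_self (v (i + 1))]

lemma abs_ctr_le {h : ℝ} (hh : 0 < h) (v : ℤ → ℝ) (i : ℤ) :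
    |ctr h v i| ≤ 1 / h * (|v (i - 1)| + |v i| + |v (i + 1)|) := by
  rw [ctr_apply, abs_div, abs_of_pos (by positivity : 0 < 2 * h), one_div, inv_mul_eq_div]
  rw [div_le_div_iff₀ (by positivity) hh]
  have := abs_sub (v (i + 1)) (v (i - 1))
  have := mul_le_mul_of_nonneg_right this hh.le
  nlinarith [abs_nonneg (v (i - 1)), abs_nonneg (v (i + 1)), abs_nonneg (v i)]

end Bounds

/-! ### Bounds for the forms of the scheme, uniform in ε and h -/

section Forms

variable {p : Coeffs} {ε h : ℝ} {I : ℕ}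

/-- One difference is moved to the test function, where the energy norm pays for it with 1/(αε)
instead of 1/h. -/
lemma abs_inn_ctr_le (hα : 0 < p.α) (hε : 0 < ε) (hh : 0 < h) (P : ℤ → ℝ) {g : ℤ → ℝ}
    (hg : VanishesAtEnds I g) :
    |inn h I (ctr h P) g| ≤ dnorm h I P * (2 * en p ε h I g / (p.α * ε)) := by
  rw [inn_ctr hg.near, abs_neg]
  exact (abs_inn_le hh _ _).trans
    (mul_le_mul_of_nonneg_left (dnorm_ctr_le_en hα hε hh hg) (dnorm_nonneg _))

lemma abs_inn_fwd_le (hα : 0 < p.α) (hε : 0 < ε) (hh : 0 < h) (P : ℤ → ℝ) {g : ℤ → ℝ}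
    (hg : VanishesAtEnds I g) :
    |inn h I (fwd h P) g| ≤ dnorm h I P * (en p ε h I g / (p.α * ε)) := by
  rw [inn_fwd hg.near, abs_neg]
  refine (abs_inn_le hh _ _).trans (mul_le_mul_of_nonneg_left ?_ (dnorm_nonneg _))
  rw [dnorm_bwd hg]
  exact dnorm_fwd_le_en hα hε hh g

/-- The linear part of the scheme in terms of `f_ẋ` and `f_xx̄`. -/
lemma abs_inn_lin_le (hα : 0 < p.α) (hγ : 0 ≤ p.γ) (hε : 0 < ε) (hh : 0 < h) (hh1 : h ≤ 1)
    {f g : ℤ → ℝ} (hg : VanishesAtEnds I g) :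
    |inn h I (lin p ε h f) g| ≤ |p.c₀| * (dnorm h I (ctr h f) * en p ε h I g)
      + 2 * p.γ * ε / p.α * (dnorm h I (sec h f) * en p ε h I g) := by
  unfold lin
  rw [inn_add_left, inn_smul_left, inn_smul_left, inn_add_left, inn_smul_left, inn_smul_left]
  set n := dnorm h I (sec h f)
  set m := en p ε h I g
  have hn : 0 ≤ n := dnorm_nonneg _
  have hm : 0 ≤ m := en_nonneg _
  have a1 : |inn h I (ctr h f) g| ≤ dnorm h I (ctr h f) * m :=
    (abs_inn_le hh _ _).trans (mul_le_mul_of_nonneg_left (dnorm_le_en hh g) (dnorm_nonneg _))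
  have a2 : |inn h I (ctr h (sec h f)) g| ≤ n * (2 * m / (p.α * ε)) :=
    abs_inn_ctr_le hα hε hh _ hg
  have a3 : |inn h I (fwd h (sec h f)) g| ≤ n * (2 * m / (p.α * ε)) := by
    refine (abs_inn_fwd_le hα hε hh _ hg).trans ?_
    gcongr
    linarith
  set s := inn h I (ctr h (sec h f)) g
  set t := inn h I (fwd h (sec h f)) g
  have h1 : 0 ≤ 1 - h := by linarith
  calc _ ≤ |p.c₀| * |inn h I (ctr h f) g|
        + ε ^ 2 * (p.γ * (1 - h) * |s| + p.γ * h * |t|) := by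
        refine (abs_add_le _ _).trans ?_
        rw [abs_mul, abs_mul (ε ^ 2), abs_of_nonneg (sq_nonneg ε)]
        gcongr
        refine (abs_add_le _ _).trans ?_
        rw [abs_mul, abs_mul (p.γ * h), abs_of_nonneg (mul_nonneg hγ h1),
          abs_of_nonneg (mul_nonneg hγ hh.le)]
    _ ≤ |p.c₀| * (dnorm h I (ctr h f) * m)
        + ε ^ 2 * (p.γ * (1 - h) * (n * (2 * m / (p.α * ε)))
          + p.γ * h * (n * (2 * m / (p.α * ε)))) := by gcongr
    _ = _ := by field_simp; ring

/-- With `eps_div_le_scale`: the two sizes 1/h and ε/h² that occur are both dominated by 1/(εh²),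
the scale of the restriction on τ. -/
lemma one_div_le_scale (hε : 0 < ε) (hε1 : ε ≤ 1) (hh : 0 < h) (hhε : h ≤ ε) :
    1 / h ≤ 1 / (ε * h ^ 2) := by
  have : ε * h ^ 2 ≤ h := by
    have : ε * h ≤ 1 := mul_le_one₀ hε1 hh.le (hhε.trans hε1)
    nlinarith
  exact one_div_le_one_div_of_le (by positivity) this

lemma eps_div_le_scale (hε : 0 < ε) (hε1 : ε ≤ 1) (hh : 0 < h) :
    ε / h ^ 2 ≤ 1 / (ε * h ^ 2) := by
  rw [div_le_div_iff₀ (by positivity) (by positivity)]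
  have : ε * ε ≤ 1 := mul_le_one₀ hε1 hε.le hε1
  nlinarith [sq_nonneg h]

lemma abs_inn_R1_le_of {B : ℝ} (hε : 0 < ε) (hε1 : ε ≤ 1) (hh : 0 < h) (hhε : h ≤ ε)
    {P v g : ℤ → ℝ} (hv : VanishesAtEnds I v)
    (hP : ∀ i, |P i| ≤ 2 * B ^ 2 / h * (|v (i - 1)| + |v i| + |v (i + 1)|)) :
    |inn h I P g| ≤ 6 * B ^ 2 * (1 / (ε * h ^ 2) * dnorm h I v * en p ε h I g) := by
  have h2 := one_div_le_scale hε hε1 hh hhε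
  have := dnorm_nonneg (h := h) (I := I) v
  have := en_nonneg (p := p) (ε := ε) (h := h) (I := I) g
  calc _ ≤ 3 * (2 * B ^ 2 / h) * dnorm h I v * dnorm h I g :=
        abs_inn_le_of_stencil hh (by positivity) hv.near hP
    _ ≤ 3 * (2 * B ^ 2 / h) * dnorm h I v * en p ε h I g := by
        gcongr; exact dnorm_le_en hh g
    _ = 6 * B ^ 2 * (1 / h * dnorm h I v * en p ε h I g) := by ring
    _ ≤ _ := by gcongr

lemma abs_inn_R2_le {B : ℝ} (hα : 0 < p.α) (hε : 0 < ε) (hε1 : ε ≤ 1) (hh : 0 < h)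
    {u v g : ℤ → ℝ} (hu : ∀ i, |u i| ≤ B) (hv : VanishesAtEnds I v) (hg : VanishesAtEnds I g) :
    |ε ^ 2 * inn h I (R2 p h u v) g|
      ≤ 18 * fluxConst p * B / p.α * (1 / (ε * h ^ 2) * dnorm h I v * en p ε h I g) := by
  have hB : 0 ≤ B := (abs_nonneg _).trans (hu 0)
  have hc := fluxConst_nonneg p
  have h2 := eps_div_le_scale hε hε1 hh
  have := dnorm_nonneg (h := h) (I := I) v
  have := en_nonneg (p := p) (ε := ε) (h := h) (I := I) g
  have h1 : dnorm h I (flux p h u v) ≤ 3 * (3 * fluxConst p * B / h ^ 2) * dnorm h I v :=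
    dnorm_le_of_stencil hh (by positivity) hv.near (abs_flux_le p hh hu)
  rw [abs_mul, abs_of_nonneg (sq_nonneg ε), R2_eq]
  calc _ ≤ ε ^ 2 * (dnorm h I (flux p h u v) * (2 * en p ε h I g / (p.α * ε))) := by
        gcongr; exact abs_inn_ctr_le hα hε hh _ hg
    _ ≤ ε ^ 2 * (3 * (3 * fluxConst p * B / h ^ 2) * dnorm h I v
          * (2 * en p ε h I g / (p.α * ε))) := by gcongr
    _ = 18 * fluxConst p * B / p.α * (ε / h ^ 2 * dnorm h I v * en p ε h I g) := by
        field_simp; ring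
    _ ≤ _ := by gcongr

/-- Of the three differences in the dispersive terms one goes to `g` and the other two cost 1/h² on
`v`. Having only the L² norm of `v` on the right is what the duality argument needs later. -/
lemma exists_abs_inn_linz_le (p : Coeffs) (hα : 0 < p.α) (hγ : 0 ≤ p.γ) (B : ℝ) :
    ∃ C : ℝ, 0 < C ∧ ∀ (ε h : ℝ) (I : ℕ) (ψ v g : ℤ → ℝ), 0 < ε → ε ≤ 1 → 0 < h → h ≤ ε →
      (∀ i, |ψ i| ≤ B) → VanishesAtEnds I v → VanishesAtEnds I g →
      |inn h I (linz p ε h ψ v) g| ≤ C * (1 / (ε * h ^ 2) * dnorm h I v * en p ε h I g) := by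
  refine ⟨3 * |p.c₀| + 12 * p.γ / p.α + |p.c₁| * (6 * B ^ 2)
    + 18 * fluxConst p * |B| / p.α + 1, ?_, ?_⟩
  · have := fluxConst_nonneg p; positivity
  intro ε h I ψ v g hε hε1 hh hhε hψ hv hg
  have hB : 0 ≤ B := (abs_nonneg _).trans (hψ 0)
  rw [abs_of_nonneg hB]
  have hv0 := dnorm_nonneg (h := h) (I := I) v
  have hg0 := en_nonneg (p := p) (ε := ε) (h := h) (I := I) g
  unfold linz
  rw [inn_sub_left, inn_add_left, inn_smul_left, inn_smul_left]
  set X := 1 / (ε * h ^ 2) * dnorm h I v * en p ε h I g with hX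
  have hX0 : 0 ≤ X := by positivity
  have a1 : |inn h I (lin p ε h v) g| ≤ (3 * |p.c₀| + 12 * p.γ / p.α) * X := by
    have s1 : dnorm h I (ctr h v) ≤ 3 * (1 / h) * dnorm h I v :=
      dnorm_le_of_stencil hh (by positivity) hv.near (abs_ctr_le hh v)
    have s2 : dnorm h I (sec h v) ≤ 3 * (2 / h ^ 2) * dnorm h I v :=
      dnorm_le_of_stencil hh (by positivity) hv.near (abs_sec_le hh v)
    have := one_div_le_scale hε hε1 hh hhε
    have := eps_div_le_scale hε hε1 hh
    calc _ ≤ _ := abs_inn_lin_le hα hγ hε hh (hhε.trans hε1) hg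
      _ ≤ |p.c₀| * (3 * (1 / h) * dnorm h I v * en p ε h I g)
        + 2 * p.γ * ε / p.α * (3 * (2 / h ^ 2) * dnorm h I v * en p ε h I g) := by gcongr
      _ = 3 * |p.c₀| * (1 / h * dnorm h I v * en p ε h I g)
        + 12 * p.γ / p.α * (ε / h ^ 2 * dnorm h I v * en p ε h I g) := by ring
      _ ≤ 3 * |p.c₀| * (1 / (ε * h ^ 2) * dnorm h I v * en p ε h I g)
        + 12 * p.γ / p.α * (1 / (ε * h ^ 2) * dnorm h I v * en p ε h I g) := by gcongr
      _ = _ := by rw [hX]; ring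
  have a2 : |p.c₁ * inn h I (R1 h ψ v) g| ≤ |p.c₁| * (6 * B ^ 2) * X := by
    rw [abs_mul, mul_assoc]
    gcongr
    exact abs_inn_R1_le_of hε hε1 hh hhε hv (abs_R1_le_right hh hψ)
  have a3 := abs_inn_R2_le (p := p) (I := I) hα hε hε1 hh hψ hv hg
  rw [← hX] at a3
  calc _ ≤ |inn h I (lin p ε h v) g| + |p.c₁ * inn h I (R1 h ψ v) g|
        + |ε ^ 2 * inn h I (R2 p h ψ v) g| :=
        (abs_sub _ _).trans (add_le_add_left (abs_add_le _ _) _)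
    _ ≤ _ := by linarith

/-- Bounding all but one factor `w` by its maximum gives an estimate linear in `w`. This suffices
for contraction, not for quadratic convergence. -/
lemma exists_abs_inn_rmd_le (p : Coeffs) (hα : 0 < p.α) (B : ℝ) :
    ∃ C : ℝ, 0 < C ∧ ∀ (ε h : ℝ) (I : ℕ) (ψ w g : ℤ → ℝ), 0 < ε → ε ≤ 1 → 0 < h → h ≤ ε →
      (∀ i, |ψ i| ≤ B) → (∀ i, |w i| ≤ B) → VanishesAtEnds I w → VanishesAtEnds I g →
      |inn h I (rmd p ε h ψ w) g| ≤ C * (1 / (ε * h ^ 2) * dnorm h I w * en p ε h I g) := by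
  refine ⟨|p.c₁| * (6 * (2 * B) ^ 2) + 9 * fluxConst p * |B| / p.α + 1, ?_, ?_⟩
  · have := fluxConst_nonneg p; positivity
  intro ε h I ψ w g hε hε1 hh hhε hψ hw hwV hg
  have hB : 0 ≤ B := (abs_nonneg _).trans (hψ 0)
  rw [abs_of_nonneg hB]
  have hv0 := dnorm_nonneg (h := h) (I := I) w
  have hg0 := en_nonneg (p := p) (ε := ε) (h := h) (I := I) g
  unfold rmd
  rw [inn_sub_left, inn_smul_left, inn_smul_left]
  set X := 1 / (ε * h ^ 2) * dnorm h I w * en p ε h I g with hX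
  have hX0 : 0 ≤ X := by positivity
  have a2 : |p.c₁ * inn h I (R1 h w (ψ + (1 / 3 : ℝ) • w)) g|
      ≤ |p.c₁| * (6 * (2 * B) ^ 2) * X := by
    rw [abs_mul, mul_assoc]
    gcongr
    refine abs_inn_R1_le_of hε hε1 hh hhε hwV (abs_R1_le_left hh ?_ ?_)
    · intro i; linarith [hw i]
    · intro i
      simp only [Pi.add_apply, Pi.smul_apply, smul_eq_mul]
      have := abs_add_le (ψ i) (1 / 3 * w i)
      rw [abs_mul (1 / 3 : ℝ), abs_of_pos (by norm_num : (0 : ℝ) < 1 / 3)] at this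
      linarith [hw i, hψ i]
  have a3 : |ε ^ 2 * inn h I (Q2 p h w) g| ≤ 9 * fluxConst p * B / p.α * X := by
    have a3 := abs_inn_R2_le (p := p) (I := I) hα hε hε1 hh hw hwV hg
    rw [R2_self, inn_smul_left, mul_left_comm, abs_mul, abs_two, ← hX] at a3
    calc _ ≤ 18 * fluxConst p * B / p.α * X / 2 := by linarith
      _ = _ := by ring
  refine (abs_sub _ _).trans ?_
  linarith

lemma abs_Q1_le {B : ℝ} (hh : 0 < h) {y : ℤ → ℝ} (hy : ∀ i, |y i| ≤ B) (i : ℤ) :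
    |Q1 h y i| ≤ 2 * B ^ 2 * (|fwd h y (i - 1)| + |fwd h y i| + |fwd h y (i + 1)|) := by
  have hB : 0 ≤ B := (abs_nonneg _).trans (hy 0)
  have e : Q1 h y i = 1 / 4 * ((y i ^ 2 + y i * (y (i + 1) + y (i - 1))
      + (y (i + 1) ^ 2 + y (i + 1) * y (i - 1) + y (i - 1) ^ 2))
        * (fwd h y i + fwd h y (i - 1))) := by
    rw [Q1_apply, fwd_apply, fwd_apply, sub_add_cancel]; field_simp; ring
  have h0 := abs_le.1 (hy i)
  have h1 := abs_le.1 (hy (i + 1))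
  have h2 := abs_le.1 (hy (i - 1))
  have q : |y i ^ 2 + y i * (y (i + 1) + y (i - 1))
      + (y (i + 1) ^ 2 + y (i + 1) * y (i - 1) + y (i - 1) ^ 2)| ≤ 6 * B ^ 2 := by
    have sq : ∀ j k, |y j * y k| ≤ B ^ 2 := fun j k => by
      rw [abs_mul, pow_two]; gcongr; exacts [hy j, hy k]
    have t1 := abs_le.1 (sq i i)
    have t2 := abs_le.1 (sq i (i + 1))
    have t3 := abs_le.1 (sq i (i - 1))
    have t4 := abs_le.1 (sq (i + 1) (i + 1))
    have t5 := abs_le.1 (sq (i + 1) (i - 1))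
    have t6 := abs_le.1 (sq (i - 1) (i - 1))
    rw [abs_le]
    constructor <;> linarith [t1.1, t1.2, t2.1, t2.2, t3.1, t3.2, t4.1, t4.2, t5.1, t5.2, t6.1, t6.2]
  rw [e, abs_mul, abs_mul, abs_of_pos (by norm_num : (0 : ℝ) < 1 / 4)]
  calc _ ≤ 1 / 4 * (6 * B ^ 2 * (|fwd h y i| + |fwd h y (i - 1)|)) := by
        gcongr; exact abs_add_le _ _
    _ ≤ _ := by
        have : 0 ≤ B ^ 2 * |fwd h y i| := by positivity
        have : 0 ≤ B ^ 2 * |fwd h y (i - 1)| := by positivity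
        have : 0 ≤ B ^ 2 * |fwd h y (i + 1)| := by positivity
        linarith

/-- Using the energy norm of `y` as well, only one power of 1/h is lost. This gives the size τ√ε/h
of the first increment. -/
lemma exists_abs_inn_nonlin_le (p : Coeffs) (hα : 0 < p.α) (hγ : 0 ≤ p.γ) (B : ℝ) :
    ∃ C : ℝ, 0 < C ∧ ∀ (ε h : ℝ) (I : ℕ) (y g : ℤ → ℝ), 0 < ε → ε ≤ 1 → 0 < h → h ≤ ε →
      (∀ i, |y i| ≤ B) → VanishesAtEnds I y → VanishesAtEnds I g →
      |inn h I (nonlin p ε h y) g| ≤ C * (1 / h * en p ε h I y * en p ε h I g) := by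
  refine ⟨2 * |p.c₀| / p.α + 6 * p.γ / p.α ^ 2 + |p.c₁| * (6 * B ^ 2) / p.α
    + 12 * fluxConst p * |B| / p.α ^ 2 + 1, ?_, ?_⟩
  · have := fluxConst_nonneg p; positivity
  intro ε h I y g hε hε1 hh hhε hy hyV hg
  have hB : 0 ≤ B := (abs_nonneg _).trans (hy 0)
  have hfc := fluxConst_nonneg p
  rw [abs_of_nonneg hB]
  have hv0 := en_nonneg (p := p) (ε := ε) (h := h) (I := I) y
  have hg0 := en_nonneg (p := p) (ε := ε) (h := h) (I := I) g
  have hy0 := dnorm_nonneg (h := h) (I := I) (fwd h y)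
  unfold nonlin
  rw [inn_sub_left, inn_add_left, inn_smul_left, inn_smul_left]
  set X := 1 / h * en p ε h I y * en p ε h I g with hX
  have hX0 : 0 ≤ X := by positivity
  have hεh : 1 / ε ≤ 1 / h := one_div_le_one_div_of_le hh hhε
  have hfw := dnorm_fwd_le_en (I := I) hα hε hh y
  have a1 : |inn h I (lin p ε h y) g| ≤ (2 * |p.c₀| / p.α + 6 * p.γ / p.α ^ 2) * X := by
    have s1 := dnorm_ctr_le_en hα hε hh hyV
    have s2 : dnorm h I (sec h y) ≤ 3 * (1 / h) * dnorm h I (fwd h y) := by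
      refine dnorm_le_of_stencil hh (by positivity) (hyV.fwd h) fun i => ?_
      rw [sec_eq, abs_div, abs_of_pos hh, one_div, inv_mul_eq_div]
      gcongr
      linarith [abs_sub (fwd h y i) (fwd h y (i - 1)), abs_nonneg (fwd h y (i + 1))]
    have s3 : dnorm h I (sec h y) ≤ 3 * (1 / h) * (en p ε h I y / (p.α * ε)) :=
      s2.trans (by gcongr)
    calc _ ≤ _ := abs_inn_lin_le hα hγ hε hh (hhε.trans hε1) hg
      _ ≤ |p.c₀| * (2 * en p ε h I y / (p.α * ε) * en p ε h I g)
        + 2 * p.γ * ε / p.α * (3 * (1 / h) * (en p ε h I y / (p.α * ε)) * en p ε h I g) := by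
        gcongr
      _ = 2 * |p.c₀| / p.α * (1 / ε * en p ε h I y * en p ε h I g)
        + 6 * p.γ / p.α ^ 2 * (1 / h * en p ε h I y * en p ε h I g) := by field_simp; ring
      _ ≤ 2 * |p.c₀| / p.α * (1 / h * en p ε h I y * en p ε h I g)
        + 6 * p.γ / p.α ^ 2 * (1 / h * en p ε h I y * en p ε h I g) := by gcongr
      _ = _ := by rw [hX]; ring
  have a2 : |p.c₁ * inn h I (Q1 h y) g| ≤ |p.c₁| * (6 * B ^ 2) / p.α * X := by
    rw [abs_mul]
    calc _ ≤ |p.c₁| * (3 * (2 * B ^ 2) * dnorm h I (fwd h y) * dnorm h I g) := by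
          gcongr
          exact abs_inn_le_of_stencil hh (by positivity) (hyV.fwd h) (abs_Q1_le hh hy)
      _ ≤ |p.c₁| * (3 * (2 * B ^ 2) * (en p ε h I y / (p.α * ε)) * en p ε h I g) := by
          gcongr
          · exact dnorm_nonneg _
          · exact dnorm_le_en hh g
      _ = |p.c₁| * (6 * B ^ 2) / p.α * (1 / ε * en p ε h I y * en p ε h I g) := by
          field_simp; ring
      _ ≤ _ := by rw [hX]; gcongr
  have a3 : |ε ^ 2 * inn h I (Q2 p h y) g| ≤ 12 * fluxConst p * B / p.α ^ 2 * X := by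
    have hq : Q2 p h y = ctr h ((1 / 2 : ℝ) • flux p h y y) := Q2_eq_ctr p h y
    -- Each product in the flux keeps one difference quotient of `y`, while the other factor is
    -- bounded through the maximum of `y`.
    have hflux : ∀ i, |((1 / 2 : ℝ) • flux p h y y) i|
        ≤ 2 * fluxConst p * B / h * (|fwd h y (i - 1)| + |fwd h y i| + |fwd h y (i + 1)|) := by
      intro i
      have d0 := abs_fwd_le hh hy i
      have d1 := abs_fwd_le hh hy (i - 1)
      have y0 := hy i
      simp only [Pi.smul_apply, smul_eq_mul]
      rw [abs_mul, abs_of_pos (by norm_num : (0 : ℝ) < 1 / 2), flux_apply]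
      set a := fwd h y i
      set b := fwd h y (i - 1)
      set s := |b| + |a| + |fwd h y (i + 1)|
      have hs1 : |a| + |b| ≤ s := by
        have := abs_nonneg (fwd h y (i + 1)); simp only [s]; linarith
      have hs : 0 ≤ s := (by positivity : (0:ℝ) ≤ |a| + |b|).trans hs1
      have t1 : |a * b| ≤ 2 * B / h * s := by
        rw [abs_mul]
        exact mul_le_mul d0 (by linarith [abs_nonneg a]) (abs_nonneg b) (by positivity)
      have t2 : |a * a| ≤ 2 * B / h * s := by
        rw [abs_mul]
        exact mul_le_mul d0 (by linarith [abs_nonneg b]) (abs_nonneg a) (by positivity)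
      have t3 : |b * b| ≤ 2 * B / h * s := by
        rw [abs_mul]
        exact mul_le_mul d1 (by linarith [abs_nonneg a]) (abs_nonneg b) (by positivity)
      have t4 : |y i * ((a - b) / h)| ≤ B / h * s := by
        rw [abs_mul, abs_div, abs_of_pos hh]
        calc _ ≤ B * (s / h) := by
              gcongr; exact (abs_sub _ _).trans hs1
          _ = _ := by ring
      have e1 : (p.c₂ - p.c₃) * (a * b + b * a)
          + p.c₃ * (y i * ((a - b) / h) + a * a + b * b + (a - b) / h * y i)
          = (p.c₂ - p.c₃) * (2 * (a * b))
            + p.c₃ * (2 * (y i * ((a - b) / h)) + a * a + b * b) := by ring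
      have e2 : |2 * (y i * ((a - b) / h)) + a * a + b * b|
          ≤ 2 * (B / h * s) + 2 * B / h * s + 2 * B / h * s := by
        rw [abs_le] at *
        constructor <;> linarith [t4.1, t4.2, t2.1, t2.2, t3.1, t3.2]
      rw [e1]
      calc _ ≤ 1 / 2 * (|p.c₂ - p.c₃| * (2 * (2 * B / h * s))
            + |p.c₃| * (2 * (B / h * s) + 2 * B / h * s + 2 * B / h * s)) := by
            gcongr
            refine (abs_add_le _ _).trans ?_
            rw [abs_mul _ (2 * (a * b)), abs_mul 2 (a * b), abs_mul p.c₃, abs_two]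
            gcongr
        _ = (2 * |p.c₂ - p.c₃| + 3 * |p.c₃|) * (B / h * s) := by ring
        _ ≤ (2 * fluxConst p) * (B / h * s) := by
            gcongr
            unfold fluxConst
            linarith [abs_nonneg (p.c₂ - p.c₃), abs_nonneg p.c₃]
        _ = _ := by ring
    have hn : dnorm h I ((1 / 2 : ℝ) • flux p h y y)
        ≤ 3 * (2 * fluxConst p * B / h) * dnorm h I (fwd h y) :=
      dnorm_le_of_stencil hh (by positivity) (hyV.fwd h) hflux
    rw [abs_mul, abs_of_nonneg (sq_nonneg ε), hq]
    calc _ ≤ ε ^ 2 * (dnorm h I ((1 / 2 : ℝ) • flux p h y y)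
          * (2 * en p ε h I g / (p.α * ε))) := by
          gcongr; exact abs_inn_ctr_le hα hε hh _ hg
      _ ≤ ε ^ 2 * (3 * (2 * fluxConst p * B / h) * (en p ε h I y / (p.α * ε))
          * (2 * en p ε h I g / (p.α * ε))) := by
          gcongr; exact hn.trans (by gcongr)
      _ = _ := by rw [hX]; field_simp; ring
  calc _ ≤ |inn h I (lin p ε h y) g| + |p.c₁ * inn h I (Q1 h y) g|
        + |ε ^ 2 * inn h I (Q2 p h y) g| :=
        (abs_sub _ _).trans (add_le_add_left (abs_add_le _ _) _)
    _ ≤ _ := by linarith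

end Forms

/-! ### Energy inequality for even solutions -/

section Conservation

variable {p : Coeffs} {ε h τ : ℝ} {I : ℕ}

lemma inn_ctr_self {f : ℤ → ℝ} (hf : VanishesNearEnds I f) : inn h I (ctr h f) f = 0 := by
  have h1 := inn_ctr (h := h) (f := f) hf
  have h2 := inn_comm h I f (ctr h f)
  linarith

/-- Summation by parts makes the first and third terms of Q₁ cancel, and the middle one is the
product of (z²)_ẋ with z², which vanishes by skew symmetry. -/
lemma inn_Q1_self {z : ℤ → ℝ} (hz : VanishesAtEnds I z) : inn h I (Q1 h z) z = 0 := by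
  have h2 : VanishesNearEnds I (z ^ 2) := fun i hi => by simp [hz.near i hi]
  have e1 : inn h I (z ^ 2 * ctr h z) z = inn h I (z ^ 3) (ctr h z) := by
    simp only [inn, Pi.mul_apply, Pi.pow_apply]
    congr 1
    exact Finset.sum_congr rfl fun i _ => by ring
  have e2 : inn h I (z * ctr h (z ^ 2)) z = inn h I (ctr h (z ^ 2)) (z ^ 2) := by
    simp only [inn, Pi.mul_apply, Pi.pow_apply]
    congr 1
    exact Finset.sum_congr rfl fun i _ => by ring
  rw [Q1, inn_smul_left, inn_add_left, inn_add_left, e1, e2, inn_ctr_self h2, inn_ctr hz.near]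
  ring

/-- The reflection i ↦ 2k - i changes the sign of the product. The sum is first extended to ℤ
because the window need not be symmetric about k. -/
lemma inn_eq_zero_of_odd {P z : ℤ → ℝ} (hz : VanishesAtEnds I z) {k : ℤ}
    (hP : ∀ i, P (2 * k - i) = -P i) (hzk : ∀ i, z (2 * k - i) = z i) : inn h I P z = 0 := by
  have e : ∑ i ∈ Finset.Icc (1 : ℤ) ((I : ℤ) - 1), P i * z i = ∑' i : ℤ, P i * z i :=
    (tsum_eq_sum fun i hi => by
      rw [hz i (by simp only [Finset.mem_Icc] at hi; omega), mul_zero]).symm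
  have r : ∑' i : ℤ, P (2 * k - i) * z (2 * k - i) = ∑' i : ℤ, P i * z i :=
    (Equiv.subLeft (2 * k)).tsum_eq fun i => P i * z i
  simp only [hP, hzk, neg_mul, tsum_neg] at r
  rw [inn, e]
  have : ∑' i : ℤ, P i * z i = 0 := by linarith
  rw [this, mul_zero]

/-- The flux of an even function is even, so its central difference is odd. This is the one place
where evenness enters the energy inequality. -/
lemma inn_Q2_self_of_even {z : ℤ → ℝ} (hz : VanishesAtEnds I z) (he : IsEvenGrid z) :
    inn h I (Q2 p h z) z = 0 := by
  obtain ⟨k, hk⟩ := he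
  have hzk : ∀ i, z (2 * k - i) = z i := fun i => by
    have := hk (k - i)
    rwa [show k + (k - i) = 2 * k - i by ring, show k - (k - i) = i by ring] at this
  have hf : ∀ i, fwd h z (2 * k - i) = -fwd h z (i - 1) := fun i => by
    rw [fwd_apply, fwd_apply, hzk, sub_add_cancel,
      show 2 * k - i + 1 = 2 * k - (i - 1) by ring, hzk]
    ring
  have hf' : ∀ i, fwd h z (2 * k - i - 1) = -fwd h z i := fun i => by
    rw [show 2 * k - i - 1 = 2 * k - (i + 1) by ring, hf, add_sub_cancel_right]
  have hfl : ∀ i, flux p h z z (2 * k - i) = flux p h z z i := fun i => by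
    rw [flux_apply, flux_apply, hf, hf', hzk]; ring
  refine inn_eq_zero_of_odd hz (k := k) (fun i => ?_) hzk
  rw [Q2_eq_ctr, ctr_smul]
  simp only [Pi.smul_apply, smul_eq_mul, ctr_apply]
  rw [show 2 * k - i + 1 = 2 * k - (i - 1) by ring, show 2 * k - i - 1 = 2 * k - (i + 1) by ring,
    hfl, hfl]
  ring

/-- The product of z_x - z_x̄ with z_x + z_x̄ is a difference of squares, and the two quotients have
equal norms. -/
lemma inn_ctr_sec_self {z : ℤ → ℝ} (hz : VanishesAtEnds I z) :
    inn h I (ctr h (sec h z)) z = 0 := by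
  have hs : sec h z = (1 / h) • (fwd h z - bwd h z) := by
    ext i; simp only [sec_eq, bwd_eq_fwd, Pi.smul_apply, Pi.sub_apply, smul_eq_mul]; ring
  rw [inn_ctr hz.near, hs, ctr_eq_smul, inn_smul_left, inn_comm, inn_smul_left, inn_add_left,
    inn_comm h I (fwd h z), inn_comm h I (bwd h z), inn_sub_left, inn_sub_left, inn_self, inn_self,
    normSq_bwd hz, inn_comm h I (bwd h z) (fwd h z)]
  ring

/-- The forward difference is the central one plus (h/2) times a second difference. The central part
drops out and the rest leaves the dissipation (h/2)‖z_xx̄‖². -/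
lemma inn_fwd_sec_self_nonneg (hh : 0 < h) {z : ℤ → ℝ} (hz : VanishesAtEnds I z) :
    0 ≤ inn h I (fwd h (sec h z)) z := by
  have hs : fwd h (sec h z) = ctr h (sec h z) + (h / 2) • sec h (sec h z) := by
    ext i
    simp only [fwd_apply, ctr_apply, sec_apply _ (sec h z), Pi.add_apply, Pi.smul_apply,
      smul_eq_mul]
    field_simp; ring
  have h2 : inn h I (sec h (sec h z)) z = normSq h I (sec h z) := by
    rw [inn_sec hz.near, inn_fwd (hz.fwd h), neg_neg]
    exact inn_self h I (sec h z)
  rw [hs, inn_add_left, inn_smul_left, inn_ctr_sec_self hz, h2]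
  have := normSq_nonneg (I := I) hh (sec h z)
  positivity

lemma inn_nonlin_self_nonneg (hγ : 0 ≤ p.γ) (hh : 0 < h) {z : ℤ → ℝ}
    (hz : VanishesAtEnds I z) (he : IsEvenGrid z) : 0 ≤ inn h I (nonlin p ε h z) z := by
  unfold nonlin lin
  rw [inn_sub_left, inn_add_left, inn_add_left, inn_smul_left, inn_smul_left, inn_smul_left,
    inn_smul_left, inn_add_left, inn_smul_left, inn_smul_left, inn_ctr_self hz.near,
    inn_ctr_sec_self hz, inn_Q1_self hz, inn_Q2_self_of_even hz he]
  have := inn_fwd_sec_self_nonneg hh hz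
  have : 0 ≤ ε ^ 2 * (p.γ * h * inn h I (fwd h (sec h z)) z) := by positivity
  linarith

/-- The energy of an even solution does not exceed the energy of the previous level. -/
lemma IsNonlinearStep.enSq_le (hγ : 0 ≤ p.γ) (hh : 0 < h) (hτ : 0 ≤ τ) {yOld z : ℤ → ℝ}
    (hz : IsNonlinearStep p ε h τ I yOld z) (he : IsEvenGrid z) :
    enSq p ε h I z ≤ enSq p ε h I yOld := by
  have h1 : inn h I (mass p ε h z + τ • nonlin p ε h z) z = inn h I (mass p ε h yOld) z :=
    inn_congr hz.1 hz.2
  rw [inn_add_left, inn_smul_left, inn_mass_self hz.1.near] at h1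
  have h2 := mul_nonneg hτ (inn_nonlin_self_nonneg (ε := ε) hγ hh hz.1 he)
  have h3 := inn_mass_le (p := p) (ε := ε) hh (f := yOld) hz.1.near
  linarith

end Conservation

/-! ### Solvability of the linearized scheme -/

section Solvability

/-- Extension by zero of a function on the nodes `3, …, I - 3`. -/
noncomputable def extendZero (I : ℕ) : (↥(Finset.Icc (3 : ℤ) ((I : ℤ) - 3)) → ℝ) →ₗ[ℝ] (ℤ → ℝ) where
  toFun f i := if hi : i ∈ Finset.Icc (3 : ℤ) ((I : ℤ) - 3) then f ⟨i, hi⟩ else 0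
  map_add' f g := by
    ext i
    by_cases hi : i ∈ Finset.Icc (3 : ℤ) ((I : ℤ) - 3)
    · simp only [Pi.add_apply, dif_pos hi]
    · simp only [Pi.add_apply, dif_neg hi, add_zero]
  map_smul' c f := by
    ext i
    by_cases hi : i ∈ Finset.Icc (3 : ℤ) ((I : ℤ) - 3)
    · simp only [Pi.smul_apply, dif_pos hi, RingHom.id_apply]
    · simp only [Pi.smul_apply, dif_neg hi, smul_zero]

lemma extendZero_vanishes (I : ℕ) (f : ↥(Finset.Icc (3 : ℤ) ((I : ℤ) - 3)) → ℝ) :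
    VanishesAtEnds I (extendZero I f) := fun i hi => by
  have : i ∉ Finset.Icc (3 : ℤ) ((I : ℤ) - 3) := by simp only [Finset.mem_Icc]; omega
  exact dif_neg this

/-- There are as many equations as unknowns, one for each node 3, …, I - 3, so injectivity gives
surjectivity in finite dimension. -/
lemma exists_solution_of_injective (I : ℕ) (A : (ℤ → ℝ) →ₗ[ℝ] (ℤ → ℝ))
    (hA : ∀ f : ℤ → ℝ, VanishesAtEnds I f →
      (∀ i : ℤ, 3 ≤ i → i ≤ (I : ℤ) - 3 → A f i = 0) → f = 0) (r : ℤ → ℝ) :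
    ∃ f : ℤ → ℝ, VanishesAtEnds I f ∧ ∀ i : ℤ, 3 ≤ i → i ≤ (I : ℤ) - 3 → A f i = r i := by
  let res : (ℤ → ℝ) →ₗ[ℝ] (↥(Finset.Icc (3 : ℤ) ((I : ℤ) - 3)) → ℝ) :=
    LinearMap.funLeft ℝ ℝ Subtype.val
  let T := res ∘ₗ A ∘ₗ extendZero I
  have hT : Function.Injective T := by
    rw [← LinearMap.ker_eq_bot, LinearMap.ker_eq_bot']
    intro f hf
    have h0 := hA (extendZero I f) (extendZero_vanishes I f) fun i h1 h2 =>
      congrFun hf ⟨i, Finset.mem_Icc.2 ⟨h1, h2⟩⟩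
    ext ⟨i, hi⟩
    have := congrFun h0 i
    simpa [extendZero, Finset.mem_Icc.1 hi] using this
  obtain ⟨f, hf⟩ := (LinearMap.injective_iff_surjective.1 hT) (res r)
  exact ⟨extendZero I f, extendZero_vanishes I f, fun i h1 h2 =>
    congrFun hf ⟨i, Finset.mem_Icc.2 ⟨h1, h2⟩⟩⟩

/-- The operator of the linearized scheme. -/
noncomputable def stepOp (p : Coeffs) (ε h τ : ℝ) (ψ : ℤ → ℝ) : (ℤ → ℝ) →ₗ[ℝ] (ℤ → ℝ) where
  toFun v := mass p ε h v + τ • linz p ε h ψ v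
  map_add' f g := by simp only [mass_add, linz_add, smul_add]; abel
  map_smul' c f := by
    simp only [mass_smul, linz_smul, smul_add, smul_comm τ c, RingHom.id_apply]

variable {p : Coeffs} {ε h τ : ℝ} {I : ℕ}

lemma IsLinearizedStep_iff {yOld ψ φ : ℤ → ℝ} :
    IsLinearizedStep p ε h τ I yOld ψ φ ↔ VanishesAtEnds I φ ∧
      ∀ i : ℤ, 3 ≤ i → i ≤ (I : ℤ) - 3 → (mass p ε h φ + τ • linz p ε h ψ φ) i =
        (mass p ε h yOld + τ • (linz p ε h ψ ψ - nonlin p ε h ψ)) i := by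
  rw [linz_self, add_sub_cancel_left]; rfl

/-- The equation for the increment of a linearization step. -/
lemma IsLinearizedStep.increment {yOld ψ φ : ℤ → ℝ}
    (hφ : IsLinearizedStep p ε h τ I yOld ψ φ) (i : ℤ) (h1 : 3 ≤ i) (h2 : i ≤ (I : ℤ) - 3) :
    (mass p ε h (φ - ψ) + τ • linz p ε h ψ (φ - ψ)) i
      = mass p ε h yOld i - mass p ε h ψ i - τ * nonlin p ε h ψ i := by
  have := (IsLinearizedStep_iff.1 hφ).2 i h1 h2
  simp only [Pi.add_apply, Pi.smul_apply, smul_eq_mul, Pi.sub_apply, mass_sub, linz_sub] at this ⊢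
  linarith

/-- Testing with `v` itself: the mass term yields the full energy, of which the perturbation
consumes at most one half. -/
lemma en_le_of_linz {C D : ℝ} (hh : 0 < h) (hτ : 0 ≤ τ) (hD : 0 ≤ D) {ψ v r : ℤ → ℝ}
    (hC : |inn h I (linz p ε h ψ v) v| ≤ C * (1 / (ε * h ^ 2) * dnorm h I v * en p ε h I v))
    (hCτ : C * (τ / (ε * h ^ 2)) ≤ 1 / 2) (hv : VanishesAtEnds I v)
    (heq : ∀ i : ℤ, 3 ≤ i → i ≤ (I : ℤ) - 3 →
      (mass p ε h v + τ • linz p ε h ψ v) i = τ * r i)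
    (hr : |inn h I r v| ≤ D * en p ε h I v) : en p ε h I v ≤ 2 * τ * D := by
  have h1 : inn h I (mass p ε h v + τ • linz p ε h ψ v) v = inn h I (τ • r) v :=
    inn_congr hv heq
  rw [inn_add_left, inn_smul_left, inn_smul_left, inn_mass_self hv.near, ← en_sq hh] at h1
  have h2 := neg_le_of_abs_le hC
  have h3 := le_of_abs_le hr
  have h4 := dnorm_le_en (p := p) (ε := ε) (I := I) hh v
  have h5 := dnorm_nonneg (h := h) (I := I) v
  have h6 := en_nonneg (p := p) (ε := ε) (h := h) (I := I) v
  have h7 : τ * (C * (1 / (ε * h ^ 2) * dnorm h I v * en p ε h I v))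
      ≤ 1 / 2 * en p ε h I v ^ 2 := by
    calc _ = C * (τ / (ε * h ^ 2)) * (dnorm h I v * en p ε h I v) := by ring
      _ ≤ 1 / 2 * (dnorm h I v * en p ε h I v) := by gcongr
      _ ≤ 1 / 2 * (en p ε h I v * en p ε h I v) := by gcongr
      _ = _ := by ring
  have h8 := mul_le_mul_of_nonneg_left h2 hτ
  have h9 := mul_le_mul_of_nonneg_left h3 hτ
  have h10 : en p ε h I v * en p ε h I v ≤ en p ε h I v * (2 * τ * D) := by nlinarith
  by_contra hcon
  push Not at hcon
  have : 0 ≤ 2 * τ * D := by positivity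
  have h11 : 0 < en p ε h I v := this.trans_lt hcon
  exact absurd (le_of_mul_le_mul_left h10 h11) (not_le.2 hcon)

lemma eq_zero_of_en {f : ℤ → ℝ} (hh : 0 < h) (hf : VanishesAtEnds I f)
    (h0 : en p ε h I f ≤ 0) : f = 0 := by
  refine eq_zero_of_normSq hh hf ?_
  have h1 := (dnorm_le_en (p := p) (ε := ε) (I := I) hh f).trans h0
  rw [← dnorm_sq hh, le_antisymm h1 (dnorm_nonneg f)]
  simp

lemma abs_le_en (hα : 0 < p.α) (hε : 0 < ε) (hh : 0 < h) {f : ℤ → ℝ}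
    (hf : VanishesAtEnds I f) (i : ℤ) : |f i| ≤ en p ε h I f / √(p.α * ε) := by
  have := Real.abs_le_sqrt (sq_le_enSq (p := p) hα hε hh hf i)
  rwa [Real.sqrt_div' _ (by positivity)] at this

lemma continuous_stepOp_apply (p : Coeffs) (ε h τ : ℝ) (i : ℤ) :
    Continuous fun q : (ℤ → ℝ) × (ℤ → ℝ) => (mass p ε h q.2 + τ • linz p ε h q.1 q.2) i := by
  simp only [mass, linz, lin, R2_eq, Pi.add_apply, Pi.smul_apply, Pi.sub_apply, smul_eq_mul,
    R1_apply, ctr_apply, fwd_apply, sec_apply, flux_apply]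
  fun_prop

lemma continuous_rhs_apply (p : Coeffs) (ε h τ : ℝ) (yOld : ℤ → ℝ) (i : ℤ) :
    Continuous fun ψ : ℤ → ℝ =>
      (mass p ε h yOld + τ • (linz p ε h ψ ψ - nonlin p ε h ψ)) i := by
  simp only [linz_self, add_sub_cancel_left, Q2_eq_ctr, Pi.add_apply, Pi.smul_apply,
    Pi.sub_apply, smul_eq_mul, Q1_apply, ctr_apply, flux_apply, fwd_apply]
  fun_prop

end Solvability

/-! ### Newton steps: contraction, uniqueness and passage to the limit -/

/-- The bound for the form of the linearized scheme around grid functions bounded by `B`. -/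
def LinzBound (p : Coeffs) (ε h : ℝ) (I : ℕ) (B C : ℝ) : Prop :=
  ∀ ψ v g : ℤ → ℝ, (∀ i, |ψ i| ≤ B) → VanishesAtEnds I v → VanishesAtEnds I g →
    |inn h I (linz p ε h ψ v) g| ≤ C * (1 / (ε * h ^ 2) * dnorm h I v * en p ε h I g)

/-- The bound for the form of the Taylor remainder on grid functions bounded by `B`. -/
def RmdBound (p : Coeffs) (ε h : ℝ) (I : ℕ) (B C : ℝ) : Prop :=
  ∀ ψ w g : ℤ → ℝ, (∀ i, |ψ i| ≤ B) → (∀ i, |w i| ≤ B) → VanishesAtEnds I w →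
    VanishesAtEnds I g →
    |inn h I (rmd p ε h ψ w) g| ≤ C * (1 / (ε * h ^ 2) * dnorm h I w * en p ε h I g)

section Steps

variable {p : Coeffs} {ε h τ B C₁ C₂ : ℝ} {I : ℕ}

lemma stepOp_injective (hh : 0 < h) (hτ : 0 ≤ τ) (H₁ : LinzBound p ε h I B C₁)
    (hC₁ : C₁ * (τ / (ε * h ^ 2)) ≤ 1 / 2) {ψ v : ℤ → ℝ} (hψ : ∀ i, |ψ i| ≤ B)
    (hv : VanishesAtEnds I v)
    (heq : ∀ i : ℤ, 3 ≤ i → i ≤ (I : ℤ) - 3 → (mass p ε h v + τ • linz p ε h ψ v) i = 0) :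
    v = 0 := by
  refine eq_zero_of_en (p := p) (ε := ε) hh hv ?_
  have := en_le_of_linz hh hτ le_rfl (H₁ ψ v v hψ hv hv) hC₁ hv (r := 0)
    (fun i h1 h2 => by rw [heq i h1 h2]; simp) (by simp [inn])
  simpa using this

lemma exists_linearizedStep (hh : 0 < h) (hτ : 0 ≤ τ) (H₁ : LinzBound p ε h I B C₁)
    (hC₁ : C₁ * (τ / (ε * h ^ 2)) ≤ 1 / 2) {ψ : ℤ → ℝ} (hψ : ∀ i, |ψ i| ≤ B) (yOld : ℤ → ℝ) :
    ∃ φ, IsLinearizedStep p ε h τ I yOld ψ φ := by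
  obtain ⟨φ, hφ, heq⟩ := exists_solution_of_injective I (stepOp p ε h τ ψ)
    (fun v hv h0 => stepOp_injective hh hτ H₁ hC₁ hψ hv h0)
    (mass p ε h yOld + τ • (linz p ε h ψ ψ - nonlin p ε h ψ))
  exact ⟨φ, IsLinearizedStep_iff.2 ⟨hφ, heq⟩⟩

lemma IsLinearizedStep.unique (hh : 0 < h) (hτ : 0 ≤ τ) (H₁ : LinzBound p ε h I B C₁)
    (hC₁ : C₁ * (τ / (ε * h ^ 2)) ≤ 1 / 2) {ψ yOld φ φ' : ℤ → ℝ} (hψ : ∀ i, |ψ i| ≤ B)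
    (hφ : IsLinearizedStep p ε h τ I yOld ψ φ) (hφ' : IsLinearizedStep p ε h τ I yOld ψ φ') :
    φ = φ' := by
  refine sub_eq_zero.1 (stepOp_injective hh hτ H₁ hC₁ hψ (hφ.1.sub hφ'.1) fun i h1 h2 => ?_)
  have e1 := (IsLinearizedStep_iff.1 hφ).2 i h1 h2
  have e2 := (IsLinearizedStep_iff.1 hφ').2 i h1 h2
  rw [mass_sub, linz_sub]
  simp only [Pi.add_apply, Pi.smul_apply, smul_eq_mul, Pi.sub_apply] at e1 e2 ⊢
  linarith

/-- Successive increments of the iteration contract. -/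
lemma IsLinearizedStep.en_increment_le (hε : 0 < ε) (hh : 0 < h) (hτ : 0 ≤ τ)
    (H₁ : LinzBound p ε h I B C₁)
    (hC₁ : C₁ * (τ / (ε * h ^ 2)) ≤ 1 / 2) (H₂ : RmdBound p ε h I B C₂) (hC₂0 : 0 ≤ C₂)
    (hC₂ : C₂ * (τ / (ε * h ^ 2)) ≤ 1 / 8) {yOld ψ₀ ψ₁ ψ₂ : ℤ → ℝ} (h₀ : VanishesAtEnds I ψ₀)
    (hψ₀ : ∀ i, |ψ₀ i| ≤ B) (hψ₁ : ∀ i, |ψ₁ i| ≤ B) (hd : ∀ i, |(ψ₁ - ψ₀) i| ≤ B)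
    (h₁ : IsLinearizedStep p ε h τ I yOld ψ₀ ψ₁) (h₂ : IsLinearizedStep p ε h τ I yOld ψ₁ ψ₂) :
    en p ε h I (ψ₂ - ψ₁) ≤ 1 / 2 * en p ε h I (ψ₁ - ψ₀) := by
  have V1 := h₁.1.sub h₀
  have V2 := h₂.1.sub h₁.1
  have hn := dnorm_nonneg (h := h) (I := I) (ψ₁ - ψ₀)
  -- The defect of `ψ₁` in (N) is exactly the Taylor remainder of the step from `ψ₀`, and this
  -- defect drives the next increment.
  have key := en_le_of_linz (D := C₂ * (1 / (ε * h ^ 2) * dnorm h I (ψ₁ - ψ₀))) hh hτ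
    (by positivity) (H₁ ψ₁ _ _ hψ₁ V2 V2) hC₁ V2 (r := -rmd p ε h ψ₀ (ψ₁ - ψ₀)) ?_ ?_
  · calc _ ≤ _ := key
      _ = 2 * (C₂ * (τ / (ε * h ^ 2))) * dnorm h I (ψ₁ - ψ₀) := by ring
      _ ≤ 2 * (1 / 8) * dnorm h I (ψ₁ - ψ₀) := by gcongr
      _ ≤ 1 / 2 * dnorm h I (ψ₁ - ψ₀) := by linarith
      _ ≤ _ := by gcongr; exact dnorm_le_en hh _
  · intro i i1 i2
    have e1 := h₁.increment i i1 i2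
    have e2 := h₂.increment i i1 i2
    have e3 := congrFun (nonlin_add p ε h ψ₀ (ψ₁ - ψ₀)) i
    have e4 : mass p ε h ψ₁ i = mass p ε h ψ₀ i + mass p ε h (ψ₁ - ψ₀) i := by
      rw [mass_sub]; simp
    rw [add_sub_cancel] at e3
    rw [e2, e3, e4]
    simp only [Pi.add_apply, Pi.smul_apply, smul_eq_mul, Pi.neg_apply] at e1 ⊢
    linarith
  · rw [inn_neg_left, abs_neg, mul_assoc]
    exact H₂ ψ₀ _ _ hψ₀ hd V1 V2

/-- A solution of (N) satisfies the Newton equation at any `ψ` up to the remainder; subtracting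
`IsLinearizedStep.increment` gives the error equation. -/
lemma IsNonlinearStep.rmd_eq {yOld ψ z : ℤ → ℝ}
    (hz : IsNonlinearStep p ε h τ I yOld z) (i : ℤ) (h1 : 3 ≤ i) (h2 : i ≤ (I : ℤ) - 3) :
    (mass p ε h (z - ψ) + τ • linz p ε h ψ (z - ψ)) i = mass p ε h yOld i - mass p ε h ψ i
      - τ * nonlin p ε h ψ i - τ * rmd p ε h ψ (z - ψ) i := by
  have e1 : (mass p ε h z + τ • nonlin p ε h z) i = mass p ε h yOld i := hz.2 i h1 h2
  have e3 := congrFun (nonlin_add p ε h ψ (z - ψ)) i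
  have e4 : mass p ε h z i = mass p ε h ψ i + mass p ε h (z - ψ) i := by
    rw [mass_sub]; simp
  rw [add_sub_cancel] at e3
  simp only [Pi.add_apply, Pi.smul_apply, smul_eq_mul] at e1 e3 ⊢
  rw [e3, e4] at e1
  linarith

/-- Expanding at `z`, the difference solves a homogeneous linearized equation up to the remainder,
hence is at most a quarter of itself in energy. -/
lemma IsNonlinearStep.unique (hε : 0 < ε) (hh : 0 < h) (hτ : 0 ≤ τ)
    (H₁ : LinzBound p ε h I B C₁) (hC₁ : C₁ * (τ / (ε * h ^ 2)) ≤ 1 / 2)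
    (H₂ : RmdBound p ε h I B C₂) (hC₂0 : 0 ≤ C₂) (hC₂ : C₂ * (τ / (ε * h ^ 2)) ≤ 1 / 8)
    {yOld z z' : ℤ → ℝ}
    (hzB : ∀ i, |z i| ≤ B) (hd : ∀ i, |(z' - z) i| ≤ B)
    (hz : IsNonlinearStep p ε h τ I yOld z) (hz' : IsNonlinearStep p ε h τ I yOld z') :
    z' = z := by
  have V := hz'.1.sub hz.1
  have hn := dnorm_nonneg (h := h) (I := I) (z' - z)
  have key := en_le_of_linz (D := C₂ * (1 / (ε * h ^ 2) * dnorm h I (z' - z))) hh hτ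
    (by positivity) (H₁ z _ _ hzB V V) hC₁ V (r := -rmd p ε h z (z' - z)) ?_ ?_
  · refine sub_eq_zero.1 (eq_zero_of_en (p := p) (ε := ε) hh V ?_)
    have : en p ε h I (z' - z) ≤ 1 / 4 * en p ε h I (z' - z) := by
      calc _ ≤ _ := key
        _ = 2 * (C₂ * (τ / (ε * h ^ 2))) * dnorm h I (z' - z) := by ring
        _ ≤ 2 * (1 / 8) * dnorm h I (z' - z) := by gcongr
        _ = 1 / 4 * dnorm h I (z' - z) := by ring
        _ ≤ _ := by gcongr; exact dnorm_le_en hh _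
    linarith
  · intro i i1 i2
    have e1 := hz'.rmd_eq (ψ := z) i i1 i2
    have e2 : (mass p ε h z + τ • nonlin p ε h z) i = mass p ε h yOld i := hz.2 i i1 i2
    rw [e1]
    simp only [Pi.add_apply, Pi.smul_apply, smul_eq_mul, Pi.neg_apply] at e2 ⊢
    linarith
  · rw [inn_neg_left, abs_neg, mul_assoc]
    exact H₂ z _ _ hzB hd V V

lemma IsNonlinearStep_of_tendsto {yOld z : ℤ → ℝ} {φ : ℕ → ℤ → ℝ}
    (hV : ∀ s, VanishesAtEnds I (φ s))
    (hφ : ∀ s, IsLinearizedStep p ε h τ I yOld (φ s) (φ (s + 1)))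
    (hlim : Tendsto φ atTop (𝓝 z)) : IsNonlinearStep p ε h τ I yOld z := by
  have hpt := tendsto_pi_nhds.1 hlim
  refine ⟨fun i hi => ?_, fun i i1 i2 => ?_⟩
  · refine tendsto_nhds_unique (hpt i) ?_
    simp only [hV _ i hi]
    exact tendsto_const_nhds
  · have l1 := ((continuous_stepOp_apply p ε h τ i).tendsto (z, z)).comp
      (hlim.prodMk_nhds (hlim.comp (tendsto_add_atTop_nat 1)))
    have l2 := ((continuous_rhs_apply p ε h τ yOld i).tendsto z).comp hlim
    have e := tendsto_nhds_unique (l1.congr fun s =>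
      (IsLinearizedStep_iff.1 (hφ s)).2 i i1 i2) l2
    change (mass p ε h z + τ • nonlin p ε h z) i = mass p ε h yOld i
    simp only [Pi.add_apply, Pi.smul_apply, smul_eq_mul, Pi.sub_apply] at e ⊢
    linarith

end Steps

/-! ### Convergence of the iteration to a solution of (N) -/

/-- Convergence of the iteration for a previous level of energy `O(ε)`. -/
theorem exists_iteration_limit (p : Coeffs) (hα : 0 < p.α) (hγ : 0 ≤ p.γ) {C₀ : ℝ}
    (hC₀ : 0 < C₀) : ∃ q : ℝ, 0 < q ∧ ∃ B : ℝ, 0 < B ∧ ∃ C₁ : ℝ, 0 < C₁ ∧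
      ∃ C : ℝ, 0 < C ∧ C₁ * q ≤ 1 / 2 ∧
      ∀ (ε h τ : ℝ) (I : ℕ) (yOld : ℤ → ℝ), 0 < ε → ε ≤ 1 → 0 < h → h ≤ ε → 0 < τ →
        τ ≤ q * ε * h ^ 2 → VanishesAtEnds I yOld → enSq p ε h I yOld ≤ C₀ * ε →
        LinzBound p ε h I B C₁ ∧
        ∃ φ : ℕ → ℤ → ℝ, IsIteration p ε h τ I yOld φ ∧
          (∀ ψ : ℕ → ℤ → ℝ, IsIteration p ε h τ I yOld ψ → ψ = φ) ∧
          (∀ s i, |φ s i| ≤ B) ∧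
          ∃ z : ℤ → ℝ, IsNonlinearStep p ε h τ I yOld z ∧ (∀ s i, |(z - φ s) i| ≤ B) ∧
            (∀ z' : ℤ → ℝ, IsNonlinearStep p ε h τ I yOld z' → enSq p ε h I z' ≤ C₀ * ε →
              z' = z) ∧
            en p ε h I (z - yOld) ≤ C * τ * √ε / h ∧ Tendsto φ atTop (𝓝 z) := by
  -- `K` bounds the maximum of every grid function of energy at most C₀ε. The bound `B` leaves room
  -- for a distance 1 from the old level and for the difference of two solutions bounded by K + 1
  -- and K.
  set K := √(C₀ / p.α) with hK
  have hK0 : 0 ≤ K := Real.sqrt_nonneg _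
  set B := 2 * (K + 1) with hB
  obtain ⟨C₁, hC₁, H₁⟩ := exists_abs_inn_linz_le p hα hγ B
  obtain ⟨C₂, hC₂, H₂⟩ := exists_abs_inn_rmd_le p hα B
  obtain ⟨C₃, hC₃, H₃⟩ := exists_abs_inn_nonlin_le p hα hγ B
  -- The three entries secure invertibility of the linearized operator, contraction, and a first
  -- increment of maximum at most 1/2.
  set q := min (1 / (2 * C₁)) (min (1 / (8 * C₂)) (√p.α / (4 * C₃ * √C₀))) with hq
  have hq1 : C₁ * q ≤ 1 / 2 := by
    calc C₁ * q ≤ C₁ * (1 / (2 * C₁)) := by gcongr; exact min_le_left _ _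
      _ = 1 / 2 := by field_simp
  have hq2 : C₂ * q ≤ 1 / 8 := by
    calc C₂ * q ≤ C₂ * (1 / (8 * C₂)) := by
          gcongr; exact (min_le_right _ _).trans (min_le_left _ _)
      _ = 1 / 8 := by field_simp
  have hq3 : q ≤ √p.α / (4 * C₃ * √C₀) := (min_le_right _ _).trans (min_le_right _ _)
  have hq0 : 0 < q := by positivity
  refine ⟨q, hq0, B, by positivity, C₁, hC₁, 4 * C₃ * √C₀, by positivity, hq1, ?_⟩
  intro ε h τ I yOld hε hε1 hh hhε hτ hτq hV hE
  have L₁ : LinzBound p ε h I B C₁ := fun ψ v g => H₁ ε h I ψ v g hε hε1 hh hhε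
  have L₂ : RmdBound p ε h I B C₂ := fun ψ v g => H₂ ε h I ψ v g hε hε1 hh hhε
  have hτ' : τ / (ε * h ^ 2) ≤ q := by
    rw [div_le_iff₀ (by positivity)]; linarith
  have hk1 : C₁ * (τ / (ε * h ^ 2)) ≤ 1 / 2 := le_trans (by gcongr) hq1
  have hk2 : C₂ * (τ / (ε * h ^ 2)) ≤ 1 / 8 := le_trans (by gcongr) hq2
  have bound_of_energy : ∀ f : ℤ → ℝ, VanishesAtEnds I f → enSq p ε h I f ≤ C₀ * ε →
      ∀ i, |f i| ≤ K := fun f hf hfE i => by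
    refine Real.abs_le_sqrt ((sq_le_enSq hα hε hh hf i).trans ?_)
    calc _ ≤ C₀ * ε / (p.α * ε) := by gcongr
      _ = _ := by field_simp
  have hyK := bound_of_energy yOld hV hE
  have hen : en p ε h I yOld ≤ √C₀ * √ε := by
    rw [← Real.sqrt_mul hC₀.le]; exact Real.sqrt_le_sqrt hE
  -- `δ` bounds the first increment in energy and `η` bounds it in the maximum norm; the factor √ε
  -- cancels in `η`.
  set δ := 2 * τ * (C₃ * (1 / h * (√C₀ * √ε))) with hδ
  set η := δ / √(p.α * ε) with hη
  have hη0 : 0 ≤ η := by positivity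
  have hη1 : η ≤ 1 / 2 := by
    rw [hη, Real.sqrt_mul hα.le, div_le_iff₀ (by positivity)]
    have h1 : τ / h ≤ q := by
      rw [div_le_iff₀ hh]
      have : ε * h ≤ 1 := mul_le_one₀ hε1 hh.le (hhε.trans hε1)
      have := mul_le_mul_of_nonneg_left this (by positivity : 0 ≤ q * h)
      nlinarith
    calc δ = 2 * (C₃ * √C₀ * √ε) * (τ / h) := by rw [hδ]; ring
      _ ≤ 2 * (C₃ * √C₀ * √ε) * (√p.α / (4 * C₃ * √C₀)) := by
          exact mul_le_mul_of_nonneg_left (h1.trans hq3) (by positivity)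
      _ = _ := by field_simp; ring
  have hBK : K + 1 ≤ B := by rw [hB]; linarith
  have hnl : ∀ g, VanishesAtEnds I g →
      |inn h I (nonlin p ε h yOld) g| ≤ C₃ * (1 / h * (√C₀ * √ε)) * en p ε h I g := by
    intro g hg
    have := en_nonneg (p := p) (ε := ε) (h := h) (I := I) g
    calc _ ≤ C₃ * (1 / h * en p ε h I yOld * en p ε h I g) :=
          H₃ ε h I yOld g hε hε1 hh hhε (fun i => by linarith [hyK i]) hV hg
      _ ≤ C₃ * (1 / h * (√C₀ * √ε) * en p ε h I g) := by gcongr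
      _ = _ := by ring
  classical
  -- The default value 0 is never used: every iterate is bounded by `B`, and there the step is
  -- solvable.
  let step : (ℤ → ℝ) → (ℤ → ℝ) := fun ψ =>
    if hs : ∃ φ, IsLinearizedStep p ε h τ I yOld ψ φ then hs.choose else 0
  have hstep : ∀ ψ, (∀ i, |ψ i| ≤ B) → IsLinearizedStep p ε h τ I yOld ψ (step ψ) := by
    intro ψ hψ
    have hs := exists_linearizedStep hh hτ.le L₁ hk1 hψ yOld
    simp only [step, dif_pos hs]
    exact hs.choose_spec
  let φ : ℕ → ℤ → ℝ := fun s => step^[s] yOld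
  have hφ0 : φ 0 = yOld := rfl
  have hφs : ∀ s, φ (s + 1) = step (φ s) := fun s => Function.iterate_succ_apply' _ _ _
  -- The factor 2 - 2/2^s is the partial sum 1 + 1/2 + … + 1/2^(s-1) of the halving increments;
  -- hence the iterates stay within 2η ≤ 1 of `yOld`.
  have claim : ∀ s, VanishesAtEnds I (φ s) ∧ (∀ i, |φ s i - yOld i| ≤ η * (2 - 2 / 2 ^ s)) ∧
      en p ε h I (φ (s + 1) - φ s) ≤ δ / 2 ^ s := by
    have pow_bound : ∀ s : ℕ, η * (2 - 2 / 2 ^ s) ≤ 1 := fun s => by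
      have : (0 : ℝ) < 2 / 2 ^ s := by positivity
      nlinarith
    have toB : ∀ s, (∀ i, |φ s i - yOld i| ≤ η * (2 - 2 / 2 ^ s)) → ∀ i, |φ s i| ≤ B := by
      intro s hs i
      have := abs_add_le (φ s i - yOld i) (yOld i)
      rw [sub_add_cancel] at this
      linarith [hs i, pow_bound s, hyK i]
    have toSup : ∀ s, VanishesAtEnds I (φ s) → VanishesAtEnds I (φ (s + 1)) →
        en p ε h I (φ (s + 1) - φ s) ≤ δ / 2 ^ s →
        ∀ i, |(φ (s + 1) - φ s) i| ≤ η / 2 ^ s := by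
      intro s h1 h2 h3 i
      refine (abs_le_en hα hε hh (h2.sub h1) i).trans ?_
      rw [hη, div_right_comm]
      gcongr
    intro s
    induction s with
    | zero =>
      have hyB : ∀ i, |φ 0 i| ≤ B := fun i => by rw [hφ0]; linarith [hyK i]
      refine ⟨hV, fun i => by simp [hφ0], ?_⟩
      have hs := hstep _ hyB
      rw [← hφs, zero_add] at hs
      have V1 := hs.1.sub hV
      have := en_le_of_linz (r := -nonlin p ε h yOld) (D := C₃ * (1 / h * (√C₀ * √ε))) hh hτ.le
        (by positivity) (L₁ yOld _ _ hyB V1 V1) hk1 V1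
        (fun i i1 i2 => by
          have := hs.increment i i1 i2
          rw [hφ0] at this
          rw [this, Pi.neg_apply]; ring)
        (by rw [inn_neg_left, abs_neg]; exact hnl _ V1)
      rw [zero_add, pow_zero, div_one, hφ0]
      exact this
    | succ s ih =>
      obtain ⟨V, hb, he⟩ := ih
      have hB0 := toB s hb
      have s1 := hstep _ hB0
      rw [← hφs] at s1
      have hsup := toSup s V s1.1 he
      have hb' : ∀ i, |φ (s + 1) i - yOld i| ≤ η * (2 - 2 / 2 ^ (s + 1)) := fun i => by
        have := abs_add_le (φ (s + 1) i - φ s i) (φ s i - yOld i)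
        rw [sub_add_sub_cancel] at this
        have h2 := hsup i
        simp only [Pi.sub_apply] at h2
        calc _ ≤ η / 2 ^ s + η * (2 - 2 / 2 ^ s) := by linarith [hb i]
          _ = _ := by rw [pow_succ]; field_simp; ring
      have hB1 := toB (s + 1) hb'
      have s2 := hstep _ hB1
      rw [← hφs] at s2
      refine ⟨s1.1, hb', ?_⟩
      have hd : ∀ i, |(φ (s + 1) - φ s) i| ≤ B := fun i => by
        refine (hsup i).trans ?_
        have : η / 2 ^ s ≤ η := div_le_self hη0 (one_le_pow₀ (by norm_num))
        linarith
      have := IsLinearizedStep.en_increment_le hε hh hτ.le L₁ hk1 L₂ hC₂.le hk2 V hB0 hB1 hd s1 s2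
      calc _ ≤ _ := this
        _ ≤ 1 / 2 * (δ / 2 ^ s) := by gcongr
        _ = _ := by rw [pow_succ]; field_simp
  have near : ∀ s i, |φ s i - yOld i| ≤ 1 := fun s i => by
    have : (0 : ℝ) < 2 / 2 ^ s := by positivity
    have := (claim s).2.1 i
    nlinarith
  have hφB : ∀ s i, |φ s i| ≤ B := fun s i => by
    have := abs_add_le (φ s i - yOld i) (yOld i)
    rw [sub_add_cancel] at this
    linarith [near s i, hyK i]
  have hlin : ∀ s, IsLinearizedStep p ε h τ I yOld (φ s) (φ (s + 1)) := fun s => by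
    rw [hφs]; exact hstep _ (hφB s)
  have hcau : ∀ i, ∃ a, Tendsto (fun s => φ s i) atTop (𝓝 a) := fun i => by
    refine cauchySeq_tendsto_of_complete
      (cauchySeq_of_le_geometric (1 / 2) η (by norm_num) fun s => ?_)
    rw [dist_comm, Real.dist_eq]
    refine (abs_le_en (p := p) hα hε hh ((claim (s + 1)).1.sub (claim s).1) i).trans ?_
    calc _ ≤ δ / 2 ^ s / √(p.α * ε) := by gcongr; exact (claim s).2.2
      _ = _ := by rw [hη, one_div, inv_pow]; ring
  choose z hz using hcau
  have hlim : Tendsto φ atTop (𝓝 z) := tendsto_pi_nhds.2 hz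
  have hzN := IsNonlinearStep_of_tendsto (fun s => (claim s).1) hlin hlim
  have hzy : ∀ i, |z i - yOld i| ≤ 1 := fun i =>
    le_of_tendsto ((hz i).sub_const (yOld i)).abs (Eventually.of_forall fun s => near s i)
  have hzB : ∀ i, |z i| ≤ K + 1 := fun i => by
    have := abs_add_le (z i - yOld i) (yOld i)
    rw [sub_add_cancel] at this
    linarith [hzy i, hyK i]
  refine ⟨L₁, φ, ⟨hφ0, hlin⟩, ?_, hφB, z, hzN, ?_, ?_, ?_, hlim⟩
  · intro ψ hψ
    funext s
    induction s with
    | zero => rw [hψ.1, hφ0]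
    | succ s ih =>
      have h1 := hψ.2 s
      rw [ih] at h1
      exact h1.unique hh hτ.le L₁ hk1 (hφB s) (hlin s)
  · intro s i
    have := abs_add_le (z i - yOld i) (yOld i - φ s i)
    rw [sub_add_sub_cancel, abs_sub_comm (yOld i)] at this
    simp only [Pi.sub_apply]
    linarith [hzy i, near s i]
  -- No closeness of `z'` to the iterates is assumed: its energy bound alone puts `z' - z` within
  -- `B`.
  · intro z' hz' hE'
    have hK' := bound_of_energy z' hz'.1 hE'
    refine IsNonlinearStep.unique hε hh hτ.le L₁ hk1 L₂ hC₂.le hk2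
      (fun i => (hzB i).trans hBK) (fun i => ?_) hzN hz'
    simp only [Pi.sub_apply]
    linarith [abs_sub (z' i) (z i), hK' i, hzB i]
  · have V := hzN.1.sub hV
    have hn := dnorm_nonneg (h := h) (I := I) (z - yOld)
    have key := en_le_of_linz (r := -nonlin p ε h yOld - rmd p ε h yOld (z - yOld))
      (D := C₃ * (1 / h * (√C₀ * √ε)) + C₂ * (1 / (ε * h ^ 2) * dnorm h I (z - yOld)))
      hh hτ.le (by positivity)
      (L₁ yOld _ _ (fun i => by linarith [hyK i]) V V) hk1 V
      (fun i i1 i2 => by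
        rw [hzN.rmd_eq (ψ := yOld) i i1 i2, Pi.sub_apply, Pi.neg_apply]; ring)
      (by
        rw [inn_sub_left, inn_neg_left, add_mul, mul_assoc C₂]
        refine (abs_sub _ _).trans (add_le_add (by rw [abs_neg]; exact hnl _ V) ?_)
        exact L₂ yOld _ _ (fun i => by linarith [hyK i])
          (fun i => by simp only [Pi.sub_apply]; linarith [hzy i]) V V)
    -- The remainder is absorbed into the left side, which leaves the bound for the first Newton
    -- increment up to a constant factor.
    have h2 : 2 * τ * (C₂ * (1 / (ε * h ^ 2) * dnorm h I (z - yOld)))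
        ≤ 1 / 4 * en p ε h I (z - yOld) := by
      calc _ = 2 * (C₂ * (τ / (ε * h ^ 2))) * dnorm h I (z - yOld) := by ring
        _ ≤ 2 * (1 / 8) * en p ε h I (z - yOld) := by gcongr; exact dnorm_le_en hh _
        _ = _ := by ring
    have h3 : en p ε h I (z - yOld) ≤ 4 / 3 * (2 * τ * (C₃ * (1 / h * (√C₀ * √ε)))) := by
      linarith
    calc _ ≤ _ := h3
      _ ≤ 2 * (2 * τ * (C₃ * (1 / h * (√C₀ * √ε)))) := by gcongr; norm_num
      _ = _ := by ring

/-! ### The initial grid function has energy O(ε) -/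

lemma sq_integral_le {f : ℝ → ℝ} {a b : ℝ} (hab : a ≤ b) (hf : ContinuousOn f (Set.Icc a b)) :
    (∫ x in a..b, f x) ^ 2 ≤ (b - a) * ∫ x in a..b, f x ^ 2 := by
  rcases hab.eq_or_lt with rfl | hlt
  · simp
  have hf' : ContinuousOn f (Set.uIcc a b) := by rwa [Set.uIcc_of_le hab]
  set S := ∫ x in a..b, f x with hS
  set m := S / (b - a) with hm
  -- The Cauchy–Schwarz inequality, read off from the nonnegative variance about the mean `m`.
  have h1 : 0 ≤ ∫ x in a..b, (f x - m) ^ 2 :=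
    intervalIntegral.integral_nonneg hab fun x _ => sq_nonneg _
  have h2 : ∫ x in a..b, (f x - m) ^ 2
      = (∫ x in a..b, f x ^ 2) - 2 * m * S + m ^ 2 * (b - a) := by
    have i1 : IntervalIntegrable (fun x => f x ^ 2) volume a b := (hf'.pow 2).intervalIntegrable
    have i2 : IntervalIntegrable (fun x => 2 * m * f x) volume a b :=
      (hf'.intervalIntegrable).const_mul _
    have i3 : IntervalIntegrable (fun _ : ℝ => m ^ 2) volume a b := intervalIntegrable_const
    calc _ = ∫ x in a..b, (f x ^ 2 - 2 * m * f x + m ^ 2) := by congr 1; ext x; ring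
      _ = _ := by
        rw [intervalIntegral.integral_add (i1.sub i2) i3, intervalIntegral.integral_sub i1 i2,
          intervalIntegral.integral_const_mul, intervalIntegral.integral_const, smul_eq_mul]
        ring
  have hba : 0 < b - a := sub_pos.2 hlt
  have hmS : m * (b - a) = S := div_mul_cancel₀ _ hba.ne'
  rw [h2] at h1
  have h3 : m ^ 2 * (b - a) = m * S := by rw [← hmS]; ring
  have h4 : S ^ 2 = (b - a) * (m * S) := by rw [← hmS]; ring
  rw [h4]
  exact mul_le_mul_of_nonneg_left (by linarith) hba.le

/-- The primitive of a nonnegative function on `[0, R]`, extended by constants. -/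
lemma exists_monotone_primitive {k : ℝ → ℝ} {R : ℝ} (hR : 0 ≤ R) (hk : ∀ x, 0 ≤ k x)
    (hki : IntervalIntegrable k volume 0 R) :
    ∃ G : ℝ → ℝ, Monotone G ∧ (∀ x, 0 ≤ G x) ∧ (∀ x, G x ≤ ∫ x in (0 : ℝ)..R, k x) ∧
      ∀ a b, 0 ≤ a → a ≤ b → b ≤ R → G b - G a = ∫ x in a..b, k x := by
  have hsub : ∀ a b, 0 ≤ a → a ≤ b → b ≤ R → IntervalIntegrable k volume a b := by
    intro a b ha hab hb
    refine hki.mono_set ?_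
    rw [Set.uIcc_of_le hab, Set.uIcc_of_le hR]
    exact Set.Icc_subset_Icc ha hb
  have hP : ∀ a b, 0 ≤ a → a ≤ b → b ≤ R →
      (∫ x in (0 : ℝ)..b, k x) - ∫ x in (0 : ℝ)..a, k x = ∫ x in a..b, k x := by
    intro a b ha hab hb
    rw [sub_eq_iff_eq_add, add_comm]
    exact (intervalIntegral.integral_add_adjacent_intervals (hsub 0 a le_rfl ha (hab.trans hb))
      (hsub a b ha hab hb)).symm
  have hmon : ∀ a b, 0 ≤ a → a ≤ b → b ≤ R →
      (∫ x in (0 : ℝ)..a, k x) ≤ ∫ x in (0 : ℝ)..b, k x := by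
    intro a b ha hab hb
    have h1 := hP a b ha hab hb
    have h2 : 0 ≤ ∫ x in a..b, k x := intervalIntegral.integral_nonneg hab fun x _ => hk x
    linarith
  -- Clamping to [0, R] keeps the primitive monotone and bounded on all of ℝ, so telescoping sums
  -- need no care at the ends.
  have cl : ∀ x, 0 ≤ max 0 (min x R) ∧ max 0 (min x R) ≤ R := fun x =>
    ⟨le_max_left _ _, max_le hR (min_le_right _ _)⟩
  refine ⟨fun x => ∫ t in (0 : ℝ)..(max 0 (min x R)), k t, ?_, ?_, ?_, ?_⟩
  · intro x y hxy
    exact hmon _ _ (cl x).1 (max_le_max le_rfl (min_le_min hxy le_rfl)) (cl y).2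
  · intro x
    exact intervalIntegral.integral_nonneg (cl x).1 fun x _ => hk x
  · intro x
    exact hmon _ _ (cl x).1 (cl x).2 le_rfl
  · intro a b ha hab hb
    simp only [min_eq_left hb, min_eq_left (hab.trans hb), max_eq_right ha,
      max_eq_right (ha.trans hab)]
    exact hP a b ha hab hb

lemma sum_window_telescope (n : ℕ) (G : ℤ → ℝ) :
    ∑ i ∈ Finset.Icc (1 : ℤ) n, (G i - G (i - 1)) = G n - G 0 := by
  induction n with
  | zero => simp
  | succ n ih =>
    have e : Finset.Icc (1 : ℤ) ((n + 1 : ℕ) : ℤ)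
        = (insert (n + 1 : ℤ) (Finset.Icc (1 : ℤ) n) : Finset ℤ) := by
      ext j; simp only [Finset.mem_Icc, Finset.mem_insert]; push_cast; omega
    rw [e, Finset.sum_insert (by simp), ih]
    push_cast
    rw [add_sub_cancel_right]
    ring

lemma sum_window_telescope_le {I : ℕ} (hI : 0 < I) {G : ℤ → ℝ} {A : ℝ} (h0 : ∀ i, 0 ≤ G i)
    (hA : ∀ i, G i ≤ A) :
    ∑ i ∈ Finset.Icc (1 : ℤ) ((I : ℤ) - 1), (G i - G (i - 1)) ≤ A := by
  obtain ⟨n, rfl⟩ : ∃ n, I = n + 1 := ⟨I - 1, by omega⟩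
  have : (((n + 1 : ℕ) : ℤ) - 1) = n := by push_cast; ring
  rw [this, sum_window_telescope]
  linarith [h0 0, hA n]

/-- What is needed of a function of the Sobolev space. -/
lemma SobolevBound.exists_deriv {R M : ℝ} (hR : 0 ≤ R) {u : ℝ → ℝ} (hu : SobolevBound R M u) :
    ∃ v : ℝ → ℝ, ContinuousOn v (Set.Icc 0 R) ∧ ContinuousOn u (Set.Icc 0 R) ∧
      (∀ a b, 0 ≤ a → a ≤ b → b ≤ R → u b - u a = ∫ s in a..b, v s) ∧
      ∫ s in (0 : ℝ)..R, v s ^ 2 ≤ M ^ 2 ∧ ∫ s in (0 : ℝ)..R, u s ^ 2 ≤ M ^ 2 := by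
  obtain ⟨v, g, hg, hv, hu, hM⟩ := hu
  have prim : ∀ (a b : ℝ → ℝ), IntervalIntegrable b volume 0 R →
      (∀ x ∈ Set.Icc 0 R, a x = a 0 + ∫ s in (0 : ℝ)..x, b s) → ContinuousOn a (Set.Icc 0 R) := by
    intro a b hb hab
    have := intervalIntegral.continuousOn_primitive_interval' hb (Set.left_mem_uIcc)
    rw [Set.uIcc_of_le hR] at this
    exact (continuousOn_const.add this).congr hab
  have hgi : IntervalIntegrable g volume 0 R := by
    rw [intervalIntegrable_iff_integrableOn_Ioc_of_le hR]
    exact hg.integrable (by norm_num)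
  have hg2 : IntervalIntegrable (fun s => g s ^ 2) volume 0 R := by
    rw [intervalIntegrable_iff_integrableOn_Ioc_of_le hR]
    exact hg.integrable_sq
  have hvc := prim v g hgi hv
  have hvc' : ContinuousOn v (Set.uIcc 0 R) := by rwa [Set.uIcc_of_le hR]
  have huc := prim u v hvc'.intervalIntegrable hu
  have huc' : ContinuousOn u (Set.uIcc 0 R) := by rwa [Set.uIcc_of_le hR]
  have hu2 : IntervalIntegrable (fun s => u s ^ 2) volume 0 R := (huc'.pow 2).intervalIntegrable
  have hv2 : IntervalIntegrable (fun s => v s ^ 2) volume 0 R := (hvc'.pow 2).intervalIntegrable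
  rw [intervalIntegral.integral_add (hu2.add hv2) hg2, intervalIntegral.integral_add hu2 hv2] at hM
  have n1 : 0 ≤ ∫ s in (0 : ℝ)..R, u s ^ 2 :=
    intervalIntegral.integral_nonneg hR fun x _ => sq_nonneg _
  have n2 : 0 ≤ ∫ s in (0 : ℝ)..R, v s ^ 2 :=
    intervalIntegral.integral_nonneg hR fun x _ => sq_nonneg _
  have n3 : 0 ≤ ∫ s in (0 : ℝ)..R, g s ^ 2 :=
    intervalIntegral.integral_nonneg hR fun x _ => sq_nonneg _
  refine ⟨v, hvc, huc, ?_, by linarith, by linarith⟩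
  intro a b ha hab hb
  have hsub : ∀ c d, 0 ≤ c → c ≤ d → d ≤ R → IntervalIntegrable v volume c d := by
    intro c d hc hcd hd
    refine hvc'.intervalIntegrable.mono_set ?_
    rw [Set.uIcc_of_le hcd, Set.uIcc_of_le hR]
    exact Set.Icc_subset_Icc hc hd
  rw [hu b ⟨ha.trans hab, hb⟩, hu a ⟨ha, hab.trans hb⟩,
    ← intervalIntegral.integral_add_adjacent_intervals (hsub 0 a le_rfl ha (hab.trans hb))
      (hsub a b ha hab hb)]
  ring

lemma initialData_vanishes (ε h : ℝ) (I : ℕ) (u0 : ℝ → ℝ) :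
    VanishesAtEnds I (initialData ε h I u0) := fun i hi => if_neg (by omega)

lemma initialData_apply {ε h : ℝ} {I : ℕ} {u0 : ℝ → ℝ} {i : ℤ} (h1 : 3 ≤ i)
    (h2 : i ≤ (I : ℤ) - 3) : initialData ε h I u0 i =
      (1 / h) * ∫ η in ((i : ℝ) * h - h / 2)..((i : ℝ) * h + h / 2), u0 (η / ε) :=
  if_pos ⟨h1, h2⟩

/-- Squares of averages are bounded by bounds of the squares. -/
lemma sq_average_le {f : ℝ → ℝ} {a b h D : ℝ} (hh : 0 < h) (hab : b - a = h)
    (hD : 0 ≤ D) (hf : ∀ x ∈ Set.Icc a b, f x ^ 2 ≤ D) :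
    (1 / h * ∫ x in a..b, f x) ^ 2 ≤ D := by
  have h1 : ‖∫ x in a..b, f x‖ ≤ √D * |b - a| := by
    refine intervalIntegral.norm_integral_le_of_norm_le_const fun x hx => ?_
    rw [Set.uIoc_of_le (by linarith)] at hx
    exact Real.abs_le_sqrt (hf x ⟨hx.1.le, hx.2⟩)
  rw [hab, abs_of_pos hh, Real.norm_eq_abs] at h1
  rw [← sq_abs, abs_mul, abs_of_pos (by positivity : 0 < 1 / h)]
  calc _ ≤ (1 / h * (√D * h)) ^ 2 := by gcongr
    _ = D := by rw [mul_left_comm, one_div_mul_cancel hh.ne', mul_one, Real.sq_sqrt hD]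

section Initial

variable {L M ε h : ℝ} {I : ℕ} {u0 : ℝ → ℝ}

/-- Jensen's inequality on the disjoint cells. The factor ε comes from the substitution x = η/ε. -/
lemma normSq_initialData_le (hL : 0 < L) (hε : 0 < ε) (hI : 0 < I)
    (hh : h = L / I) (hu : SobolevBound (L / ε) M u0) :
    normSq h I (initialData ε h I u0) ≤ M ^ 2 * ε := by
  have hI' : (0 : ℝ) < I := by exact_mod_cast hI
  have hh0 : 0 < h := by rw [hh]; positivity
  have hIh : (I : ℝ) * h = L := by rw [hh]; field_simp
  have hR : 0 ≤ L / ε := by positivity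
  obtain ⟨v, hv, huc, -, -, hu2⟩ := hu.exists_deriv hR
  have hwc : ContinuousOn (fun η => u0 (η / ε)) (Set.Icc 0 L) := by
    refine huc.comp (by fun_prop) fun x hx => ⟨?_, ?_⟩
    · exact div_nonneg hx.1 hε.le
    · have := hx.2; show x / ε ≤ L / ε; gcongr
  have hw2 : ∫ η in (0 : ℝ)..L, u0 (η / ε) ^ 2 ≤ M ^ 2 * ε := by
    have := intervalIntegral.integral_comp_div (a := 0) (b := L) (fun x => u0 x ^ 2) hε.ne'
    rw [this, zero_div, smul_eq_mul, mul_comm]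
    gcongr
  obtain ⟨G, hGm, hG0, hGM, hGi⟩ := exists_monotone_primitive (k := fun η => u0 (η / ε) ^ 2) hL.le
    (fun x => sq_nonneg _) (by
      have : ContinuousOn (fun η => u0 (η / ε) ^ 2) (Set.uIcc 0 L) := by
        rw [Set.uIcc_of_le hL.le]; exact hwc.pow 2
      exact this.intervalIntegrable)
  set H : ℤ → ℝ := fun i => G ((i : ℝ) * h + h / 2) with hH
  have key : ∀ i ∈ Finset.Icc (1 : ℤ) ((I : ℤ) - 1),
      h * |initialData ε h I u0 i| ^ 2 ≤ H i - H (i - 1) := by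
    intro i _
    have eH : H (i - 1) = G ((i : ℝ) * h - h / 2) := by
      simp only [hH]; congr 1; push_cast; ring
    rw [eH]
    by_cases hi : 3 ≤ i ∧ i ≤ (I : ℤ) - 3
    · have i1 : (3 : ℝ) ≤ i := by exact_mod_cast hi.1
      have i2 : (i : ℝ) ≤ I - 3 := by exact_mod_cast hi.2
      have b1 : 0 ≤ (i : ℝ) * h - h / 2 := by nlinarith
      have b2 : (i : ℝ) * h + h / 2 ≤ L := by nlinarith
      have hab : (i : ℝ) * h - h / 2 ≤ (i : ℝ) * h + h / 2 := by linarith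
      simp only [hH]
      rw [hGi _ _ b1 hab b2, sq_abs, initialData_apply hi.1 hi.2]
      have := sq_integral_le hab (hwc.mono (Set.Icc_subset_Icc b1 b2))
      rw [show (i : ℝ) * h + h / 2 - ((i : ℝ) * h - h / 2) = h by ring] at this
      calc _ = 1 / h * (∫ η in ((i : ℝ) * h - h / 2)..((i : ℝ) * h + h / 2), u0 (η / ε)) ^ 2 := by
            field_simp
        _ ≤ 1 / h * (h * ∫ η in ((i : ℝ) * h - h / 2)..((i : ℝ) * h + h / 2), u0 (η / ε) ^ 2) := by
            gcongr
        _ = _ := by field_simp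
    · rw [initialData_vanishes ε h I u0 i (by omega)]
      have : G ((i : ℝ) * h - h / 2) ≤ G ((i : ℝ) * h + h / 2) := hGm (by linarith)
      simp only [hH, abs_zero, zero_pow two_ne_zero, mul_zero]
      linarith
  unfold normSq
  rw [Finset.mul_sum]
  refine (Finset.sum_le_sum key).trans
    (sum_window_telescope_le hI (fun i => hG0 _) fun i => (hGM _).trans hw2)

/-- An interior difference is an average of increments of u⁰(·/ε) over the distance h. The cut-off
at the first and last free node causes jumps, and these are small because u⁰ vanishes at the end
points, at distance at most 4h. -/
lemma normSq_fwd_initialData_le (hL : 0 < L) (hε : 0 < ε) (hI : 0 < I)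
    (hh : h = L / I) (hu : SobolevBound (L / ε) M u0) (hl : u0 0 = 0) (hr : u0 (L / ε) = 0) :
    ε * normSq h I (fwd h (initialData ε h I u0)) ≤ 16 * M ^ 2 := by
  have hI' : (0 : ℝ) < I := by exact_mod_cast hI
  have hh0 : 0 < h := by rw [hh]; positivity
  have hIh : (I : ℝ) * h = L := by rw [hh]; field_simp
  have hR : 0 ≤ L / ε := by positivity
  obtain ⟨v, hv, huc, hd, hv2, -⟩ := hu.exists_deriv hR
  obtain ⟨G, hGm, hG0, hGM, hGi⟩ := exists_monotone_primitive (k := fun s => v s ^ 2) hR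
    (fun x => sq_nonneg _) (by
      have : ContinuousOn (fun s => v s ^ 2) (Set.uIcc 0 (L / ε)) := by
        rw [Set.uIcc_of_le hR]; exact hv.pow 2
      exact this.intervalIntegrable)
  have hwc : ContinuousOn (fun η => u0 (η / ε)) (Set.Icc 0 L) := by
    refine huc.comp (by fun_prop) fun x hx => ⟨?_, ?_⟩
    · exact div_nonneg hx.1 hε.le
    · have := hx.2; show x / ε ≤ L / ε; gcongr
  have hosc : ∀ a b, 0 ≤ a → a ≤ b → b ≤ L →
      (u0 (b / ε) - u0 (a / ε)) ^ 2 ≤ (b - a) / ε * (G (b / ε) - G (a / ε)) := by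
    intro a b ha hab hb
    have a' : 0 ≤ a / ε := by positivity
    have ab' : a / ε ≤ b / ε := by gcongr
    have b' : b / ε ≤ L / ε := by gcongr
    rw [hd _ _ a' ab' b', hGi _ _ a' ab' b', sub_div]
    exact sq_integral_le ab' (hv.mono (Set.Icc_subset_Icc a' b'))
  have hGM' : ∀ x, G x ≤ M ^ 2 := fun x => (hGM x).trans hv2
  set y := initialData ε h I u0 with hy
  set H : ℤ → ℝ := fun i => G (((i : ℝ) * h + h / 2) / ε) with hH
  -- A budget for the squared differences: M² for each of the two edge jumps, and two increments of
  -- `H`, because shifting a cell by h sweeps two cells. Its sum is at most 4M².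
  set b : ℤ → ℝ := fun i => (if i = 2 then M ^ 2 else 0) + (if i = (I : ℤ) - 3 then M ^ 2 else 0)
    + ((H (i + 1) - H i) + (H i - H (i - 1))) with hb
  have hHmono : ∀ i, H (i - 1) ≤ H (i + 1) := fun i => by
    refine hGm ?_
    push_cast
    gcongr ?_ / ε
    nlinarith
  have hM2 : 0 ≤ M ^ 2 := sq_nonneg M
  have hb0 : ∀ i, 0 ≤ b i := fun i => by
    have := hHmono i
    simp only [hb]
    have t1 : 0 ≤ if i = 2 then M ^ 2 else 0 := by split_ifs <;> simp [hM2]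
    have t2 : 0 ≤ if i = (I : ℤ) - 3 then M ^ 2 else 0 := by split_ifs <;> simp [hM2]
    linarith
  have hcell : ∀ i : ℤ, 3 ≤ i → i ≤ (I : ℤ) - 3 →
      2 * h ≤ (i : ℝ) * h - h / 2 ∧ (i : ℝ) * h + h / 2 ≤ L - 2 * h := by
    intro i i1 i2
    have i1 : (3 : ℝ) ≤ i := by exact_mod_cast i1
    have i2 : (i : ℝ) ≤ I - 3 := by exact_mod_cast i2
    constructor <;> nlinarith
  have key : ∀ i : ℤ, (y (i + 1) - y i) ^ 2 ≤ 4 * h / ε * b i := by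
    intro i
    have trivial_case : y (i + 1) = 0 → y i = 0 → (y (i + 1) - y i) ^ 2 ≤ 4 * h / ε * b i := by
      intro e1 e2
      rw [e1, e2, sub_zero, zero_pow two_ne_zero]
      have := hb0 i
      positivity
    have hVy : VanishesAtEnds I y := initialData_vanishes ε h I u0
    by_cases hl1 : 3 ≤ i + 1 ∧ i + 1 ≤ (I : ℤ) - 3
    · by_cases hl2 : 3 ≤ i
      · have hbi : H (i + 1) - H (i - 1) ≤ b i := by
          simp only [hb]
          have t1 : 0 ≤ if i = 2 then M ^ 2 else 0 := by split_ifs <;> simp [hM2]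
          have t2 : 0 ≤ if i = (I : ℤ) - 3 then M ^ 2 else 0 := by split_ifs <;> simp [hM2]
          linarith
        have c1 := hcell i hl2 (by omega)
        have c2 := hcell (i + 1) hl1.1 hl1.2
        push_cast at c2
        have e : y (i + 1) - y i = 1 / h * ∫ η in ((i : ℝ) * h - h / 2)..((i : ℝ) * h + h / 2),
            (u0 ((η + h) / ε) - u0 (η / ε)) := by
          have hle : (i : ℝ) * h - h / 2 ≤ (i : ℝ) * h + h / 2 := by linarith
          have j1 : IntervalIntegrable (fun η => u0 ((η + h) / ε)) volume
              ((i : ℝ) * h - h / 2) ((i : ℝ) * h + h / 2) := by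
            refine ContinuousOn.intervalIntegrable ?_
            rw [Set.uIcc_of_le hle]
            refine hwc.comp (f := fun η => η + h) (by fun_prop) fun x hx => ⟨?_, ?_⟩
            · have := hx.1; show 0 ≤ x + h; linarith
            · have := hx.2; show x + h ≤ L; linarith
          have j2 : IntervalIntegrable (fun η => u0 (η / ε)) volume
              ((i : ℝ) * h - h / 2) ((i : ℝ) * h + h / 2) := by
            refine ContinuousOn.intervalIntegrable ?_
            rw [Set.uIcc_of_le hle]
            exact hwc.mono (Set.Icc_subset_Icc (by linarith) (by linarith))
          rw [intervalIntegral.integral_sub j1 j2,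
            intervalIntegral.integral_comp_add_right (fun η => u0 (η / ε)), hy,
            initialData_apply hl1.1 hl1.2, initialData_apply hl2 (by omega), mul_sub]
          congr 3
          · push_cast; ring
          · push_cast; ring
        rw [e]
        refine (sq_average_le hh0 (by ring) (D := h / ε * (H (i + 1) - H (i - 1)))
          (mul_nonneg (by positivity) (by linarith [hHmono i])) fun x hx => ?_).trans ?_
        · refine (hosc x (x + h) (by linarith [hx.1]) (by linarith) (by linarith [hx.2])).trans ?_
          rw [add_sub_cancel_left]
          have g1 : G ((x + h) / ε) ≤ H (i + 1) := hGm (by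
            push_cast; gcongr ?_ / ε; linarith [hx.2])
          have g2 : H (i - 1) ≤ G (x / ε) := hGm (by
            push_cast; gcongr ?_ / ε; linarith [hx.1])
          gcongr
        · calc _ ≤ h / ε * b i := by gcongr
            _ ≤ 4 * h / ε * b i := by
              have := hb0 i
              gcongr; linarith
      · have hi2 : i = 2 := by omega
        have e0 : y i = 0 := hVy i (by omega)
        have hbi : M ^ 2 ≤ b i := by
          simp only [hb, hi2, if_true]
          have t2 : 0 ≤ if (2 : ℤ) = (I : ℤ) - 3 then M ^ 2 else 0 := by split_ifs <;> simp [hM2]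
          have := hHmono 2
          linarith
        have c2 := hcell (i + 1) hl1.1 hl1.2
        rw [e0, sub_zero, hy, initialData_apply hl1.1 hl1.2]
        refine (sq_average_le hh0 (by ring) (D := 4 * h / ε * M ^ 2) (by positivity)
          fun x hx => ?_).trans (by gcongr)
        have := hosc 0 x le_rfl (by linarith [hx.1]) (by linarith [hx.2])
        rw [zero_div, hl, sub_zero, sub_zero] at this
        refine this.trans ?_
        have g1 := hGM' (x / ε)
        have g2 := hG0 0
        -- The first averaged cell, around node 3, ends at 7h/2.
        have hx4 : x ≤ 4 * h := by
          have := hx.2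
          rw [hi2] at this
          push_cast at this
          linarith
        have hx0 : 0 ≤ x := by linarith [hx.1]
        calc _ ≤ x / ε * M ^ 2 := by gcongr; linarith
          _ ≤ _ := by gcongr
    · have e1 : y (i + 1) = 0 := hVy _ (by omega)
      by_cases hl2 : 3 ≤ i ∧ i ≤ (I : ℤ) - 3
      · have hi2 : i = (I : ℤ) - 3 := by omega
        have hbi : M ^ 2 ≤ b i := by
          simp only [hb]
          rw [if_pos hi2]
          have t1 : 0 ≤ if i = 2 then M ^ 2 else 0 := by split_ifs <;> simp [hM2]
          have := hHmono i
          linarith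
        have c2 := hcell i hl2.1 hl2.2
        rw [e1, zero_sub, neg_sq, hy, initialData_apply hl2.1 hl2.2]
        refine (sq_average_le hh0 (by ring) (D := 4 * h / ε * M ^ 2) (by positivity)
          fun x hx => ?_).trans (by gcongr)
        have := hosc x L (by linarith [hx.1]) (by linarith [hx.2]) le_rfl
        rw [hr, zero_sub, neg_sq] at this
        refine this.trans ?_
        have g1 := hGM' (L / ε)
        have g2 := hG0 (x / ε)
        have hx4 : L - x ≤ 4 * h := by
          have := hx.1
          rw [hi2] at this
          push_cast at this
          linarith
        have hx0 : 0 ≤ L - x := by linarith [hx.2]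
        calc _ ≤ (L - x) / ε * M ^ 2 := by gcongr; linarith
          _ ≤ _ := by gcongr
      · exact trivial_case e1 (hVy i (by omega))
  have hsum : ∑ i ∈ Finset.Icc (1 : ℤ) ((I : ℤ) - 1), b i ≤ 4 * M ^ 2 := by
    simp only [hb, Finset.sum_add_distrib]
    have s1 : ∑ i ∈ Finset.Icc (1 : ℤ) ((I : ℤ) - 1), (if i = 2 then M ^ 2 else 0) ≤ M ^ 2 := by
      rw [Finset.sum_ite_eq']; split_ifs <;> simp [hM2]
    have s2 : ∑ i ∈ Finset.Icc (1 : ℤ) ((I : ℤ) - 1), (if i = (I : ℤ) - 3 then M ^ 2 else 0)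
        ≤ M ^ 2 := by
      rw [Finset.sum_ite_eq']; split_ifs <;> simp [hM2]
    have s3 := sum_window_telescope_le hI (G := H) (fun i => hG0 _) fun i => hGM' _
    have s4 := sum_window_telescope_le hI (G := fun i => H (i + 1)) (fun i => hG0 _) fun i => hGM' _
    simp only [sub_add_cancel] at s4
    linarith
  unfold normSq
  have hpt : ∑ i ∈ Finset.Icc (1 : ℤ) ((I : ℤ) - 1), |fwd h y i| ^ 2
      ≤ ∑ i ∈ Finset.Icc (1 : ℤ) ((I : ℤ) - 1), 4 / (ε * h) * b i := by
    refine Finset.sum_le_sum fun i _ => ?_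
    rw [sq_abs, fwd_apply, div_pow, div_le_iff₀ (by positivity)]
    calc _ ≤ _ := key i
      _ = _ := by field_simp
  rw [← Finset.mul_sum] at hpt
  calc _ ≤ ε * (h * (4 / (ε * h) * (4 * M ^ 2))) := by
        gcongr
        exact hpt.trans (by gcongr)
    _ = _ := by field_simp; ring

lemma enSq_initialData_le (p : Coeffs) (hL : 0 < L) (hε : 0 < ε) (hI : 0 < I)
    (hh : h = L / I) (hu : SobolevBound (L / ε) M u0) (hl : u0 0 = 0) (hr : u0 (L / ε) = 0) :
    enSq p ε h I (initialData ε h I u0) ≤ M ^ 2 * (1 + 16 * p.α ^ 2) * ε := by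
  have h1 := normSq_initialData_le hL hε hI hh hu
  have h2 := normSq_fwd_initialData_le hL hε hI hh hu hl hr
  unfold enSq
  calc _ = normSq h I (initialData ε h I u0)
        + p.α ^ 2 * ε * (ε * normSq h I (fwd h (initialData ε h I u0))) := by ring
    _ ≤ M ^ 2 * ε + p.α ^ 2 * ε * (16 * M ^ 2) := by gcongr
    _ = _ := by ring

end Initial

/-! ### Quadratic estimates of the Taylor remainder against a dual solution -/

section Duality

variable {p : Coeffs} {ε h : ℝ} {I : ℕ}

/-- The form of `R₁(w, v)`, with the differences moved off `v`. -/
lemma abs_inn_R1_quadratic_le {B G G' : ℝ} (hh : 0 < h) {w v g : ℤ → ℝ}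
    (hw : VanishesAtEnds I w) (hg : VanishesAtEnds I g) (hv : ∀ i, |v i| ≤ B)
    (hG : ∀ i, |g i| ≤ G) (hG' : ∀ i, |fwd h g i| ≤ G') :
    |inn h I (R1 h w v) g| ≤ B * (14 * G * (dnorm h I (fwd h w) * dnorm h I w)
      + 27 * G' * dnorm h I w ^ 2) := by
  have hB : 0 ≤ B := (abs_nonneg _).trans (hv 0)
  have hG0 : 0 ≤ G := (abs_nonneg _).trans (hG 0)
  have hG0' : 0 ≤ G' := (abs_nonneg _).trans (hG' 0)
  set m : ℤ → ℝ := fun i => |w (i - 1)| + |w i| + |w (i + 1)| with hm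
  set d : ℤ → ℝ := fun i => |fwd h w (i - 1)| + |fwd h w i| with hd
  -- `T` is the transpose of R₁(w, ·) applied to `g`. No difference falls on `v`, and every term of
  -- `T` carries a difference of `w` or of `g`.
  set T : ℤ → ℝ := (1 / 2 : ℝ) • (-ctr h (w ^ 2 * g) - (2 : ℝ) • (w * ctr h (w * g))
    - (3 : ℝ) • (w ^ 2 * ctr h g) + (2 : ℝ) • (w * ctr h w * g) + ctr h (w ^ 2) * g) with hT
  have hm0 : ∀ i, 0 ≤ m i := fun i => by simp only [hm]; positivity
  have hd0 : ∀ i, 0 ≤ d i := fun i => by simp only [hd]; positivity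
  have ident : inn h I (R1 h w v) g = inn h I v T := by
    have e1 : inn h I (w ^ 2 * ctr h v) g = - inn h I v (ctr h (w ^ 2 * g)) := by
      rw [← inn_ctr (fun i hi => by simp [hg.near i hi])]
      simp only [inn, Pi.mul_apply, Pi.pow_apply]
      congr 1
      exact Finset.sum_congr rfl fun i _ => by ring
    have e2 : inn h I (w * ctr h (w * v)) g = - inn h I v (w * ctr h (w * g)) := by
      have : inn h I v (w * ctr h (w * g)) = inn h I (w * v) (ctr h (w * g)) := by
        simp only [inn, Pi.mul_apply]
        congr 1
        exact Finset.sum_congr rfl fun i _ => by ring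
      rw [this, ← inn_ctr (fun i hi => by simp [hg.near i hi])]
      simp only [inn, Pi.mul_apply]
      congr 1
      exact Finset.sum_congr rfl fun i _ => by ring
    have e3 : inn h I (ctr h (w ^ 2 * v)) g = - inn h I v (w ^ 2 * ctr h g) := by
      rw [inn_ctr hg.near]
      simp only [inn, Pi.mul_apply, Pi.pow_apply]
      congr 2
      exact Finset.sum_congr rfl fun i _ => by ring
    have e4 : inn h I (w * v * ctr h w) g = inn h I v (w * ctr h w * g) := by
      simp only [inn, Pi.mul_apply]
      congr 1
      exact Finset.sum_congr rfl fun i _ => by ring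
    have e5 : inn h I (v * ctr h (w ^ 2)) g = inn h I v (ctr h (w ^ 2) * g) := by
      simp only [inn, Pi.mul_apply]
      congr 1
      exact Finset.sum_congr rfl fun i _ => by ring
    rw [R1, inn_smul_left, inn_add_left, inn_add_left, inn_add_left, inn_add_left, inn_smul_left,
      inn_smul_left, inn_smul_left, e1, e2, e3, e4, e5, inn_comm h I v T, hT, inn_smul_left,
      inn_add_left, inn_add_left, inn_sub_left, inn_sub_left, inn_neg_left, inn_smul_left,
      inn_smul_left, inn_smul_left, inn_comm h I v, inn_comm h I v, inn_comm h I v, inn_comm h I v,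
      inn_comm h I v]
    ring
  have hTb : ∀ i, |T i| ≤ 3 / 2 * G * (d i * m i) + 3 * G' * (m i * m i) := by
    intro i
    set a := w (i - 1)
    set b := w i
    set c := w (i + 1)
    set D := fwd h w i + fwd h w (i - 1) with hDdef
    set E := fwd h g i + fwd h g (i - 1) with hEdef
    have hD : c = a + h * D := by
      simp only [hDdef, fwd_apply, sub_add_cancel, a, c]; field_simp; ring
    have hE : g (i + 1) = g (i - 1) + h * E := by
      simp only [hEdef, fwd_apply, sub_add_cancel]; field_simp; ring
    have eT : T i = 1 / 4 * (-(D * (a + c) * g (i + 1)) - a * a * E - 2 * (b * D * g (i + 1))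
        - 2 * (b * a * E) - 3 * (b * b * E) + 2 * (b * D * g i) + D * (a + c) * g i) := by
      simp only [hT, Pi.add_apply, Pi.sub_apply, Pi.neg_apply, Pi.smul_apply, Pi.mul_apply,
        Pi.pow_apply, smul_eq_mul, ctr_apply]
      change 1 / 2 * (-((c ^ 2 * g (i + 1) - a ^ 2 * g (i - 1)) / (2 * h))
        - 2 * (b * ((c * g (i + 1) - a * g (i - 1)) / (2 * h)))
        - 3 * (b ^ 2 * ((g (i + 1) - g (i - 1)) / (2 * h)))
        + 2 * (b * ((c - a) / (2 * h)) * g i) + (c ^ 2 - a ^ 2) / (2 * h) * g i) = _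
      have hg' : g (i - 1) = g (i + 1) - h * E := by rw [hE]; ring
      rw [hg', hD]; field_simp; ring
    have hDb : |D| ≤ d i := by
      simp only [hd, hDdef]; linarith [abs_add_le (fwd h w i) (fwd h w (i - 1))]
    have hEb : |E| ≤ 2 * G' := by
      linarith [abs_add_le (fwd h g i) (fwd h g (i - 1)), hG' i, hG' (i - 1)]
    have na := abs_nonneg a
    have nb := abs_nonneg b
    have nc := abs_nonneg c
    have hmi : m i = |a| + |b| + |c| := rfl
    have hac : |a + c| ≤ m i := by rw [hmi]; linarith [abs_add_le a c]
    have ha : |a| ≤ m i := by rw [hmi]; linarith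
    have hb : |b| ≤ m i := by rw [hmi]; linarith
    have P : ∀ x y z X Y Z : ℝ, |x| ≤ X → |y| ≤ Y → |z| ≤ Z → |x * y * z| ≤ X * Y * Z := by
      intro x y z X Y Z hx hy hz
      have := (abs_nonneg x).trans hx
      have := (abs_nonneg y).trans hy
      rw [abs_mul, abs_mul]
      gcongr
    have t1 := abs_le.1 (P _ _ _ _ _ _ hDb hac (hG (i + 1)))
    have t2 := abs_le.1 (P _ _ _ _ _ _ ha ha hEb)
    have t3 := abs_le.1 (P _ _ _ _ _ _ hb hDb (hG (i + 1)))
    have t4 := abs_le.1 (P _ _ _ _ _ _ hb ha hEb)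
    have t5 := abs_le.1 (P _ _ _ _ _ _ hb hb hEb)
    have t6 := abs_le.1 (P _ _ _ _ _ _ hb hDb (hG i))
    have t7 := abs_le.1 (P _ _ _ _ _ _ hDb hac (hG i))
    rw [eT, abs_le]
    constructor <;> linarith [t1.1, t1.2, t2.1, t2.2, t3.1, t3.2, t4.1, t4.2, t5.1, t5.2, t6.1,
      t6.2, t7.1, t7.2]
  have hmn : dnorm h I m ≤ 3 * dnorm h I w := by
    have := dnorm_le_of_stencil hh (c := 1) zero_le_one hw.near (P := m) fun i => by
      rw [abs_of_nonneg (hm0 i), one_mul]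
    linarith
  have hdn : dnorm h I d ≤ 3 * dnorm h I (fwd h w) := by
    have := dnorm_le_of_stencil hh (c := 1) zero_le_one (hw.fwd h) (P := d) fun i => by
      rw [abs_of_nonneg (hd0 i), one_mul]
      simp only [hd]
      linarith [abs_nonneg (fwd h w (i + 1))]
    linarith
  have hw0 := dnorm_nonneg (h := h) (I := I) w
  have hf0 := dnorm_nonneg (h := h) (I := I) (fwd h w)
  have hdm : inn h I d m ≤ 9 * (dnorm h I (fwd h w) * dnorm h I w) := by
    calc _ ≤ _ := le_of_abs_le (abs_inn_le hh d m)
      _ ≤ 3 * dnorm h I (fwd h w) * (3 * dnorm h I w) := by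
        gcongr
        exact dnorm_nonneg m
      _ = _ := by ring
  have hmm : inn h I m m ≤ 9 * dnorm h I w ^ 2 := by
    rw [inn_self, ← dnorm_sq hh]
    calc _ ≤ (3 * dnorm h I w) ^ 2 := by
          gcongr
          exact dnorm_nonneg m
      _ = _ := by ring
  rw [ident]
  calc _ ≤ h * ∑ i ∈ Finset.Icc (1 : ℤ) ((I : ℤ) - 1), |v i| * |T i| := abs_inn_le_sum hh v T
    _ ≤ h * ∑ i ∈ Finset.Icc (1 : ℤ) ((I : ℤ) - 1),
        B * (3 / 2 * G * (d i * m i) + 3 * G' * (m i * m i)) := by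
        gcongr with i _
        · exact hv i
        · exact hTb i
    _ = B * (3 / 2 * G * inn h I d m + 3 * G' * inn h I m m) := by
        rw [← Finset.mul_sum, Finset.sum_add_distrib, ← Finset.mul_sum, ← Finset.mul_sum]
        simp only [inn]; ring
    _ ≤ B * (3 / 2 * G * (9 * (dnorm h I (fwd h w) * dnorm h I w))
        + 3 * G' * (9 * dnorm h I w ^ 2)) := by gcongr
    _ ≤ _ := by
        have : 0 ≤ B * (G * (dnorm h I (fwd h w) * dnorm h I w)) := by positivity
        linarith

/-- By the product rule (w²)_xx̄ = 2w w_xx̄ + (w_x)² + (w_x̄)², all second differences of `w` are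
collected in that of a square and can be moved to the test function. -/
lemma half_flux_self (p : Coeffs) (hh : h ≠ 0) (w : ℤ → ℝ) :
    (1 / 2 : ℝ) • flux p h w w
      = (p.c₂ - p.c₃) • (fwd h w * bwd h w) + (p.c₃ / 2) • sec h (w ^ 2) := by
  ext i
  simp only [flux_apply, Pi.smul_apply, Pi.add_apply, Pi.mul_apply, Pi.pow_apply, smul_eq_mul,
    bwd_eq_fwd, fwd_apply, sec_apply, sub_add_cancel]
  field_simp
  ring

/-- The form of `Q₂(w)` against the solution `g` of a discrete Dirichlet problem: `s` is the
second difference quotient of `g` at the interior nodes. -/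
lemma abs_inn_Q2_quadratic_le {G' S : ℝ} (hh : 0 < h) {w g s : ℤ → ℝ}
    (hw : VanishesAtEnds I w) (hg : VanishesAtEnds I g) (hG' : ∀ i, |fwd h g i| ≤ G')
    (hs : VanishesAtEnds I s) (hsec : ∀ i : ℤ, 3 ≤ i → i ≤ (I : ℤ) - 3 → sec h g i = s i)
    (hS : ∀ i, |w i| ≤ S) :
    |inn h I (Q2 p h w) g| ≤ (|p.c₂ - p.c₃| + |p.c₃|) * (G' * dnorm h I (fwd h w) ^ 2)
      + 9 * |p.c₃| * (S * dnorm h I (fwd h w) * dnorm h I s) := by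
  have hG0' : 0 ≤ G' := (abs_nonneg _).trans (hG' 0)
  have hS0 : 0 ≤ S := (abs_nonneg _).trans (hS 0)
  have hf0 := dnorm_nonneg (h := h) (I := I) (fwd h w)
  have hs0 := dnorm_nonneg (h := h) (I := I) s
  have hctr : ∀ i, |ctr h g i| ≤ G' := fun i => by
    rw [ctr_eq, abs_div, abs_two]
    linarith [abs_add_le (fwd h g i) (fwd h g (i - 1)), hG' i, hG' (i - 1)]
  have e : inn h I (Q2 p h w) g = -((p.c₂ - p.c₃) * inn h I (fwd h w * bwd h w) (ctr h g))
      + p.c₃ / 2 * inn h I (fwd h (w ^ 2)) (fwd h (ctr h g)) := by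
    rw [Q2_eq_ctr, half_flux_self p hh.ne', inn_ctr hg.near, inn_add_left, inn_smul_left,
      inn_smul_left, inn_sec (hg.ctr h)]
    ring
  have a1 : |inn h I (fwd h w * bwd h w) (ctr h g)| ≤ G' * dnorm h I (fwd h w) ^ 2 := by
    have h1 : inn h I (fun i => |fwd h w i|) (fun i => |bwd h w i|) ≤ dnorm h I (fwd h w) ^ 2 := by
      have := le_of_abs_le (abs_inn_le (I := I) hh (fun i => |fwd h w i|) fun i => |bwd h w i|)
      have n1 : dnorm h I (fun i => |fwd h w i|) = dnorm h I (fwd h w) := by simp [dnorm, normSq]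
      have n2 : dnorm h I (fun i => |bwd h w i|) = dnorm h I (bwd h w) := by simp [dnorm, normSq]
      rw [n1, n2, dnorm_bwd hw] at this
      linarith [pow_two (dnorm h I (fwd h w))]
    calc _ ≤ _ := abs_inn_le_sum hh _ _
      _ ≤ h * ∑ i ∈ Finset.Icc (1 : ℤ) ((I : ℤ) - 1), |fwd h w i| * |bwd h w i| * G' := by
          gcongr with i _
          · rw [Pi.mul_apply, abs_mul]
          · exact hctr i
      _ = G' * inn h I (fun i => |fwd h w i|) (fun i => |bwd h w i|) := by
          rw [← Finset.sum_mul]; simp only [inn]; ring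
      _ ≤ _ := by gcongr
  -- `t` is what the difference of g_ẋ would be if `s` were the second difference of `g` everywhere;
  -- the two disagree where w² has a nonzero difference only at the edges i = 2 and i = I - 3.
  set t : ℤ → ℝ := fun i => (s i + s (i + 1)) / 2 with ht
  have htn : dnorm h I t ≤ 3 / 2 * dnorm h I s := by
    have := dnorm_le_of_stencil hh (c := 1 / 2) (by norm_num) hs.near (P := t) fun i => by
      simp only [ht]
      rw [abs_div, abs_two]
      linarith [abs_add_le (s i) (s (i + 1)), abs_nonneg (s (i - 1))]
    linarith
  have hFn : dnorm h I (fwd h (w ^ 2)) ≤ 6 * S * dnorm h I (fwd h w) := by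
    have := dnorm_le_of_stencil hh (c := 2 * S) (by positivity) (hw.fwd h)
      (P := fwd h (w ^ 2)) fun i => by
        have e1 : fwd h (w ^ 2) i = (w (i + 1) + w i) * fwd h w i := by
          simp only [fwd_apply, Pi.pow_apply]; ring
        rw [e1, abs_mul]
        have h1 : |w (i + 1) + w i| ≤ 2 * S := by
          linarith [abs_add_le (w (i + 1)) (w i), hS i, hS (i + 1)]
        gcongr
        linarith [abs_nonneg (fwd h w (i - 1)), abs_nonneg (fwd h w (i + 1))]
    linarith
  have err : ∀ i, |fwd h (w ^ 2) i * (fwd h (ctr h g) i - t i)| ≤ G' * fwd h w i ^ 2 := by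
    intro i
    have e1 : fwd h (ctr h g) i = (sec h g i + sec h g (i + 1)) / 2 := by
      simp only [fwd_apply, ctr_apply, sec_apply, add_sub_cancel_right]
      field_simp
      ring
    have hpos : 0 ≤ G' * fwd h w i ^ 2 := by positivity
    have hzero : fwd h (w ^ 2) i = 0 →
        |fwd h (w ^ 2) i * (fwd h (ctr h g) i - t i)| ≤ G' * fwd h w i ^ 2 := fun h0 => by
      rw [h0, zero_mul, abs_zero]; exact hpos
    by_cases hi : i ≤ 1 ∨ (I : ℤ) - 2 ≤ i
    · refine hzero ?_
      simp only [fwd_apply, Pi.pow_apply]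
      rw [hw i (by omega), hw (i + 1) (by omega)]
      simp
    by_cases hI : (I : ℤ) ≤ 5
    · refine hzero ?_
      simp only [fwd_apply, Pi.pow_apply]
      rw [hw i (by omega), hw (i + 1) (by omega)]
      simp
    -- At an edge, one of the two values of `w` is zero, so the difference of w² equals ±h (w_x)².
    -- This factor h compensates the 1/h in the uncontrolled second difference of `g`.
    have hedge : ∀ x : ℝ, |x| ≤ G' → |fwd h (w ^ 2) i| ≤ h * fwd h w i ^ 2 →
        fwd h (ctr h g) i - t i = x / h / 2 →
        |fwd h (w ^ 2) i * (fwd h (ctr h g) i - t i)| ≤ G' * fwd h w i ^ 2 := by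
      intro x hx hF hd
      rw [hd, abs_mul, abs_div, abs_div, abs_of_pos hh, abs_two]
      calc _ ≤ h * fwd h w i ^ 2 * (G' / h / 2) := by gcongr
        _ = G' * fwd h w i ^ 2 / 2 := by field_simp
        _ ≤ _ := by linarith
    by_cases h2 : i = 2
    · refine hedge (fwd h g i) (hG' i) ?_ ?_
      · simp only [fwd_apply, Pi.pow_apply]
        rw [hw i (by omega)]
        rw [abs_of_nonneg (by simp only [zero_pow two_ne_zero, sub_zero]; positivity)]
        refine le_of_eq ?_
        field_simp
        ring
      · rw [e1, hsec (i + 1) (by omega) (by omega)]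
        simp only [ht]
        rw [hs i (by omega), sec_apply, fwd_apply, hg i (by omega), hg (i - 1) (by omega)]
        field_simp
        ring
    by_cases h3 : i = (I : ℤ) - 3
    · refine hedge (-fwd h g i) (by rw [abs_neg]; exact hG' i) ?_ ?_
      · simp only [fwd_apply, Pi.pow_apply]
        rw [hw (i + 1) (by omega), abs_div, abs_of_pos hh, zero_pow two_ne_zero, zero_sub, abs_neg,
          abs_of_nonneg (sq_nonneg _)]
        refine le_of_eq ?_
        field_simp
        ring
      · rw [e1, hsec i (by omega) (by omega)]
        simp only [ht]
        rw [hs (i + 1) (by omega), sec_apply, fwd_apply, hg (i + 1) (by omega),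
          hg (i + 1 + 1) (by omega), add_sub_cancel_right]
        field_simp
        ring
    · rw [e1, hsec i (by omega) (by omega), hsec (i + 1) (by omega) (by omega)]
      simp only [ht, sub_self, mul_zero, abs_zero]
      exact hpos
  have a2 : |inn h I (fwd h (w ^ 2)) (fwd h (ctr h g))|
      ≤ 9 * (S * dnorm h I (fwd h w) * dnorm h I s) + G' * dnorm h I (fwd h w) ^ 2 := by
    have e2 : inn h I (fwd h (w ^ 2)) (fwd h (ctr h g)) = inn h I (fwd h (w ^ 2)) t
        + inn h I (fwd h (w ^ 2)) (fwd h (ctr h g) - t) := by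
      rw [inn_comm h I _ (fwd h (ctr h g) - t), inn_sub_left, inn_comm h I t,
        inn_comm h I (fwd h (ctr h g))]
      ring
    have b1 : |inn h I (fwd h (w ^ 2)) t| ≤ 9 * (S * dnorm h I (fwd h w) * dnorm h I s) := by
      calc _ ≤ _ := abs_inn_le hh _ _
        _ ≤ 6 * S * dnorm h I (fwd h w) * (3 / 2 * dnorm h I s) := by
          gcongr
          exact dnorm_nonneg _
        _ = _ := by ring
    have b2 : |inn h I (fwd h (w ^ 2)) (fwd h (ctr h g) - t)|
        ≤ G' * dnorm h I (fwd h w) ^ 2 := by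
      calc _ ≤ _ := abs_inn_le_sum hh _ _
        _ ≤ h * ∑ i ∈ Finset.Icc (1 : ℤ) ((I : ℤ) - 1), G' * (fwd h w i * fwd h w i) := by
            refine mul_le_mul_of_nonneg_left (Finset.sum_le_sum fun i _ => ?_) hh.le
            rw [← abs_mul, Pi.sub_apply, ← pow_two]
            exact err i
        _ = G' * dnorm h I (fwd h w) ^ 2 := by
            rw [dnorm_sq hh, ← inn_self, ← Finset.mul_sum]; simp only [inn]; ring
    rw [e2]
    exact (abs_add_le _ _).trans (add_le_add b1 b2)
  have hp : 0 ≤ 9 * (S * dnorm h I (fwd h w) * dnorm h I s) := by positivity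
  have hp' : 0 ≤ G' * dnorm h I (fwd h w) ^ 2 := by positivity
  rw [e]
  calc _ ≤ |p.c₂ - p.c₃| * |inn h I (fwd h w * bwd h w) (ctr h g)|
        + |p.c₃| / 2 * |inn h I (fwd h (w ^ 2)) (fwd h (ctr h g))| := by
        refine (abs_add_le _ _).trans ?_
        rw [abs_neg, abs_mul, abs_mul, abs_div, abs_two]
    _ ≤ |p.c₂ - p.c₃| * (G' * dnorm h I (fwd h w) ^ 2) + |p.c₃| / 2 *
        (9 * (S * dnorm h I (fwd h w) * dnorm h I s) + G' * dnorm h I (fwd h w) ^ 2) := by gcongr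
    _ ≤ _ := by
        have n1 := mul_nonneg (abs_nonneg p.c₃) hp
        have n2 := mul_nonneg (abs_nonneg p.c₃) hp'
        linarith

/-- The maximum of the difference quotient in terms of second difference quotients at the
interior nodes. -/
lemma sq_fwd_le {L : ℝ} (hh : 0 < h) (hL : 0 < L) (hIh : I * h = L) (hhL : 10 * h ≤ L)
    {g s : ℤ → ℝ} (hg : VanishesAtEnds I g)
    (hsec : ∀ i : ℤ, 3 ≤ i → i ≤ (I : ℤ) - 3 → sec h g i = s i) (i : ℤ) :
    fwd h g i ^ 2 ≤ 2 / L * dnorm h I (fwd h g) ^ 2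
      + 6 * (dnorm h I s * dnorm h I (fwd h g)) := by
  set a := fwd h g with ha
  set t : ℤ → ℝ := fun i => |s i| * (|a i| + |a (i - 1)|) with ht
  have ht0 : ∀ i, 0 ≤ t i := fun i => by simp only [ht]; positivity
  have hn := dnorm_nonneg (h := h) (I := I) a
  have hn' := dnorm_nonneg (h := h) (I := I) s
  by_cases hi : i ≤ 1 ∨ (I : ℤ) - 2 ≤ i
  · have : a i = 0 := by
      rw [ha, fwd_apply, hg i (by omega), hg (i + 1) (by omega)]; simp
    rw [this, zero_pow two_ne_zero]; positivity
  -- Only the nodes 2, …, I - 3 are compared: beyond them g_x jumps to zero and its differences are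
  -- not given by `s`.
  have step : ∀ n : ℕ, ∀ k : ℤ, 2 ≤ k → k + n ≤ (I : ℤ) - 3 →
      |a (k + n) ^ 2 - a k ^ 2| ≤ h * ∑ j ∈ Finset.Ioc k (k + n), t j := by
    intro n k hk
    induction n with
    | zero => intro _; simp
    | succ n ih =>
      intro hkn
      push_cast at hkn
      have ih' := ih (by omega)
      have e : Finset.Ioc k (k + (n + 1 : ℕ))
          = (insert (k + n + 1 : ℤ) (Finset.Ioc k (k + n : ℤ)) : Finset ℤ) := by
        ext j; simp only [Finset.mem_Ioc, Finset.mem_insert]; push_cast; omega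
      have e2 : (k + (n + 1 : ℕ) : ℤ) = k + n + 1 := by push_cast; ring
      rw [e, Finset.sum_insert (by simp), mul_add, e2]
      have hstep : |a (k + n + 1) ^ 2 - a (k + n) ^ 2| ≤ h * t (k + n + 1) := by
        have h1 : a (k + n + 1) - a (k + n) = h * s (k + n + 1) := by
          rw [← hsec _ (by omega) (by omega), sec_eq, add_sub_cancel_right, mul_div_cancel₀ _ hh.ne']
        have h2 : a (k + n + 1) ^ 2 - a (k + n) ^ 2
            = h * (s (k + n + 1) * (a (k + n + 1) + a (k + n))) := by
          rw [← mul_assoc, ← h1]; ring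
        rw [h2, abs_mul, abs_of_pos hh, abs_mul]
        simp only [ht, add_sub_cancel_right]
        gcongr
        exact abs_add_le _ _
      have := abs_add_le (a (k + n + 1) ^ 2 - a (k + n) ^ 2) (a (k + n) ^ 2 - a k ^ 2)
      rw [sub_add_sub_cancel] at this
      linarith
  have htotal : h * ∑ j ∈ Finset.Icc (1 : ℤ) ((I : ℤ) - 1), t j
      ≤ 6 * (dnorm h I s * dnorm h I a) := by
    have h1 := le_of_abs_le (abs_inn_le (I := I) hh (fun i => |s i|)
      (fun i => |a i| + |a (i - 1)|))
    have h2 : dnorm h I (fun i => |s i|) = dnorm h I s := by simp [dnorm, normSq]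
    have h3 : dnorm h I (fun i => |a i| + |a (i - 1)|) ≤ 3 * dnorm h I a := by
      have := dnorm_le_of_stencil hh (c := 1) zero_le_one (hg.fwd h)
        (P := fun i => |a i| + |a (i - 1)|) fun i => by
          rw [abs_of_nonneg (by positivity)]
          linarith [abs_nonneg (fwd h g (i + 1))]
      linarith
    rw [h2] at h1
    calc _ = inn h I (fun i => |s i|) (fun i => |a i| + |a (i - 1)|) := rfl
      _ ≤ _ := h1
      _ ≤ dnorm h I s * (3 * dnorm h I a) := by gcongr
      _ ≤ _ := by
        have := mul_nonneg hn' hn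
        linarith
  have osc : ∀ k m : ℤ, 2 ≤ k → k ≤ m → m ≤ (I : ℤ) - 3 →
      |a m ^ 2 - a k ^ 2| ≤ 6 * (dnorm h I s * dnorm h I a) := by
    intro k m hk hkm hm
    obtain ⟨n, rfl⟩ : ∃ n : ℕ, m = k + n := ⟨(m - k).toNat, by omega⟩
    refine (step n k hk hm).trans (le_trans ?_ htotal)
    refine mul_le_mul_of_nonneg_left
      (Finset.sum_le_sum_of_subset_of_nonneg (fun j hj => ?_) fun _ _ _ => ht0 _) hh.le
    simp only [Finset.mem_Ioc, Finset.mem_Icc] at hj ⊢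
    omega
  have hI10 : (10 : ℝ) ≤ I := by
    have : 10 * h ≤ I * h := by rw [hIh]; exact hhL
    exact le_of_mul_le_mul_right this hh
  have hI10' : 10 ≤ I := by exact_mod_cast hI10
  -- The smallest value of (g_x)² is at most the mean over I - 4 nodes, and 10h ≤ L gives (I - 4)h ≥
  -- L/2. The oscillation bound carries this to the other nodes.
  obtain ⟨k, hk, hmin⟩ := Finset.exists_min_image (Finset.Icc (2 : ℤ) ((I : ℤ) - 3))
    (fun k => a k ^ 2) ⟨2, by simp only [Finset.mem_Icc]; omega⟩
  have hk' := Finset.mem_Icc.1 hk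
  have hak : a k ^ 2 ≤ 2 / L * dnorm h I a ^ 2 := by
    have h1 : ((I : ℝ) - 4) * a k ^ 2 ≤ ∑ j ∈ Finset.Icc (1 : ℤ) ((I : ℤ) - 1), |a j| ^ 2 := by
      have hc := Finset.card_nsmul_le_sum (Finset.Icc (2 : ℤ) ((I : ℤ) - 3)) (fun k => a k ^ 2) _
        hmin
      have hcard : ((Finset.Icc (2 : ℤ) ((I : ℤ) - 3)).card : ℝ) = (I : ℝ) - 4 := by
        rw [Int.card_Icc, show ((I : ℤ) - 3 + 1 - 2).toNat = I - 4 by omega,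
          Nat.cast_sub (by omega)]
        norm_num
      rw [nsmul_eq_mul, hcard] at hc
      refine hc.trans ?_
      calc _ ≤ ∑ j ∈ Finset.Icc (1 : ℤ) ((I : ℤ) - 1), a j ^ 2 := by
            refine Finset.sum_le_sum_of_subset_of_nonneg (fun j hj => ?_) fun j _ _ => sq_nonneg _
            simp only [Finset.mem_Icc] at hj ⊢
            omega
        _ = _ := by simp only [sq_abs]
    rw [dnorm_sq hh, normSq]
    have h2 := mul_le_mul_of_nonneg_left h1 hh.le
    have h3 : L / 2 * a k ^ 2 ≤ h * (((I : ℝ) - 4) * a k ^ 2) := by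
      rw [← mul_assoc]
      gcongr
      nlinarith
    rw [div_mul_eq_mul_div, le_div_iff₀ hL]
    linarith
  have hik : |a i ^ 2 - a k ^ 2| ≤ 6 * (dnorm h I s * dnorm h I a) := by
    rcases le_total k i with hki | hki
    · exact osc k i hk'.1 hki (by omega)
    · rw [abs_sub_comm]
      exact osc i k (by omega) hki hk'.2
  linarith [le_of_abs_le hik]

end Duality

/-! ### Quadratic convergence in the discrete L² norm -/

lemma dnorm_sub_comm (h : ℝ) (I : ℕ) (f g : ℤ → ℝ) : dnorm h I (f - g) = dnorm h I (g - f) := by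
  simp only [dnorm, normSq, Pi.sub_apply, abs_sub_comm]

/-- Quadratic convergence of the iteration in the discrete `L²` norm. -/
theorem exists_dnorm_quadratic_le (p : Coeffs) (hα : 0 < p.α) {L : ℝ} (hL : 0 < L) (B C₁ : ℝ) :
    ∃ C : ℝ, 0 < C ∧ ∀ (ε h τ : ℝ) (I : ℕ) (ψ w e : ℤ → ℝ), 0 < ε → ε ≤ 1 → 0 < h → h ≤ ε →
      I * h = L → 10 * h ≤ L → 0 < τ → LinzBound p ε h I B C₁ →
      C₁ * (τ / (ε * h ^ 2)) ≤ 1 / 2 → (∀ i, |ψ i| ≤ B) → (∀ i, |w i| ≤ B) →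
      VanishesAtEnds I w → VanishesAtEnds I e →
      (∀ i : ℤ, 3 ≤ i → i ≤ (I : ℤ) - 3 →
        (mass p ε h e + τ • linz p ε h ψ e) i = τ * rmd p ε h ψ w i) →
      dnorm h I e ≤ C * τ / (ε * √ε) * en p ε h I w ^ 2 := by
  set Cg := √(2 / (L * p.α ^ 2) + 12 / p.α ^ 3) with hCg
  set K := |p.c₁| * (2 * |B| * (14 / (p.α * √p.α) + 27 * Cg))
    + ((|p.c₂ - p.c₃| + |p.c₃|) * (Cg / p.α ^ 2) + 9 * |p.c₃| * (2 / (p.α ^ 3 * √p.α))) with hK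
  have hK0 : 0 ≤ K := by positivity
  refine ⟨2 * K + 1, by positivity, ?_⟩
  intro ε h τ I ψ w e hε hε1 hh hhε hIh hhL hτ H₁ hC₁ hψ hw hwV heV heq
  have hB : 0 ≤ B := (abs_nonneg _).trans (hψ 0)
  have hr : 0 < √ε := Real.sqrt_pos.2 hε
  have hr2 : √ε ^ 2 = ε := Real.sq_sqrt hε.le
  -- The dual problem: with τ = 0 the operator `stepOp` is the mass operator, so `g` solves g - α²ε²
  -- g_xx̄ = e at the interior nodes.
  obtain ⟨g, hg, hge⟩ := exists_solution_of_injective I (stepOp p ε h 0 0)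
    (fun v hv h0 => by
      have h1 := inn_congr (h := h) hv (f := mass p ε h v) (f' := 0) fun i i1 i2 => by
        simpa [stepOp] using h0 i i1 i2
      have h2 : enSq p ε h I v = 0 := by
        rw [← inn_mass_self hv.near, h1]; simp [inn]
      refine eq_zero_of_en (p := p) (ε := ε) hh hv ?_
      rw [en, h2, Real.sqrt_zero]) e
  have hge' : ∀ i : ℤ, 3 ≤ i → i ≤ (I : ℤ) - 3 → mass p ε h g i = e i := fun i i1 i2 => by
    simpa [stepOp] using hge i i1 i2
  set n := dnorm h I e with hn
  set N := en p ε h I w with hN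
  have hn0 : 0 ≤ n := dnorm_nonneg _
  have hN0 : 0 ≤ N := en_nonneg _
  have hen : en p ε h I g ≤ n := by
    have h1 : en p ε h I g ^ 2 = inn h I e g := by
      rw [en_sq hh, ← inn_mass_self hg.near]; exact inn_congr hg hge'
    have h2 := le_of_abs_le (abs_inn_le (I := I) hh e g)
    have h3 := dnorm_le_en (p := p) (ε := ε) (I := I) hh g
    have h4 := en_nonneg (p := p) (ε := ε) (h := h) (I := I) g
    have h5 : en p ε h I g * en p ε h I g ≤ n * en p ε h I g := by
      calc _ = inn h I e g := by rw [← h1, pow_two]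
        _ ≤ n * dnorm h I g := h2
        _ ≤ _ := by gcongr
    by_contra hcon
    push Not at hcon
    exact absurd (le_of_mul_le_mul_right h5 (hn0.trans_lt hcon)) (not_le.2 hcon)
  have hdg : dnorm h I g ≤ n := (dnorm_le_en hh g).trans hen
  have hfg : dnorm h I (fwd h g) ≤ n / (p.α * ε) :=
    (dnorm_fwd_le_en hα hε hh g).trans (by gcongr)
  -- The dual equation solved for the second difference, extended by zero.
  set s : ℤ → ℝ := (1 / (p.α ^ 2 * ε ^ 2)) • (g - e) with hs
  have hsV : VanishesAtEnds I s := fun i hi => by simp [hs, hg i hi, heV i hi]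
  have hsec : ∀ i : ℤ, 3 ≤ i → i ≤ (I : ℤ) - 3 → sec h g i = s i := fun i i1 i2 => by
    have h1 : g i - p.α ^ 2 * ε ^ 2 * sec h g i = e i := hge' i i1 i2
    simp only [hs, Pi.smul_apply, Pi.sub_apply, smul_eq_mul]
    rw [← h1]; field_simp; ring
  have hsn : dnorm h I s ≤ 2 * n / (p.α ^ 2 * ε ^ 2) := by
    have h1 : normSq h I s ≤ (2 * n / (p.α ^ 2 * ε ^ 2)) ^ 2 := by
      have h2 : normSq h I s ≤ (1 / (p.α ^ 2 * ε ^ 2)) ^ 2 * (2 * normSq h I g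
          + 2 * normSq h I e) := by
        unfold normSq
        calc _ ≤ h * ∑ i ∈ Finset.Icc (1 : ℤ) ((I : ℤ) - 1),
              (1 / (p.α ^ 2 * ε ^ 2)) ^ 2 * (2 * |g i| ^ 2 + 2 * |e i| ^ 2) := by
              gcongr with i _
              simp only [hs, Pi.smul_apply, Pi.sub_apply, smul_eq_mul, sq_abs, mul_pow]
              gcongr
              nlinarith [sq_nonneg (g i + e i)]
          _ = _ := by
              rw [← Finset.mul_sum, Finset.sum_add_distrib, ← Finset.mul_sum, ← Finset.mul_sum]
              ring
      have h3 : normSq h I g ≤ n ^ 2 := by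
        rw [← dnorm_sq hh]
        have := dnorm_nonneg (h := h) (I := I) g
        gcongr
      rw [← dnorm_sq hh e] at h2
      calc _ ≤ _ := h2
        _ ≤ (1 / (p.α ^ 2 * ε ^ 2)) ^ 2 * (2 * n ^ 2 + 2 * n ^ 2) := by gcongr
        _ = _ := by ring
    calc _ ≤ √((2 * n / (p.α ^ 2 * ε ^ 2)) ^ 2) := Real.sqrt_le_sqrt h1
      _ = _ := Real.sqrt_sq (by positivity)
  have hG : ∀ i, |g i| ≤ n / (√p.α * √ε) := fun i => by
    rw [← Real.sqrt_mul hα.le]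
    exact (abs_le_en hα hε hh hg i).trans (by gcongr)
  have hG' : ∀ i, |fwd h g i| ≤ Cg * n / (ε * √ε) := fun i => by
    have h1 := sq_fwd_le hh hL hIh hhL hg hsec i
    refine abs_le_of_sq_le_sq (h1.trans ?_) (by positivity)
    have := dnorm_nonneg (h := h) (I := I) s
    have := dnorm_nonneg (h := h) (I := I) (fwd h g)
    calc _ ≤ 2 / L * (n / (p.α * ε)) ^ 2
          + 6 * (2 * n / (p.α ^ 2 * ε ^ 2) * (n / (p.α * ε))) := by gcongr
      _ = n ^ 2 * (2 / (L * p.α ^ 2) * (1 / ε ^ 2) + 12 / p.α ^ 3 * (1 / ε ^ 3)) := by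
          field_simp; ring
      _ ≤ n ^ 2 * (2 / (L * p.α ^ 2) * (1 / ε ^ 3) + 12 / p.α ^ 3 * (1 / ε ^ 3)) := by
          gcongr n ^ 2 * (_ * (1 / ?_) + _)
          exact pow_le_pow_of_le_one hε.le hε1 (by norm_num)
      _ = Cg ^ 2 * n ^ 2 / (ε ^ 2 * √ε ^ 2) := by
          rw [hr2, hCg, Real.sq_sqrt (by positivity)]; field_simp
      _ = _ := by ring
  have hS : ∀ i, |w i| ≤ N / (√p.α * √ε) := fun i => by
    rw [← Real.sqrt_mul hα.le]
    exact abs_le_en hα hε hh hwV i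
  have hwn : dnorm h I w ≤ N := dnorm_le_en hh w
  have hwf : dnorm h I (fwd h w) ≤ N / (p.α * ε) := dnorm_fwd_le_en hα hε hh w
  have hw0 := dnorm_nonneg (h := h) (I := I) w
  have hwf0 := dnorm_nonneg (h := h) (I := I) (fwd h w)
  have hs0 := dnorm_nonneg (h := h) (I := I) s
  -- All four contributions scale alike, as ε^(-3/2), once the ε² in front of Q₂ is counted.
  have hrm : |inn h I (rmd p ε h ψ w) g| ≤ K * (n * N ^ 2 / (ε * √ε)) := by
    have b1 := abs_inn_R1_quadratic_le (B := 2 * B) (v := ψ + (1 / 3 : ℝ) • w) hh hwV hg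
      (fun i => by
        simp only [Pi.add_apply, Pi.smul_apply, smul_eq_mul]
        have := abs_add_le (ψ i) (1 / 3 * w i)
        rw [abs_mul (1 / 3 : ℝ), abs_of_pos (by norm_num : (0 : ℝ) < 1 / 3)] at this
        linarith [hw i, hψ i]) hG hG'
    have b2 := abs_inn_Q2_quadratic_le (p := p) hh hwV hg hG' hsV hsec hS
    unfold rmd
    rw [inn_sub_left, inn_smul_left, inn_smul_left]
    calc _ ≤ |p.c₁| * |inn h I (R1 h w (ψ + (1 / 3 : ℝ) • w)) g|
          + ε ^ 2 * |inn h I (Q2 p h w) g| := by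
          refine (abs_sub _ _).trans (le_of_eq ?_)
          rw [abs_mul, abs_mul (ε ^ 2), abs_of_nonneg (sq_nonneg ε)]
      _ ≤ |p.c₁| * (2 * B * (14 * (n / (√p.α * √ε)) * (N / (p.α * ε) * N)
            + 27 * (Cg * n / (ε * √ε)) * N ^ 2))
          + ε ^ 2 * ((|p.c₂ - p.c₃| + |p.c₃|) * (Cg * n / (ε * √ε) * (N / (p.α * ε)) ^ 2)
            + 9 * |p.c₃| * (N / (√p.α * √ε) * (N / (p.α * ε))
              * (2 * n / (p.α ^ 2 * ε ^ 2)))) := by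
          gcongr
          · refine b1.trans ?_
            gcongr
          · refine b2.trans ?_
            gcongr
      _ = _ := by
          rw [hK, abs_of_nonneg hB]
          field_simp
  -- The mass form is symmetric, so pairing the error equation with `g` produces ‖e‖².
  have hdual : n ^ 2 = inn h I (mass p ε h e) g := by
    rw [dnorm_sq hh, ← inn_self, inn_mass hg.near, ← inn_congr heV hge', inn_mass heV.near,
      inn_comm h I e, inn_comm h I (fwd h e)]
  have h1 : inn h I (mass p ε h e + τ • linz p ε h ψ e) g = inn h I (τ • rmd p ε h ψ w) g :=
    inn_congr hg heq
  rw [inn_add_left, inn_smul_left, inn_smul_left, ← hdual] at h1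
  have h2 := neg_le_of_abs_le (H₁ ψ e g hψ heV hg)
  have h3 := le_of_abs_le hrm
  -- Here the L² norm of `e` and the energy norm of `g`, both at most `n`, let the linearized term
  -- be absorbed.
  have h4 : τ * (C₁ * (1 / (ε * h ^ 2) * n * en p ε h I g)) ≤ 1 / 2 * n ^ 2 := by
    have := en_nonneg (p := p) (ε := ε) (h := h) (I := I) g
    calc _ = C₁ * (τ / (ε * h ^ 2)) * (n * en p ε h I g) := by ring
      _ ≤ 1 / 2 * (n * en p ε h I g) := by gcongr
      _ ≤ 1 / 2 * (n * n) := by gcongr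
      _ = _ := by ring
  have h5 := mul_le_mul_of_nonneg_left h2 hτ.le
  have h6 := mul_le_mul_of_nonneg_left h3 hτ.le
  have h7 : n * n ≤ n * (2 * K * τ / (ε * √ε) * N ^ 2) := by
    have : τ * (K * (n * N ^ 2 / (ε * √ε))) = n * (K * τ / (ε * √ε) * N ^ 2) := by ring
    have : n * (2 * K * τ / (ε * √ε) * N ^ 2) = 2 * (n * (K * τ / (ε * √ε) * N ^ 2)) := by ring
    linarith
  have h8 : n ≤ 2 * K * τ / (ε * √ε) * N ^ 2 := by
    by_contra hcon
    push Not at hcon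
    have : 0 ≤ 2 * K * τ / (ε * √ε) * N ^ 2 := by positivity
    exact absurd (le_of_mul_le_mul_left h7 (this.trans_lt hcon)) (not_le.2 hcon)
  refine h8.trans ?_
  gcongr
  linarith

lemma IsLinearizedStep.error_eq {p : Coeffs} {ε h τ : ℝ} {I : ℕ} {yOld ψ φ z : ℤ → ℝ}
    (hφ : IsLinearizedStep p ε h τ I yOld ψ φ) (hz : IsNonlinearStep p ε h τ I yOld z)
    (i : ℤ) (h1 : 3 ≤ i) (h2 : i ≤ (I : ℤ) - 3) :
    (mass p ε h (φ - z) + τ • linz p ε h ψ (φ - z)) i = τ * rmd p ε h ψ (z - ψ) i := by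
  have e1 := hφ.increment i h1 h2
  have e2 := hz.rmd_eq (ψ := ψ) i h1 h2
  rw [mass_sub, linz_sub] at e1 e2 ⊢
  simp only [Pi.add_apply, Pi.smul_apply, smul_eq_mul, Pi.sub_apply] at e1 e2 ⊢
  linarith

lemma continuous_dnorm2 (ε h τ : ℝ) (I : ℕ) : Continuous fun f : ℤ → ℝ => dnorm2 ε h τ I f := by
  simp only [dnorm2, normSq, Pi.smul_apply, fwd_apply, sec_apply]
  fun_prop

lemma tendsto_dnorm2 {ε h τ : ℝ} {I : ℕ} {φ : ℕ → ℤ → ℝ} {z : ℤ → ℝ}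
    (hφ : Tendsto φ atTop (𝓝 z)) :
    Tendsto (fun s => dnorm2 ε h τ I (φ s - z)) atTop (𝓝 0) := by
  have h1 : Tendsto (fun s => φ s - z) atTop (𝓝 0) := by
    simpa using hφ.sub_const z
  have h2 : dnorm2 ε h τ I 0 = 0 := by simp [dnorm2, normSq, fwd_apply, sec_apply]
  simpa [h2, Function.comp_def] using ((continuous_dnorm2 ε h τ I).tendsto 0).comp h1

/-- An inverse inequality: f_x costs 1/h, so the energy norm exceeds the L² norm by a factor of
order ε/h, which is at least 1. -/
lemma enSq_le_dnorm_sq {p : Coeffs} {ε h : ℝ} {I : ℕ} (hh : 0 < h) (hhε : h ≤ ε)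
    {f : ℤ → ℝ} (hf : VanishesAtEnds I f) :
    enSq p ε h I f ≤ (1 + 9 * p.α ^ 2) * (ε ^ 2 / h ^ 2) * dnorm h I f ^ 2 := by
  have h1 := dnorm_fwd_le hh hf
  have h2 : 1 ≤ ε ^ 2 / h ^ 2 := by
    rw [le_div_iff₀ (by positivity), one_mul]; gcongr
  rw [enSq, ← dnorm_sq hh, ← dnorm_sq hh]
  have h0 := dnorm_nonneg (h := h) (I := I) (fwd h f)
  calc _ ≤ 1 * dnorm h I f ^ 2 + p.α ^ 2 * ε ^ 2 * (3 / h * dnorm h I f) ^ 2 := by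
        rw [one_mul]; gcongr
    _ ≤ ε ^ 2 / h ^ 2 * dnorm h I f ^ 2 + p.α ^ 2 * ε ^ 2 * (3 / h * dnorm h I f) ^ 2 := by
        gcongr
    _ = _ := by ring

end GmKdV

/-! ### Proof of the theorem -/

open GmKdV

theorem mainTheorem1 (p : GmKdV.Coeffs) (hα : 0 < p.α) (hγ : 0 ≤ p.γ)
    (L T M : ℝ) (hL : 0 < L) (hT : 0 < T) (hM : 0 < M) :
    ∃ q₁ : ℝ, 0 < q₁ ∧ ∃ q₂ : ℝ, 0 < q₂ ∧ ∃ c : ℝ, 0 < c ∧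
      ∀ (ε : ℝ) (I J : ℕ) (h τ : ℝ), 0 < ε → ε ≤ 1 → 0 < I → 0 < J →
        h = L / I → τ = T / J → τ ≤ q₁ * ε * h ^ 2 → h ≤ q₂ * ε →
      ∀ u0 : ℝ → ℝ, GmKdV.SobolevBound (L / ε) M u0 → u0 0 = 0 → u0 (L / ε) = 0 →
      ∀ (j : ℕ) (y : ℕ → ℤ → ℝ), 1 ≤ j → j ≤ J →
        y 0 = GmKdV.initialData ε h I u0 →
        (∀ k : ℕ, k + 1 < j → GmKdV.IsNonlinearStep p ε h τ I (y k) (y (k + 1))) →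
        (∀ k : ℕ, k < j → GmKdV.IsEvenGrid (y k)) →
      ∃ φ : ℕ → ℤ → ℝ,
        GmKdV.IsIteration p ε h τ I (y (j - 1)) φ ∧
        (∀ ψ : ℕ → ℤ → ℝ, GmKdV.IsIteration p ε h τ I (y (j - 1)) ψ → ψ = φ) ∧
        ∃ z : ℤ → ℝ,
          GmKdV.IsNonlinearStep p ε h τ I (y (j - 1)) z ∧
          (∀ z' : ℤ → ℝ, GmKdV.IsNonlinearStep p ε h τ I (y (j - 1)) z' →
            GmKdV.IsEvenGrid z' → z' = z) ∧
          Tendsto (fun s => GmKdV.dnorm2 ε h τ I (φ s - z)) atTop (𝓝 0) ∧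
          GmKdV.dnorm h I (z - φ 2) ≤ c * τ ^ 4 := by
  obtain ⟨q, hq, B, hB, C₁, hC₁, C, hC, hCq, hmain⟩ := exists_iteration_limit p hα hγ
    (C₀ := M ^ 2 * (1 + 16 * p.α ^ 2)) (by positivity)
  obtain ⟨D, hD, hquad⟩ := exists_dnorm_quadratic_le p hα hL B C₁
  -- The bound on h/ε ensures h ≤ ε and 10h ≤ L. The last constant is produced by two quadratic
  -- steps followed by τ³ ≤ (qεh²)³.
  refine ⟨q, hq, min 1 (L / 10), by positivity,
    D ^ 3 * (1 + 9 * p.α ^ 2) * C ^ 4 * q ^ 3, by positivity, ?_⟩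
  intro ε I J h τ hε hε1 hI hJ hh hτJ hτq hhq u0 hu hl hr j y hj hjJ hy0 hstep heven
  have hI' : (0 : ℝ) < I := by exact_mod_cast hI
  have hJ' : (0 : ℝ) < J := by exact_mod_cast hJ
  have hh0 : 0 < h := by rw [hh]; positivity
  have hτ0 : 0 < τ := by rw [hτJ]; positivity
  have hIh : (I : ℝ) * h = L := by rw [hh]; field_simp
  have hhε : h ≤ ε := by
    calc h ≤ min 1 (L / 10) * ε := hhq
      _ ≤ 1 * ε := by gcongr; exact min_le_left _ _
      _ = ε := one_mul ε
  have hhL : 10 * h ≤ L := by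
    have : h ≤ L / 10 * 1 := by
      calc h ≤ min 1 (L / 10) * ε := hhq
        _ ≤ L / 10 * 1 := by gcongr; exact min_le_right _ _
    linarith
  -- Evenness of every level carries the initial energy bound forward with the same constant,
  -- independent of the number of levels.
  have levels : ∀ k : ℕ, k < j → VanishesAtEnds I (y k) ∧
      enSq p ε h I (y k) ≤ M ^ 2 * (1 + 16 * p.α ^ 2) * ε := by
    intro k
    induction k with
    | zero =>
      intro _
      rw [hy0]
      exact ⟨initialData_vanishes ε h I u0, enSq_initialData_le p hL hε hI hh hu hl hr⟩
    | succ k ih =>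
      intro hk
      have hs := hstep k hk
      exact ⟨hs.1, (hs.enSq_le hγ hh0 hτ0.le (heven _ hk)).trans (ih (by omega)).2⟩
  obtain ⟨hV, hE⟩ := levels (j - 1) (by omega)
  obtain ⟨L₁, φ, hφ, huniq, hφB, z, hz, hzB, hzuniq, hzen, hlim⟩ :=
    hmain ε h τ I (y (j - 1)) hε hε1 hh0 hhε hτ0 hτq hV hE
  refine ⟨φ, hφ, huniq, z, hz, fun z' hz' he => hzuniq z' hz'
    ((hz'.enSq_le hγ hh0 hτ0.le he).trans hE), tendsto_dnorm2 hlim, ?_⟩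
  have hτ' : τ / (ε * h ^ 2) ≤ q := by
    rw [div_le_iff₀ (by positivity)]; linarith
  have hk1 : C₁ * (τ / (ε * h ^ 2)) ≤ 1 / 2 := le_trans (by gcongr) hCq
  have hφV : ∀ s, VanishesAtEnds I (φ s) := fun s => by
    cases s with
    | zero => rw [hφ.1]; exact hV
    | succ s => exact (hφ.2 s).1
  have quad : ∀ s, dnorm h I (z - φ (s + 1))
      ≤ D * τ / (ε * √ε) * en p ε h I (z - φ s) ^ 2 := fun s => by
    rw [dnorm_sub_comm]
    exact hquad ε h τ I (φ s) (z - φ s) (φ (s + 1) - z) hε hε1 hh0 hhε hIh hhL hτ0 L₁ hk1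
      (hφB s) (hzB s) (hz.1.sub (hφV s)) ((hφV (s + 1)).sub hz.1) ((hφ.2 s).error_eq hz)
  have hr0 : 0 < √ε := Real.sqrt_pos.2 hε
  have hr1 : √ε ≤ 1 := Real.sqrt_le_one.2 hε1
  have hr2 : ε = √ε ^ 2 := (Real.sq_sqrt hε.le).symm
  have first : dnorm h I (z - φ 1) ≤ D * C ^ 2 * τ ^ 3 / (√ε * h ^ 2) := by
    rw [← hφ.1] at hzen
    have h0 := en_nonneg (p := p) (ε := ε) (h := h) (I := I) (z - φ 0)
    calc _ ≤ D * τ / (ε * √ε) * en p ε h I (z - φ 0) ^ 2 := quad 0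
      _ ≤ D * τ / (ε * √ε) * (C * τ * √ε / h) ^ 2 := by gcongr
      _ = D * C ^ 2 * τ ^ 3 / (√ε * h ^ 2) * (√ε ^ 2 / ε) := by field_simp
      _ = _ := by rw [← hr2, div_self hε.ne', mul_one]
  have hd0 := dnorm_nonneg (h := h) (I := I) (z - φ 1)
  -- Two quadratic steps give τ⁷; three of these powers pay for h^(-6) and the negative power of ε.
  have hτ3 : τ ^ 3 ≤ (q * ε * h ^ 2) ^ 3 := by gcongr
  calc _ ≤ D * τ / (ε * √ε) * en p ε h I (z - φ 1) ^ 2 := quad 1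
    _ ≤ D * τ / (ε * √ε) * ((1 + 9 * p.α ^ 2) * (ε ^ 2 / h ^ 2)
        * (D * C ^ 2 * τ ^ 3 / (√ε * h ^ 2)) ^ 2) := by
        rw [en_sq hh0]
        gcongr
        exact (enSq_le_dnorm_sq hh0 hhε (hz.1.sub (hφV 1))).trans (by gcongr)
    _ = D ^ 3 * (1 + 9 * p.α ^ 2) * C ^ 4 * τ ^ 4 * (ε / (√ε * √ε ^ 2 * h ^ 6)) * τ ^ 3 := by
        field_simp
    _ ≤ D ^ 3 * (1 + 9 * p.α ^ 2) * C ^ 4 * τ ^ 4 * (ε / (√ε * √ε ^ 2 * h ^ 6))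
        * (q * ε * h ^ 2) ^ 3 := by gcongr
    _ = D ^ 3 * (1 + 9 * p.α ^ 2) * C ^ 4 * q ^ 3 * τ ^ 4 * √ε ^ 5 := by
        rw [← hr2]
        have : ε ^ 3 = √ε ^ 6 := by rw [← Real.sq_sqrt hε.le, Real.sqrt_sq hr0.le]; ring
        field_simp
        exact this
    _ ≤ D ^ 3 * (1 + 9 * p.α ^ 2) * C ^ 4 * q ^ 3 * τ ^ 4 * 1 := by
        gcongr
        exact pow_le_one₀ hr0.le hr1
    _ = _ := mul_one _
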